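/- Let $n\ge 3$, $\lambda>0$, $p=\lfloor\frac{n+1}{2}\rfloor-1$, $q=\lfloor\frac n2\rfloor$. **Kerr–de Sitter data.** Use coordinates $t,\ \alpha_1,\dots,\alpha_p>0,\ \phi_1,\dots,\phi_q$ with $\sum_{i\le p}\alpha_i^2<1$, $0<\phi_i<2\pi$, and put $\alpha_{p+1}=(1-\sum_{i\le p}\alpha_i^2)^{1/2}$. For rotation parameters $a=(a_1,\dots,a_q)\in\mathbb R^q$ (with $a_{p+1}:=0$ if $n$ is odd) and mass $M\in\mathbb R$ put $\hat\alpha_i=\alpha_i(1+\lambda a_i^2)^{-1/2}$, $W=\sum_{i=1}^{p+1}\hat\alpha_i^2$, $\Xi=\sum_{i=1}^{p+1}\frac{\alpha_i^2}{1+\rho^2a_i^2}$, $\Pi=\prod_{i=1}^q(1+\rho^2a_i^2)$. The Kerr–de Sitter metric, in the coordinates $(\rho,t,\alpha,\phi)$, is $$\tilde g=-W\tfrac{\rho^2-\lambda}{\rho^2}dt^2+\tfrac{\Xi}{\rho^2-\lambda}\tfrac{d\rho^2}{\rho^2}+\delta_{p,q}\tfrac{d\hat\alpha_{p+1}^2}{\rho^2}+\sum_{i=1}^q\tfrac{1+\rho^2a_i^2}{\rho^2}(d\hat\alpha_i^2+\hat\alpha_i^2d\phi_i^2)+\tfrac{\rho^2-\lambda}{\lambda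 W\rho^2}\tfrac{dW^2}{4}+\tfrac{2M\rho^{n-2}}{\Pi\,\Xi}\,k\otimes k ,$$ $$k=W\,dt-\tfrac{\Xi}{\rho^2-\lambda}d\rho-\sum_{i=1}^q a_i\hat\alpha_i^2d\phi_i .$$ Its data at $\rho=0$ are $(\gamma_a,\ \kappa_M D_{\xi_a})$, where $$\gamma_a=\lambda W dt^2+\delta_{p,q}d\hat\alpha_{p+1}^2+\sum_{i=1}^q(d\hat\alpha_i^2+\hat\alpha_i^2d\phi_i^2)-\tfrac{dW^2}{4W},\quad \xi_a=\tfrac1\lambda\partial_t-\sum_{i=1}^q a_i\partial_{\phi_i},\quad \kappa_M=-n(n-2)M\lambda^{-n/2},$$ and $D_Y=|Y|_\gamma^{-(n+2)}\big(Y^\flat\otimes Y^\flat-\tfrac{|Y|_\gamma^2}{n}\gamma\big)$ for a vector field $Y$ and a metric $\gamma$ (away from the zeros of $Y$). **Kerr–de Sitter-like data** are $(U,\gamma,\kappa D_Y)$ with $\gamma$ a smooth, locally conformally flat Riemannian metric on a connected coordinate domain $U\subset\mathbb R^n$, $Y$ a nowhere zero conformal Killing vector field (CKVF) of $\gamma$,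 and $\kappa\in\mathbb R$. Two fields are in the same conformal class if a local conformal diffeomorphism, defined on some non-empty open set, maps one to the other. Data $(U,\gamma,D)$, $(U',\gamma',D')$ are equivalent if on some non-empty open set there is a local diffeomorphism $\varphi$ and a smooth $\omega>0$ with $\varphi^*\gamma'=\omega^2\gamma$, $\varphi^*D'=\omega^{2-n}D$. **Conformal classes.** Let $F$ be a skew-symmetric endomorphism of Minkowski space $\mathbb M^{1,n+1}$, with matrix in an orthonormal basis $$F=\begin{pmatrix}0&-\nu&-a^t+b^t/2\\-\nu&0&-a^t-b^t/2\\-a+b/2&a+b/2&-\omega\end{pmatrix}.$$ It defines the CKVF $Y_F=b+\nu X+\langle a,X\rangle X-\frac12|X|^2a-\omega X$ of $\mathbb E^n$. The space of conformal classes is $\mathrm{SkewEnd}(\mathbb M^{1,n+1})/O^+(1,n+1)$ (adjoint action) with the quotient topology. Let $\mathcal Q_{F^2}$ be the monic polynomial whose square is the characteristic polynomial of $-F^2$ ($n$ even), respectively that polynomial divided by $x$ ($n$ odd). The parameters of the class of $F$ are the $q+1$ roots of $\mathcal Q_{F^2}$, with multiplicity, arranged as follows. * $n$ odd: $(\sigma;\mu_1^2,\dots,\mu_p^2)$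 with $\sigma\ge\mu_1^2\ge\dots\ge\mu_p^2$ if $\ker F$ is timelike, and $\mu_1^2\ge\dots\ge\mu_p^2\ge0\ge\sigma$ otherwise. * $n$ even: $(-\mu_t^2,\mu_s^2;\mu_1^2,\dots,\mu_p^2)$ with $\mu_1^2\ge\dots\ge\mu_p^2\ge\mu_s^2=-\mu_t^2=0$ if $\ker F$ is degenerate, and $\mu_s^2\ge\mu_1^2\ge\dots\ge\mu_p^2\ge0\ge-\mu_t^2$ otherwise. For $0\le m\le q$, $\mathcal R_-^{(n,m)}$ is the set of parameter vectors whose first entry ($\sigma$ or $-\mu_t^2$) is negative and whose other $q$ entries ($\mu_1^2,\dots,\mu_p^2$ for $n$ odd, $\mu_s^2,\mu_1^2,\dots,\mu_p^2$ for $n$ even) are non-negative and decreasing, exactly the last $m$ of them being zero. **Proposition 5.2.** 1. As $\rho\to0^+$, the components of $\rho^2\tilde g$ tangent to $\{\rho=\mathrm{const}\}$ tend to $\gamma_a$, and the restriction of $k$ to these directions tends to $\gamma_a(\xi_a,\cdot)$. If exactly $m$ of the $a_i$ vanish and the $a_i$ are ordered so that $a_1^2\ge\dots\ge a_q^2$,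 then the conformal class of $\xi_a$ contains a field $Y_F$ such that the class of $F$ has parameters $\sigma=-\lambda^{-1}$, $\mu_i^2=a_i^2$ if $n$ is odd, and $-\mu_t^2=-\lambda^{-1}$, $\mu_s^2=a_1^2$, $\mu_i^2=a_{i+1}^2$ if $n$ is even. These parameters lie in $\mathcal R_-^{(n,m)}$. 2. The family with all $a_i\neq0$ covers $\mathcal R_-^{(n,0)}$: every point of $\mathcal R_-^{(n,0)}$ is the parameter vector of some class, and for every $F$ with parameters in $\mathcal R_-^{(n,0)}$ and every $\kappa\in\mathbb R$ there are $a$ with all $a_i\ne0$ and $M\in\mathbb R$ such that $Y_F$ is in the conformal class of $c\,\xi_a$ for some constant $c>0$, and the data $(\gamma_a,\kappa_MD_{\xi_a})$ and $(\mathbb E^n,\kappa D_{Y_F})$ are equivalent. 3. If $n$ is even, Kerr–de Sitter data and their limits cover all Kerr–de Sitter-like data: for all Kerr–de Sitter-like data $(U,\gamma,\kappa D_Y)$ there is an $F$ with $Y_F$ in the conformal class of $Y$ and $(\mathbb E^n,\kappa D_{Y_F})$ equivalent to $(U,\gamma,\kappa D_Y)$, and there is a sequence $F_k\to F$, whose classes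 then converge in the quotient topology, such that each $(\mathbb E^n,\kappa D_{Y_{F_k}})$ is, in the sense of part 2, realized by Kerr–de Sitter data with all rotation parameters non-zero. -/

import Mathlib

open Set Filter Topology Matrix
open scoped ContDiff

noncomputable section

/-! ### Conformal geometry on open sets of a normed space

A Riemannian metric on an open set of `V` is written as a family `γ x u v` of bilinear forms. -/

section Conformal

variable {V W : Type*} [NormedAddCommGroup V] [NormedSpace ℝ V]
  [NormedAddCommGroup W] [NormedSpace ℝ W]

/-- `φ` is a conformal diffeomorphism, with factor `θ > 0`, from the non-empty open set
`φ.source ⊆ U` onto the open set `φ.target ⊆ U'`: one has `φ^* γ' = θ ^ 2 γ`. -/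
structure IsLocalConformal (U : Set V) (γ : V → V → V → ℝ) (U' : Set W) (γ' : W → W → W → ℝ)
    (φ : OpenPartialHomeomorph V W) (θ : V → ℝ) : Prop where
  source_nonempty : φ.source.Nonempty
  source_subset : φ.source ⊆ U
  target_subset : φ.target ⊆ U'
  contDiffOn : ContDiffOn ℝ ∞ φ φ.source
  contDiffOn_symm : ContDiffOn ℝ ∞ φ.symm φ.target
  factor_contDiffOn : ContDiffOn ℝ ∞ θ φ.source
  factor_pos : ∀ x ∈ φ.source, 0 < θ x
  pullback : ∀ x ∈ φ.source, ∀ u v : V,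
    γ' (φ x) (fderiv ℝ φ x u) (fderiv ℝ φ x v) = θ x ^ 2 * γ x u v

/-- The vector fields `Y` (on `U`, with metric `γ`) and `Y'` (on `U'`, with metric `γ'`) are in the
same conformal class: some local conformal diffeomorphism, defined on a non-empty open set, pushes
`Y` forward to `Y'`. -/
def SameConformalClass (U : Set V) (γ : V → V → V → ℝ) (Y : V → V)
    (U' : Set W) (γ' : W → W → W → ℝ) (Y' : W → W) : Prop :=
  ∃ (φ : OpenPartialHomeomorph V W) (θ : V → ℝ), IsLocalConformal U γ U' γ' φ θ ∧
    ∀ x ∈ φ.source, fderiv ℝ φ x (Y x) = Y' (φ x)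

/-- Equivalence of `n`-dimensional asymptotic data `(U, γ, D)` and `(U', γ', D')`: up to a local
diffeomorphism, `γ' = θ ^ 2 γ` and `D' = θ ^ (2 - n) D`. -/
def EquivalentData (n : ℕ) (U : Set V) (γ D : V → V → V → ℝ)
    (U' : Set W) (γ' D' : W → W → W → ℝ) : Prop :=
  ∃ (φ : OpenPartialHomeomorph V W) (θ : V → ℝ), IsLocalConformal U γ U' γ' φ θ ∧
    ∀ x ∈ φ.source, ∀ u v : V,
      D' (φ x) (fderiv ℝ φ x u) (fderiv ℝ φ x v) = θ x ^ (2 - (n : ℤ)) * D x u v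

/-- The tensor `κ D_Y`, with `D_Y = |Y| ^ (-(n+2)) (Y♭ ⊗ Y♭ - (|Y| ^ 2 / n) γ)`.  It is meaningful
away from the zeros of `Y`. -/
def ttTensor (n : ℕ) (κ : ℝ) (γ : V → V → V → ℝ) (Y : V → V) (x u v : V) : ℝ :=
  κ * ((γ x (Y x) u * γ x (Y x) v - γ x (Y x) (Y x) / n * γ x u v)
    / Real.sqrt (γ x (Y x) (Y x)) ^ (n + 2))

end Conformal

/-- Euclidean space `𝔼ⁿ`. -/
abbrev Euc (n : ℕ) : Type := EuclideanSpace ℝ (Fin n)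

/-- The flat metric of `𝔼ⁿ`. -/
def flatMetric (n : ℕ) (_x u v : Euc n) : ℝ := inner ℝ u v

/-- Data `(U, γ, Y)` for the Kerr-de Sitter-like class, in a coordinate domain `U`: a smooth
Riemannian metric `γ`, locally conformally flat, and a conformal Killing vector field `Y` of `γ`
(`L_Y γ = 2 f γ`) whose fixed points have been removed from `U`. -/
structure IsKdSLikeData (n : ℕ) (U : Set (Euc n)) (γ : Euc n → Euc n →L[ℝ] Euc n →L[ℝ] ℝ)
    (Y : Euc n → Euc n) : Prop where
  isOpen : IsOpen U
  isConnected : IsConnected U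
  metric_contDiffOn : ContDiffOn ℝ ∞ γ U
  metric_symm : ∀ x ∈ U, ∀ u v, γ x u v = γ x v u
  metric_pos : ∀ x ∈ U, ∀ u, u ≠ 0 → 0 < γ x u u
  conformallyFlat : ∀ x ∈ U, ∃ (φ : OpenPartialHomeomorph (Euc n) (Euc n)) (θ : Euc n → ℝ),
    x ∈ φ.source ∧ IsLocalConformal U (fun y u v => γ y u v) univ (flatMetric n) φ θ
  field_contDiffOn : ContDiffOn ℝ ∞ Y U
  conformalKilling : ∃ f : Euc n → ℝ, ∀ x ∈ U, ∀ u v,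
    fderiv ℝ γ x (Y x) u v + γ x (fderiv ℝ Y x u) v + γ x u (fderiv ℝ Y x v)
      = 2 * f x * γ x u v
  field_ne_zero : ∀ x ∈ U, Y x ≠ 0

/-! ### Skew-symmetric endomorphisms of Minkowski space and conformal Killing fields -/

/-- Index set of an orthonormal basis `e_0, e_1, e_2, …, e_{n+1}` of `𝕄^{1,n+1}`: `inl 0` and
`inl 1` stand for `e_0` (timelike) and `e_1`, and `inr A` for the remaining vectors. -/
abbrev MinkIdx (n : ℕ) : Type := Fin 2 ⊕ Fin n

/-- The Minkowski metric `diag(-1, 1, …, 1)`. -/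
def minkEta (n : ℕ) : Matrix (MinkIdx n) (MinkIdx n) ℝ :=
  Matrix.diagonal fun i => if i = Sum.inl 0 then -1 else 1

/-- The Minkowski scalar product. -/
def minkInner (n : ℕ) (v w : MinkIdx n → ℝ) : ℝ := v ⬝ᵥ (minkEta n *ᵥ w)

/-- Skew-symmetric endomorphisms of `𝕄^{1,n+1}`, with the topology of the space of matrices. -/
abbrev SkewEnd (n : ℕ) : Type :=
  {F : Matrix (MinkIdx n) (MinkIdx n) ℝ // Fᵀ * minkEta n = -(minkEta n * F)}

/-- `F` and `G` differ by the adjoint action of an element of the orthochronous Lorentz group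
`O⁺(1,n+1)`. -/
def OrthochronousConj (n : ℕ) (F G : SkewEnd n) : Prop :=
  ∃ L : Matrix (MinkIdx n) (MinkIdx n) ℝ, Lᵀ * minkEta n * L = minkEta n ∧
    0 < L (Sum.inl 0) (Sum.inl 0) ∧ G.1 = L * F.1 * L⁻¹

/-- The space of conformal classes, `SkewEnd(𝕄^{1,n+1}) / O⁺(1,n+1)`; it carries the quotient
topology. -/
abbrev ConfClass (n : ℕ) : Type := Quot (OrthochronousConj n)

/-- The conformal Killing field of `𝔼ⁿ` associated with a skew-symmetric endomorphism,
`b + ν X + ⟨a, X⟩ X - (|X| ^ 2 / 2) a - w X`, where `ν`, `a`, `b`, `w` are read off the matrix of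
the endomorphism; see `ckvf_skewMatrix`. -/
def ckvf {n : ℕ} (F : Matrix (MinkIdx n) (MinkIdx n) ℝ) (X : Euc n) : Euc n :=
  let ν : ℝ := -F (Sum.inl 0) (Sum.inl 1)
  let a : Euc n := WithLp.toLp 2 fun A => -(F (Sum.inl 0) (Sum.inr A) + F (Sum.inl 1) (Sum.inr A)) / 2
  let b : Euc n := WithLp.toLp 2 fun A => F (Sum.inl 0) (Sum.inr A) - F (Sum.inl 1) (Sum.inr A)
  let w : Matrix (Fin n) (Fin n) ℝ := Matrix.of fun A B => -F (Sum.inr A) (Sum.inr B)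
  b + ν • X + (inner ℝ a X) • X - (inner ℝ X X / 2) • a
    - WithLp.toLp 2 (w *ᵥ fun B => X B)

/-- The endomorphism with parameters `ν`, `a`, `b`, `w`, in block form. -/
def skewMatrix {n : ℕ} (ν : ℝ) (a b : Fin n → ℝ) (w : Matrix (Fin n) (Fin n) ℝ) :
    Matrix (MinkIdx n) (MinkIdx n) ℝ :=
  Matrix.fromBlocks !![0, -ν; -ν, 0] (Matrix.of ![-a + (1 / 2 : ℝ) • b, -a - (1 / 2 : ℝ) • b])
    (Matrix.of ![-a + (1 / 2 : ℝ) • b, a + (1 / 2 : ℝ) • b])ᵀ (-w)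

theorem ckvf_skewMatrix {n : ℕ} (ν : ℝ) (a b : Fin n → ℝ) (w : Matrix (Fin n) (Fin n) ℝ)
    (X : Euc n) :
    ckvf (skewMatrix ν a b w) X =
      WithLp.toLp 2 b + ν • X + (inner ℝ (WithLp.toLp 2 a : Euc n) X) • X
        - (inner ℝ X X / 2) • (WithLp.toLp 2 a : Euc n) - WithLp.toLp 2 (w *ᵥ fun B => X B) := by
  have ha : (WithLp.toLp 2 fun A => -((-a + (1 / 2 : ℝ) • b) A + (-a - (1 / 2 : ℝ) • b) A) / 2 :
      Euc n) = WithLp.toLp 2 a := by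
    congr 1; funext A; simp
  have hb : (WithLp.toLp 2 fun A => (-a + (1 / 2 : ℝ) • b) A - (-a - (1 / 2 : ℝ) • b) A :
      Euc n) = WithLp.toLp 2 b := by
    congr 1; funext A; simp; ring
  have hw : (Matrix.of fun A B => -(-w) A B) = w := by ext; simp
  have hν : -(-ν) = ν := neg_neg ν
  simp only [ckvf, skewMatrix, Matrix.fromBlocks_apply₁₁, Matrix.fromBlocks_apply₁₂,
    Matrix.fromBlocks_apply₂₂, Matrix.of_apply, Matrix.cons_val_zero, Matrix.cons_val_one]
  rw [ha, hb, hw, hν]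

/-! ### Parameters of a conformal class -/

/-- `p = ⌊(n+1)/2⌋ - 1`. -/
def pNum (n : ℕ) : ℕ := (n + 1) / 2 - 1

/-- `q = ⌊n/2⌋`. -/
def qNum (n : ℕ) : ℕ := n / 2

theorem qNum_le (n : ℕ) : qNum n ≤ pNum n + 1 := by
  unfold qNum pNum; omega

/-- The kernel of `F` is timelike (it contains a timelike vector). -/
def KerTimelike {n : ℕ} (F : Matrix (MinkIdx n) (MinkIdx n) ℝ) : Prop :=
  ∃ v, F *ᵥ v = 0 ∧ minkInner n v v < 0

/-- The kernel of `F` is degenerate: the Minkowski product restricted to it has a radical. -/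
def KerDegenerate {n : ℕ} (F : Matrix (MinkIdx n) (MinkIdx n) ℝ) : Prop :=
  ∃ v, v ≠ 0 ∧ F *ᵥ v = 0 ∧ ∀ w, F *ᵥ w = 0 → minkInner n v w = 0

/-- `Q` is the polynomial `𝒬_{F²}`: the monic square root of the characteristic polynomial of
`-F ^ 2` if `n` is even, and of that polynomial divided by `x` if `n` is odd. -/
def IsQPoly {n : ℕ} (F : Matrix (MinkIdx n) (MinkIdx n) ℝ) (Q : Polynomial ℝ) : Prop :=
  Q.Monic ∧ (Even n → Q ^ 2 = (-(F * F)).charpoly) ∧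
    (Odd n → Polynomial.X * Q ^ 2 = (-(F * F)).charpoly)

/-- The sorted roots of `𝒬_{F²}` that label the class of `F`.  The vector `s` has `q + 1` entries:
`s = (σ, μ₁², …, μ_p²)` for `n` odd and `s = (-μ_t², μ_s², μ₁², …, μ_p²)` for `n` even. -/
def HasParams {n : ℕ} (F : Matrix (MinkIdx n) (MinkIdx n) ℝ) (s : Fin (qNum n + 1) → ℝ) : Prop :=
  (∃ Q : Polynomial ℝ, IsQPoly F Q ∧ Q.roots = Finset.univ.val.map s) ∧
  (Odd n →
    (KerTimelike F → Antitone s) ∧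
    (¬ KerTimelike F →
      s 0 ≤ 0 ∧ Antitone (fun i : Fin (qNum n) => s i.succ) ∧ ∀ i : Fin (qNum n), 0 ≤ s i.succ)) ∧
  (Even n →
    (KerDegenerate F →
      (∀ i : Fin (qNum n + 1), (i : ℕ) ≤ 1 → s i = 0) ∧
        (∀ i j : Fin (qNum n + 1), 2 ≤ (i : ℕ) → i ≤ j → s j ≤ s i) ∧ ∀ i, 0 ≤ s i) ∧
    (¬ KerDegenerate F →
      s 0 ≤ 0 ∧ Antitone (fun i : Fin (qNum n) => s i.succ) ∧ ∀ i : Fin (qNum n), 0 ≤ s i.succ))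

/-- The conformal class `c`, a point of `SkewEnd(𝕄^{1,n+1}) / O⁺(1,n+1)`, has parameters `s`. -/
def ClassHasParams {n : ℕ} (c : ConfClass n) (s : Fin (qNum n + 1) → ℝ) : Prop :=
  ∀ F : SkewEnd n, Quot.mk _ F = c → HasParams F.1 s

/-- The region `ℛ₋^{(n,m)}`: the first entry (`σ` or `-μ_t²`) is negative and, in the remaining
decreasing list of non-negative entries (`μ₁² ≥ … ≥ μ_p²` for `n` odd and
`μ_s² ≥ μ₁² ≥ … ≥ μ_p²` for `n` even), exactly the last `m` vanish. -/
def RMinus (n m : ℕ) : Set (Fin (qNum n + 1) → ℝ) :=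
  {s | m ≤ qNum n ∧ s 0 < 0 ∧ Antitone (fun i : Fin (qNum n) => s i.succ) ∧
    (∀ i : Fin (qNum n), 0 ≤ s i.succ) ∧
    ∀ i : Fin (qNum n), s i.succ = 0 ↔ qNum n - m ≤ (i : ℕ)}

/-! ### The Kerr-de Sitter family and its data at infinity -/

/-- Coordinates `(t, (α_i)_{i ≤ p}, (φ_i)_{i ≤ q})` at infinity. -/
abbrev ScriCoord (n : ℕ) : Type := ℝ × (Fin (pNum n) → ℝ) × (Fin (qNum n) → ℝ)

/-- The domain of the coordinates: `α_i > 0`, `α_1² + … + α_p² < 1`, `0 < φ_i < 2π`. -/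
def kdsDomain (n : ℕ) : Set (ScriCoord n) :=
  {x | (∀ i, 0 < x.2.1 i) ∧ ∑ i, x.2.1 i ^ 2 < 1 ∧ ∀ i, 0 < x.2.2 i ∧ x.2.2 i < 2 * Real.pi}

/-- The functions `α_1, …, α_{p+1}`, with `α_1² + … + α_{p+1}² = 1`. -/
def kdsAlpha {n : ℕ} (x : ScriCoord n) : Fin (pNum n + 1) → ℝ :=
  Fin.snoc (α := fun _ => ℝ) x.2.1 (Real.sqrt (1 - ∑ i, x.2.1 i ^ 2))

/-- The rotation parameters `a_1, …, a_{p+1}`, with `a_{p+1} = 0` if `n` is odd. -/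
def kdsRot {n : ℕ} (a : Fin (qNum n) → ℝ) (i : Fin (pNum n + 1)) : ℝ :=
  if h : (i : ℕ) < qNum n then a ⟨i, h⟩ else 0

/-- `α̂_i = α_i / √(1 + λ a_i²)`. -/
def kdsAlphaHat {n : ℕ} (lam : ℝ) (a : Fin (qNum n) → ℝ) (i : Fin (pNum n + 1))
    (x : ScriCoord n) : ℝ :=
  kdsAlpha x i / Real.sqrt (1 + lam * kdsRot a i ^ 2)

/-- `α̂_i` for `i ≤ q`. -/
def kdsAlphaHatQ {n : ℕ} (lam : ℝ) (a : Fin (qNum n) → ℝ) (i : Fin (qNum n))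
    (x : ScriCoord n) : ℝ :=
  kdsAlphaHat lam a (Fin.castLE (qNum_le n) i) x

/-- `W = ∑ α̂_i²`. -/
def kdsW {n : ℕ} (lam : ℝ) (a : Fin (qNum n) → ℝ) (x : ScriCoord n) : ℝ :=
  ∑ i, kdsAlphaHat lam a i x ^ 2

/-- `Ξ = ∑ α_i² / (1 + ρ² a_i²)`. -/
def kdsXi {n : ℕ} (a : Fin (qNum n) → ℝ) (ρ : ℝ) (x : ScriCoord n) : ℝ :=
  ∑ i, kdsAlpha x i ^ 2 / (1 + ρ ^ 2 * kdsRot a i ^ 2)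

/-- `Π = ∏ (1 + ρ² a_i²)`. -/
def kdsPi {n : ℕ} (a : Fin (qNum n) → ℝ) (ρ : ℝ) : ℝ := ∏ i, (1 + ρ ^ 2 * a i ^ 2)

/-- The de Sitter background of the Kerr-de Sitter metric, in the coordinates
`(ρ, t, (α_i), (φ_i))`. -/
def kdsBackground {n : ℕ} (lam : ℝ) (a : Fin (qNum n) → ℝ) (ρ : ℝ) (x : ScriCoord n)
    (u v : ℝ × ScriCoord n) : ℝ :=
  -kdsW lam a x * ((ρ ^ 2 - lam) / ρ ^ 2) * (u.2.1 * v.2.1)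
  + kdsXi a ρ x / (ρ ^ 2 - lam) * (u.1 * v.1 / ρ ^ 2)
  + (if pNum n = qNum n then
      fderiv ℝ (kdsAlphaHat lam a (Fin.last (pNum n))) x u.2
        * fderiv ℝ (kdsAlphaHat lam a (Fin.last (pNum n))) x v.2 / ρ ^ 2 else 0)
  + ∑ i, (1 + ρ ^ 2 * a i ^ 2) / ρ ^ 2 *
      (fderiv ℝ (kdsAlphaHatQ lam a i) x u.2 * fderiv ℝ (kdsAlphaHatQ lam a i) x v.2
        + kdsAlphaHatQ lam a i x ^ 2 * (u.2.2.2 i * v.2.2.2 i))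
  + (ρ ^ 2 - lam) / (lam * kdsW lam a x * ρ ^ 2)
      * (fderiv ℝ (kdsW lam a) x u.2 * fderiv ℝ (kdsW lam a) x v.2 / 4)

/-- The Kerr-Schild one-form `k`. -/
def kdsK {n : ℕ} (lam : ℝ) (a : Fin (qNum n) → ℝ) (ρ : ℝ) (x : ScriCoord n)
    (u : ℝ × ScriCoord n) : ℝ :=
  kdsW lam a x * u.2.1 - kdsXi a ρ x / (ρ ^ 2 - lam) * u.1
    - ∑ i, a i * kdsAlphaHatQ lam a i x ^ 2 * u.2.2.2 i

/-- The Kerr-de Sitter metric with mass parameter `M` and rotation parameters `a_i`. -/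
def kdsMetric {n : ℕ} (lam : ℝ) (a : Fin (qNum n) → ℝ) (M ρ : ℝ) (x : ScriCoord n)
    (u v : ℝ × ScriCoord n) : ℝ :=
  kdsBackground lam a ρ x u v
    + 2 * M * ρ ^ (n - 2) / (kdsPi a ρ * kdsXi a ρ x) * (kdsK lam a ρ x u * kdsK lam a ρ x v)

/-- The boundary metric of the Kerr-de Sitter family at `ρ = 0`, for the conformal factor `ρ`. -/
def kdsGamma {n : ℕ} (lam : ℝ) (a : Fin (qNum n) → ℝ) (x u v : ScriCoord n) : ℝ :=
  lam * kdsW lam a x * (u.1 * v.1)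
  + (if pNum n = qNum n then
      fderiv ℝ (kdsAlphaHat lam a (Fin.last (pNum n))) x u
        * fderiv ℝ (kdsAlphaHat lam a (Fin.last (pNum n))) x v else 0)
  + ∑ i, (fderiv ℝ (kdsAlphaHatQ lam a i) x u * fderiv ℝ (kdsAlphaHatQ lam a i) x v
        + kdsAlphaHatQ lam a i x ^ 2 * (u.2.2 i * v.2.2 i))
  - 1 / kdsW lam a x * (fderiv ℝ (kdsW lam a) x u * fderiv ℝ (kdsW lam a) x v / 4)

/-- The conformal Killing field of the data, `ξ = λ⁻¹ ∂_t - ∑ a_i ∂_{φ_i}`. -/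
def kdsField {n : ℕ} (lam : ℝ) (a : Fin (qNum n) → ℝ) (_x : ScriCoord n) : ScriCoord n :=
  (lam⁻¹, 0, -a)

/-- The constant `κ = -n (n-2) M λ^(-n/2)` of the data. -/
def kdsKappa (n : ℕ) (lam M : ℝ) : ℝ :=
  -(n : ℝ) * ((n : ℝ) - 2) * M * lam ^ (-(n : ℝ) / 2)

/-- The Kerr-de Sitter data with parameters `M`, `a_i` realize the Kerr-de Sitter-like data
`(𝔼ⁿ, κ D_Y)` with `Y` the conformal Killing field of `F`: the field `Y` is in the conformal class
of `ξ`, scaled by a constant `c > 0`, and the two sets of data are equivalent. -/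
def KdSRealizes {n : ℕ} (lam : ℝ) (a : Fin (qNum n) → ℝ) (M κ : ℝ) (F : SkewEnd n) : Prop :=
  (∃ c : ℝ, 0 < c ∧
    SameConformalClass (kdsDomain n) (kdsGamma lam a) (fun x => c • kdsField lam a x)
      univ (flatMetric n) (ckvf F.1)) ∧
  EquivalentData n (kdsDomain n) (kdsGamma lam a)
    (ttTensor n (kdsKappa n lam M) (kdsGamma lam a) (kdsField lam a))
    {X | ckvf F.1 X ≠ 0} (flatMetric n) (ttTensor n κ (flatMetric n) (ckvf F.1))

end

/-! Everything is linearised on the light cone of `𝕄^{1,n+1}`. `𝔼ⁿ` is a chart of the projectivised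
cone (`coneProj`): any section of the cone projects conformally, and the linear vector field of a
skew `F` projects to `ckvf F` (`inner_fderiv_coneProj_comp`, `fderiv_coneProj_comp_ckvf`).

The boundary metric is `W` times the product metric of a line and a round sphere
(`kdsGamma_eq_mul`). So `kdsCone` embeds the boundary conformally in the cone, and `c • ξ` becomes a
boost of rate `c / √λ` together with rotations of rates `c a_i`. Hence `ckvf F` is conformal to `c •
ξ` as soon as `F` is such a boost plus rotations in a suitable frame
(`IsNormalFrame.exists_isLocalConformal_kds`). The tensors `D_Y` are conformally covariant, and the
constant `c` is absorbed by the mass (`IsNormalFrame.exists_kdSRealizes`).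

What remains is algebra. A non-zero real eigenvalue `ν` of `F` yields a normal frame: the
eigenvectors of `ν` and `-ν` are null and span a Lorentzian plane, and `F` is Euclidean skew on its
complement (`exists_isNormalFrame_of_eigenvector`). In such a frame the roots of `𝒬_{F²}` are `-ν²`
and the squared rotation rates, which gives the parameters. Conversely, parameters in `ℛ₋^{(n,0)}`
force a real eigenvalue and non-zero rates (`HasParams.exists_isNormalFrame`).

For general Kerr-de Sitter-like data, a flat chart turns `Y` into a conformal Killing field of a
ball in `𝔼ⁿ`, which is some `ckvf F` by the infinitesimal Liouville theorem. If `n` is even, an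
invertible `F` has negative determinant, hence a positive eigenvalue, and its rotation rates cannot
vanish. Invertible endomorphisms are dense, so every `F` is a limit of realized ones. -/

noncomputable section

/-! ### Algebra of the Minkowski product -/

theorem minkInner_eq {n : ℕ} (v w : MinkIdx n → ℝ) :
    minkInner n v w = -(v (Sum.inl 0) * w (Sum.inl 0)) + v (Sum.inl 1) * w (Sum.inl 1)
      + ∑ A, v (Sum.inr A) * w (Sum.inr A) := by
  simp [minkInner, minkEta, dotProduct, Matrix.mulVec_diagonal, Fintype.sum_sum_type]

theorem minkInner_comm {n : ℕ} (v w : MinkIdx n → ℝ) : minkInner n v w = minkInner n w v := by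
  simp only [minkInner_eq, mul_comm]

theorem minkInner_add_left {n : ℕ} (v v' w : MinkIdx n → ℝ) :
    minkInner n (v + v') w = minkInner n v w + minkInner n v' w := by
  simp [minkInner, add_dotProduct]

theorem minkInner_smul_left {n : ℕ} (c : ℝ) (v w : MinkIdx n → ℝ) :
    minkInner n (c • v) w = c * minkInner n v w := by
  simp [minkInner, smul_dotProduct]

theorem minkInner_add_right {n : ℕ} (v w w' : MinkIdx n → ℝ) :
    minkInner n v (w + w') = minkInner n v w + minkInner n v w' := by
  rw [minkInner_comm, minkInner_add_left, minkInner_comm w, minkInner_comm w']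

theorem minkInner_smul_right {n : ℕ} (c : ℝ) (v w : MinkIdx n → ℝ) :
    minkInner n v (c • w) = c * minkInner n v w := by
  rw [minkInner_comm, minkInner_smul_left, minkInner_comm]

theorem minkEta_mul_self (n : ℕ) : minkEta n * minkEta n = 1 := by
  rw [minkEta, Matrix.diagonal_mul_diagonal, ← Matrix.diagonal_one]
  congr 1; funext i; split_ifs <;> norm_num

theorem minkEta_transpose (n : ℕ) : (minkEta n)ᵀ = minkEta n := by
  simp [minkEta]

theorem skew_iff_minkInner {n : ℕ} (F : Matrix (MinkIdx n) (MinkIdx n) ℝ) :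
    Fᵀ * minkEta n = -(minkEta n * F) ↔
      ∀ v w, minkInner n (F *ᵥ v) w = -minkInner n v (F *ᵥ w) := by
  have h1 : ∀ v w, minkInner n (F *ᵥ v) w = v ⬝ᵥ ((Fᵀ * minkEta n) *ᵥ w) := by
    intro v w
    rw [minkInner, ← Matrix.mulVec_mulVec, Matrix.dotProduct_mulVec v, Matrix.vecMul_transpose]
  have h2 : ∀ v w, minkInner n v (F *ᵥ w) = v ⬝ᵥ ((minkEta n * F) *ᵥ w) := by
    intro v w
    rw [minkInner, ← Matrix.mulVec_mulVec]
  constructor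
  · intro h v w
    rw [h1, h2, h, Matrix.neg_mulVec, dotProduct_neg]
  · intro h
    ext i j
    have := h (Pi.single i 1) (Pi.single j 1)
    rw [h1, h2] at this
    simpa using this

theorem lorentz_iff_minkInner {n : ℕ} (L : Matrix (MinkIdx n) (MinkIdx n) ℝ)
    (hL : Lᵀ * minkEta n * L = minkEta n) (v w : MinkIdx n → ℝ) :
    minkInner n (L *ᵥ v) (L *ᵥ w) = minkInner n v w := by
  have : minkInner n (L *ᵥ v) (L *ᵥ w) = v ⬝ᵥ ((Lᵀ * minkEta n * L) *ᵥ w) := by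
    rw [minkInner, ← Matrix.mulVec_mulVec, ← Matrix.mulVec_mulVec, Matrix.dotProduct_mulVec v,
      Matrix.vecMul_transpose]
  rw [this, hL, minkInner]

theorem lorentz_isUnit_det {n : ℕ} (L : Matrix (MinkIdx n) (MinkIdx n) ℝ)
    (hL : Lᵀ * minkEta n * L = minkEta n) : IsUnit L.det := by
  have h : (minkEta n * Lᵀ * minkEta n) * L = 1 := by
    rw [Matrix.mul_assoc, Matrix.mul_assoc, ← Matrix.mul_assoc Lᵀ, hL, minkEta_mul_self]
  exact Matrix.isUnit_det_of_left_inverse h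

/-! ### Normal frames -/

/-- Index set of an orthonormal basis of `𝔼ⁿ` made of `q` pairs and, for `n` odd, one more
vector. -/
abbrev FrameIdx (n : ℕ) : Type := (Fin (qNum n) ⊕ Fin (qNum n)) ⊕ Fin (pNum n + 1 - qNum n)

/-- The count fails at `n = 0`, where truncated subtraction gives `pNum 0 = 0` and leaves one
spurious index. -/
theorem card_frameIdx {n : ℕ} (hn : 1 ≤ n) : Fintype.card (FrameIdx n) = n := by
  simp only [Fintype.card_sum, Fintype.card_fin]
  unfold qNum pNum; omega

/-- Minkowski space in coordinates with respect to two null vectors and an orthonormal basis of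
their orthogonal complement. -/
abbrev FrameModel (n : ℕ) : Type := ℝ × ℝ × (FrameIdx n → ℝ)

/-- The two null basis vectors have product `-1/2`, so that `(eˢ, e⁻ˢ, y)` is null for every unit
vector `y`. -/
def modelInner {n : ℕ} (z z' : FrameModel n) : ℝ :=
  -(z.1 * z'.2.1 + z.2.1 * z'.1) / 2 + ∑ j, z.2.2 j * z'.2.2 j

/-- A boost with rate `ν` in the plane of the two null vectors and rotations with rates `b i`. -/
def modelAct {n : ℕ} (ν : ℝ) (b : Fin (qNum n) → ℝ) (z : FrameModel n) : FrameModel n :=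
  (ν * z.1, -ν * z.2.1, Sum.elim (Sum.elim (fun i => b i * z.2.2 (Sum.inl (Sum.inr i)))
    (fun i => -(b i * z.2.2 (Sum.inl (Sum.inl i))))) 0)

/-- In the frame `T` the endomorphism `F` is a boost plus rotations. -/
structure IsNormalFrame {n : ℕ} (F : Matrix (MinkIdx n) (MinkIdx n) ℝ) (ν : ℝ)
    (b : Fin (qNum n) → ℝ) (T : FrameModel n →ₗ[ℝ] (MinkIdx n → ℝ)) : Prop where
  inner : ∀ z z', minkInner n (T z) (T z') = modelInner z z'
  act : ∀ z, F *ᵥ T z = T (modelAct ν b z)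

theorem modelInner_nondegenerate {n : ℕ} (z : FrameModel n) (h : ∀ z', modelInner z z' = 0) :
    z = 0 := by
  have h1 := h (1, 0, 0)
  have h2 := h (0, 1, 0)
  have h3 := h (0, 0, z.2.2)
  simp [modelInner] at h1 h2
  simp only [modelInner, mul_zero, add_zero, neg_zero, zero_div, zero_add] at h3
  have h4 : z.2.2 = 0 := by
    funext j
    have := (Finset.sum_eq_zero_iff_of_nonneg (fun j _ => mul_self_nonneg (z.2.2 j))).1 h3 j
      (Finset.mem_univ j)
    simpa using this
  ext <;> simp [h1, h2, h4]

theorem modelInner_modelAct {n : ℕ} (ν : ℝ) (b : Fin (qNum n) → ℝ) (z z' : FrameModel n) :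
    modelInner (modelAct ν b z) z' = -modelInner z (modelAct ν b z') := by
  simp only [modelInner, modelAct, Fintype.sum_sum_type, Sum.elim_inl, Sum.elim_inr, Pi.zero_apply,
    zero_mul, mul_zero, Finset.sum_const_zero, add_zero]
  have h1 : ∀ x y : Fin (qNum n) → ℝ, ∑ i, -(b i * x i) * y i = -∑ i, x i * (b i * y i) := by
    intro x y; rw [← Finset.sum_neg_distrib]; exact Finset.sum_congr rfl fun i _ => by ring
  have h2 : ∀ x y : Fin (qNum n) → ℝ, ∑ i, x i * -(b i * y i) = -∑ i, (b i * x i) * y i := by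
    intro x y; rw [← Finset.sum_neg_distrib]; exact Finset.sum_congr rfl fun i _ => by ring
  rw [h1, h2]; ring

theorem finrank_frameModel {n : ℕ} (hn : 1 ≤ n) :
    Module.finrank ℝ (FrameModel n) = Module.finrank ℝ (MinkIdx n → ℝ) := by
  have := card_frameIdx hn
  simp only [Fintype.card_sum, Fintype.card_fin] at this
  simp; omega

theorem injective_of_isometry {n : ℕ} {T : FrameModel n →ₗ[ℝ] (MinkIdx n → ℝ)}
    (h : ∀ z z', minkInner n (T z) (T z') = modelInner z z') : Function.Injective T := by
  rw [← LinearMap.ker_eq_bot, LinearMap.ker_eq_bot']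
  intro z hz
  refine modelInner_nondegenerate z fun z' => ?_
  rw [← h, hz]
  simp [minkInner]

theorem bijective_of_isometry {n : ℕ} (hn : 1 ≤ n) {T : FrameModel n →ₗ[ℝ] (MinkIdx n → ℝ)}
    (h : ∀ z z', minkInner n (T z) (T z') = modelInner z z') : Function.Bijective T :=
  ⟨injective_of_isometry h, (LinearMap.injective_iff_surjective_of_finrank_eq_finrank
    (finrank_frameModel hn)).1 (injective_of_isometry h)⟩

/-- This sign freedom later makes the denominator of `coneProj` positive at a chosen point. -/
theorem IsNormalFrame.neg {n : ℕ} {F : Matrix (MinkIdx n) (MinkIdx n) ℝ} {ν : ℝ}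
    {b : Fin (qNum n) → ℝ} {T : FrameModel n →ₗ[ℝ] (MinkIdx n → ℝ)} (h : IsNormalFrame F ν b T) :
    IsNormalFrame F ν b (-T) where
  inner z z' := by
    rw [← h.inner]; simp [minkInner, Matrix.mulVec_neg]
  act z := by
    simp [Matrix.mulVec_neg, h.act]

theorem IsNormalFrame.conj {n : ℕ} {F : Matrix (MinkIdx n) (MinkIdx n) ℝ} {ν : ℝ}
    {b : Fin (qNum n) → ℝ} {T : FrameModel n →ₗ[ℝ] (MinkIdx n → ℝ)} (h : IsNormalFrame F ν b T)
    {L : Matrix (MinkIdx n) (MinkIdx n) ℝ} (hL : Lᵀ * minkEta n * L = minkEta n) :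
    IsNormalFrame (L * F * L⁻¹) ν b (L.mulVecLin ∘ₗ T) where
  inner z z' := by
    simpa [lorentz_iff_minkInner L hL] using h.inner z z'
  act z := by
    have hu := lorentz_isUnit_det L hL
    simp only [LinearMap.comp_apply, Matrix.mulVecLin_apply, ← h.act, Matrix.mulVec_mulVec]
    rw [Matrix.mul_assoc, Matrix.mul_assoc, Matrix.nonsing_inv_mul L hu, Matrix.mul_one]

theorem lorentz_inv {n : ℕ} (L : Matrix (MinkIdx n) (MinkIdx n) ℝ)
    (hL : Lᵀ * minkEta n * L = minkEta n) : (L⁻¹)ᵀ * minkEta n * L⁻¹ = minkEta n := by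
  have hu := lorentz_isUnit_det L hL
  have h1 : (L⁻¹)ᵀ * Lᵀ = 1 := by
    rw [← Matrix.transpose_mul, Matrix.mul_nonsing_inv L hu, Matrix.transpose_one]
  nth_rewrite 1 [← hL]
  rw [Matrix.mul_assoc, Matrix.mul_assoc, Matrix.mul_nonsing_inv L hu, Matrix.mul_one,
    ← Matrix.mul_assoc, h1, Matrix.one_mul]

theorem exists_isNormalFrame_iff_of_orthochronousConj {n : ℕ} {F G : SkewEnd n} {ν : ℝ}
    {b : Fin (qNum n) → ℝ} (h : OrthochronousConj n F G) :
    (∃ T, IsNormalFrame F.1 ν b T) ↔ ∃ T, IsNormalFrame G.1 ν b T := by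
  obtain ⟨L, hL, -, hG⟩ := h
  have hu := lorentz_isUnit_det L hL
  constructor
  · rintro ⟨T, hT⟩
    exact ⟨_, hG ▸ hT.conj hL⟩
  · rintro ⟨T, hT⟩
    have h2 := hT.conj (lorentz_inv L hL)
    have h3 : L⁻¹ * G.1 * L⁻¹⁻¹ = F.1 := by
      rw [hG, Matrix.nonsing_inv_nonsing_inv L hu, ← Matrix.mul_assoc, ← Matrix.mul_assoc,
        Matrix.nonsing_inv_mul L hu, Matrix.one_mul, Matrix.mul_assoc,
        Matrix.nonsing_inv_mul L hu, Matrix.mul_one]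
    exact ⟨_, h3 ▸ h2⟩

/-- Equality in `Quot` only provides the generated equivalence, so the invariance is carried along a
chain of conjugations. -/
theorem exists_isNormalFrame_iff_of_mk_eq {n : ℕ} {F G : SkewEnd n} {ν : ℝ}
    {b : Fin (qNum n) → ℝ} (h : (Quot.mk _ F : ConfClass n) = Quot.mk _ G) :
    (∃ T, IsNormalFrame F.1 ν b T) ↔ ∃ T, IsNormalFrame G.1 ν b T := by
  have h' := Quot.eqvGen_exact h
  clear h
  induction h' with
  | rel F G h => exact exists_isNormalFrame_iff_of_orthochronousConj h
  | refl F => rfl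
  | symm F G _ ih => exact ih.symm
  | trans F G H _ _ ih1 ih2 => exact ih1.trans ih2

/-- The coordinates of the model as one vector. -/
def modelEquiv (n : ℕ) : FrameModel n ≃ₗ[ℝ] (Fin 2 ⊕ FrameIdx n → ℝ) where
  toFun z := Sum.elim ![z.1, z.2.1] z.2.2
  invFun v := (v (Sum.inl 0), v (Sum.inl 1), fun j => v (Sum.inr j))
  left_inv z := by simp
  right_inv v := by
    funext j
    rcases j with j | j
    · fin_cases j <;> simp
    · simp
  map_add' z z' := by
    funext j
    rcases j with j | j
    · fin_cases j <;> simp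
    · simp
  map_smul' c z := by
    funext j
    rcases j with j | j
    · fin_cases j <;> simp
    · simp

open Polynomial in
-- In the frame `-F²` is diagonal: `-ν²` on both null vectors, `b i ^ 2` on both vectors of each
-- rotation plane, and `0` on the unpaired vector.
theorem IsNormalFrame.charpoly_neg_mul_self {n : ℕ} (hn : 1 ≤ n)
    {F : Matrix (MinkIdx n) (MinkIdx n) ℝ} {ν : ℝ}
    {b : Fin (qNum n) → ℝ} {T : FrameModel n →ₗ[ℝ] (MinkIdx n → ℝ)} (h : IsNormalFrame F ν b T) :
    (-(F * F)).charpoly =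
      ((X + C (ν ^ 2)) * ∏ i, (X - C (b i ^ 2))) ^ 2 * X ^ (pNum n + 1 - qNum n) := by
  let E := (modelEquiv n).symm.trans (LinearEquiv.ofBijective T (bijective_of_isometry hn h.inner))
  let d : Fin 2 ⊕ FrameIdx n → ℝ := Sum.elim (fun _ => -ν ^ 2)
    (Sum.elim (Sum.elim (fun i => b i ^ 2) (fun i => b i ^ 2)) 0)
  have key : E.conj (Matrix.toLin' (Matrix.diagonal d)) = Matrix.toLin' (-(F * F)) := by
    refine LinearMap.ext fun v => ?_
    obtain ⟨z, rfl⟩ := (bijective_of_isometry hn h.inner).2 v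
    have hz : E (modelEquiv n z) = T z := by simp [E]
    rw [← hz, LinearEquiv.conj_apply_apply, LinearEquiv.symm_apply_apply, hz, Matrix.toLin'_apply,
      Matrix.toLin'_apply, Matrix.neg_mulVec, ← Matrix.mulVec_mulVec, h.act, h.act, ← map_neg]
    have : E (Matrix.diagonal d *ᵥ (modelEquiv n z)) =
        T ((modelEquiv n).symm (Matrix.diagonal d *ᵥ (modelEquiv n z))) := by
      simp [E]
    rw [this]
    congr 1
    rw [LinearEquiv.symm_apply_eq]
    funext j
    rw [Matrix.mulVec_diagonal]
    rcases j with j | (j | j) | j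
    · fin_cases j <;> simp [modelEquiv, modelAct, d] <;> ring
    · simp [modelEquiv, modelAct, d]; ring
    · simp [modelEquiv, modelAct, d]; ring
    · simp [modelEquiv, modelAct, d]
  rw [← Matrix.charpoly_toLin' (-(F * F)), ← key, LinearEquiv.charpoly_conj,
    Matrix.charpoly_toLin', Matrix.charpoly_diagonal]
  simp [d, Fintype.prod_sum_type]
  ring

/-- The null vectors are `(e₀ - e₁)/2` and `(e₀ + e₁)/2`; `F` is the model action transported by the
resulting isometry. -/
theorem exists_isNormalFrame {n : ℕ} (hn : 1 ≤ n) (ν : ℝ) (b : Fin (qNum n) → ℝ) :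
    ∃ (F : SkewEnd n) (T : FrameModel n →ₗ[ℝ] (MinkIdx n → ℝ)), IsNormalFrame F.1 ν b T := by
  have hc : Fintype.card (FrameIdx n) = Fintype.card (Fin n) := by
    rw [card_frameIdx hn, Fintype.card_fin]
  let σ := Fintype.equivOfCardEq hc
  let T : FrameModel n →ₗ[ℝ] (MinkIdx n → ℝ) :=
    { toFun := fun z => Sum.elim ![(z.1 + z.2.1) / 2, (z.2.1 - z.1) / 2]
        (fun A => z.2.2 (σ.symm A))
      map_add' := by
        intro z z'; funext j
        rcases j with j | j
        · fin_cases j <;> simp <;> ring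
        · simp
      map_smul' := by
        intro c z; funext j
        rcases j with j | j
        · fin_cases j <;> simp <;> ring
        · simp }
  have hT : ∀ z z', minkInner n (T z) (T z') = modelInner z z' := by
    intro z z'
    rw [minkInner_eq, modelInner, ← Equiv.sum_comp σ]
    simp [T]; ring
  let E := LinearEquiv.ofBijective T (bijective_of_isometry hn hT)
  let act : FrameModel n →ₗ[ℝ] FrameModel n :=
    { toFun := modelAct ν b
      map_add' := by
        intro z z'
        refine Prod.ext (by simp [modelAct]; ring) (Prod.ext (by simp [modelAct]; ring) ?_)
        funext j
        rcases j with (j | j) | j <;> simp [modelAct] <;> ring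
      map_smul' := by
        intro c z
        refine Prod.ext (by simp [modelAct]; ring) (Prod.ext (by simp [modelAct]; ring) ?_)
        funext j
        rcases j with (j | j) | j <;> simp [modelAct] <;> ring }
  let F : Matrix (MinkIdx n) (MinkIdx n) ℝ := LinearMap.toMatrix' (E.conj act)
  have hF : ∀ z, F *ᵥ T z = T (modelAct ν b z) := by
    intro z
    have : E z = T z := rfl
    rw [← this, LinearMap.toMatrix'_mulVec, LinearEquiv.conj_apply_apply, LinearEquiv.symm_apply_apply]
    rfl
  refine ⟨⟨F, (skew_iff_minkInner F).2 fun v w => ?_⟩, T, hT, hF⟩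
  obtain ⟨z, rfl⟩ := E.surjective v
  obtain ⟨z', rfl⟩ := E.surjective w
  change minkInner n (F *ᵥ T z) (T z') = -minkInner n (T z) (F *ᵥ T z')
  rw [hF, hF, hT, hT, modelInner_modelAct]

/-- A boost with `ν ≠ 0` kills no null coordinate, so a kernel vector lies in the Euclidean part.
The kernel is thus neither timelike nor degenerate, which selects the "otherwise" ordering of the
parameters. -/
theorem IsNormalFrame.minkInner_self_pos {n : ℕ} (hn : 1 ≤ n)
    {F : Matrix (MinkIdx n) (MinkIdx n) ℝ} {ν : ℝ} {b : Fin (qNum n) → ℝ}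
    {T : FrameModel n →ₗ[ℝ] (MinkIdx n → ℝ)} (h : IsNormalFrame F ν b T) (hν : ν ≠ 0)
    {v : MinkIdx n → ℝ} (hv : v ≠ 0) (hFv : F *ᵥ v = 0) : 0 < minkInner n v v := by
  obtain ⟨z, rfl⟩ := (bijective_of_isometry hn h.inner).2 v
  rw [h.act, ← map_zero T] at hFv
  have h0 := injective_of_isometry h.inner hFv
  have h1 : z.1 = 0 := by simpa [modelAct, hν] using congrArg Prod.fst h0
  have h2 : z.2.1 = 0 := by simpa [modelAct, hν] using congrArg (fun z => z.2.1) h0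
  rw [h.inner, modelInner, h1, h2]
  have hz : z.2.2 ≠ 0 := by
    rintro h3
    apply hv
    have : z = 0 := by ext <;> simp [h1, h2, h3]
    rw [this, map_zero]
  obtain ⟨j, hj⟩ := Function.ne_iff.1 hz
  have : 0 < ∑ j, z.2.2 j * z.2.2 j :=
    Finset.sum_pos' (fun j _ => mul_self_nonneg _) ⟨j, Finset.mem_univ j, mul_self_pos.2 hj⟩
  simpa using this

open Polynomial in
theorem IsNormalFrame.hasParams {n : ℕ} (hn : 1 ≤ n)
    {F : Matrix (MinkIdx n) (MinkIdx n) ℝ} {ν : ℝ} {b : Fin (qNum n) → ℝ}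
    {T : FrameModel n →ₗ[ℝ] (MinkIdx n → ℝ)} (h : IsNormalFrame F ν b T) (hν : ν ≠ 0)
    (τ : Equiv.Perm (Fin (qNum n))) (hτ : Antitone fun i => b (τ i) ^ 2) :
    HasParams F (Fin.cons (-ν ^ 2) fun i => b (τ i) ^ 2) := by
  have hsort : ((Fin.cons (-ν ^ 2) fun i => b (τ i) ^ 2 : Fin (qNum n + 1) → ℝ) 0 ≤ 0 ∧
      Antitone (fun i : Fin (qNum n) =>
        (Fin.cons (-ν ^ 2) fun i => b (τ i) ^ 2 : Fin (qNum n + 1) → ℝ) i.succ) ∧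
      ∀ i : Fin (qNum n),
        0 ≤ (Fin.cons (-ν ^ 2) fun i => b (τ i) ^ 2 : Fin (qNum n + 1) → ℝ) i.succ) := by
    refine ⟨by simp [sq_nonneg], by simpa using hτ, fun i => by simp [sq_nonneg]⟩
  have ht : ¬ KerTimelike F := by
    rintro ⟨v, hv, hvv⟩
    by_cases h0 : v = 0
    · simp [h0, minkInner] at hvv
    · exact absurd (h.minkInner_self_pos hn hν h0 hv) (not_lt.2 hvv.le)
  have hd : ¬ KerDegenerate F := by
    rintro ⟨v, h0, hv, hvv⟩
    exact absurd (h.minkInner_self_pos hn hν h0 hv) (by rw [hvv v hv]; simp)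
  refine ⟨⟨(X + C (ν ^ 2)) * ∏ i, (X - C (b i ^ 2)), ⟨?_, ?_, ?_⟩, ?_⟩, fun _ => ⟨fun h => (ht h).elim, fun _ => hsort⟩,
    fun _ => ⟨fun h => (hd h).elim, fun _ => hsort⟩⟩
  · exact (monic_X_add_C _).mul (monic_prod_of_monic _ _ fun i _ => monic_X_sub_C _)
  · intro he
    have : pNum n + 1 - qNum n = 0 := by
      obtain ⟨k, rfl⟩ := he
      unfold pNum qNum; omega
    rw [h.charpoly_neg_mul_self hn, this, pow_zero, mul_one]
  · intro ho
    have : pNum n + 1 - qNum n = 1 := by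
      obtain ⟨k, rfl⟩ := ho
      unfold pNum qNum; omega
    rw [h.charpoly_neg_mul_self hn, this, pow_one, mul_comm]
  -- The multiset of roots ignores order, so the sorting permutation `τ` may be inserted in the
  -- product.
  · have e1 : (X + C (ν ^ 2)) * ∏ i, (X - C (b i ^ 2)) =
        ∏ i, (X - C ((Fin.cons (-ν ^ 2) fun i => b (τ i) ^ 2 : Fin (qNum n + 1) → ℝ) i)) := by
      rw [Fin.prod_univ_succ]
      simp only [Fin.cons_zero, Fin.cons_succ]
      rw [Equiv.prod_comp τ (fun i => X - C (b i ^ 2))]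
      simp
    rw [e1, Finset.prod_eq_multiset_prod]
    have := roots_multiset_prod_X_sub_C (Finset.univ.val.map
      (Fin.cons (-ν ^ 2) fun i => b (τ i) ^ 2 : Fin (qNum n + 1) → ℝ))
    rw [Multiset.map_map] at this
    exact this

theorem IsNormalFrame.classHasParams {n : ℕ} (hn : 1 ≤ n)
    {F : SkewEnd n} {ν : ℝ} {b : Fin (qNum n) → ℝ}
    {T : FrameModel n →ₗ[ℝ] (MinkIdx n → ℝ)} (h : IsNormalFrame F.1 ν b T) (hν : ν ≠ 0)
    (τ : Equiv.Perm (Fin (qNum n))) (hτ : Antitone fun i => b (τ i) ^ 2) :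
    ClassHasParams (Quot.mk _ F) (Fin.cons (-ν ^ 2) fun i => b (τ i) ^ 2) := by
  intro G hG
  obtain ⟨T', hT'⟩ := (exists_isNormalFrame_iff_of_mk_eq hG).2 ⟨T, h⟩
  exact hT'.hasParams hn hν τ hτ

end

noncomputable section

/-! ### Normal form of a skew-symmetric endomorphism of a Euclidean space -/

theorem inner_self_of_skew {E : Type*} [NormedAddCommGroup E] [InnerProductSpace ℝ E]
    (w : E →ₗ[ℝ] E) (hw : ∀ x y, inner ℝ (w x) y = -inner ℝ x (w y)) (x : E) :
    inner ℝ x (w x) = 0 := by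
  have := hw x x
  linarith [real_inner_comm x (w x)]

/-- `w²` is symmetric, so it has an orthonormal eigenbasis. If `w ≠ 0`, some member `e` has `w e ≠
0`; its `w²`-eigenvalue is `-‖w e‖²`, and `e` with the normalised `w e` spans an invariant plane. -/
theorem exists_invariant_pair {E : Type*} [NormedAddCommGroup E] [InnerProductSpace ℝ E]
    [FiniteDimensional ℝ E] (hE : 2 ≤ Module.finrank ℝ E) (w : E →ₗ[ℝ] E)
    (hw : ∀ x y, inner ℝ (w x) y = -inner ℝ x (w y)) :
    ∃ (e f : E) (b : ℝ), ‖e‖ = 1 ∧ ‖f‖ = 1 ∧ inner ℝ e f = 0 ∧ w e = -b • f ∧ w f = b • e := by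
  by_cases h0 : w = 0
  · let B := stdOrthonormalBasis ℝ E
    refine ⟨B ⟨0, by omega⟩, B ⟨1, by omega⟩, 0, B.orthonormal.1 _, B.orthonormal.1 _,
      B.orthonormal.2 (by simp), by simp [h0], by simp [h0]⟩
  · have hs : (w ∘ₗ w).IsSymmetric := by
      intro x y
      simp [hw]
    let B := hs.eigenvectorBasis rfl
    obtain ⟨k, hk⟩ : ∃ k, w (B k) ≠ 0 := by
      by_contra! hk
      apply h0
      exact B.toBasis.ext fun k => by simpa using hk k
    set e := B k
    have he : ‖e‖ = 1 := B.orthonormal.1 k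
    have hee : w (w e) = hs.eigenvalues rfl k • e := by
      exact hs.apply_eigenvectorBasis rfl k
    set m := hs.eigenvalues rfl k
    have hm : -m = ‖w e‖ ^ 2 := by
      have h1 : inner ℝ (w (w e)) e = -inner ℝ (w e) (w e) := hw _ _
      rw [hee, inner_smul_left, real_inner_self_eq_norm_sq, real_inner_self_eq_norm_sq, he] at h1
      simp at h1
      linarith
    have hn : ‖w e‖ ≠ 0 := norm_ne_zero_iff.2 hk
    refine ⟨e, ‖w e‖⁻¹ • w e, -‖w e‖, he, ?_, ?_, ?_, ?_⟩
    · rw [norm_smul, norm_inv, norm_norm, inv_mul_cancel₀ hn]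
    · rw [inner_smul_right, inner_self_of_skew w hw, mul_zero]
    · rw [smul_smul, neg_neg, mul_inv_cancel₀ hn, one_smul]
    · rw [map_smul, hee, smul_smul]
      congr 1
      rw [← neg_neg m, hm]
      field_simp

/-- Induction on `q`: split off an invariant plane; skewness makes its orthogonal complement
invariant. -/
theorem exists_skew_normal_form (q r : ℕ) (hr : r ≤ 1) {E : Type*} [NormedAddCommGroup E]
    [InnerProductSpace ℝ E] [FiniteDimensional ℝ E] (hE : Module.finrank ℝ E = 2 * q + r)
    (w : E →ₗ[ℝ] E) (hw : ∀ x y, inner ℝ (w x) y = -inner ℝ x (w y)) :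
    ∃ (e f : Fin q → E) (g : Fin r → E) (b : Fin q → ℝ),
      Orthonormal ℝ (Sum.elim (Sum.elim e f) g) ∧
      (∀ i, w (e i) = -b i • f i) ∧ (∀ i, w (f i) = b i • e i) ∧ ∀ k, w (g k) = 0 := by
  induction q generalizing E with
  | zero =>
    have hE' : Module.finrank ℝ E = r := by simpa using hE
    let B := (stdOrthonormalBasis ℝ E).reindex (finCongr hE')
    refine ⟨Fin.elim0, Fin.elim0, B, Fin.elim0, ?_, fun i => i.elim0, fun i => i.elim0, ?_⟩
    · rw [orthonormal_iff_ite]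
      intro i j
      rcases i with (i | i) | i
      · exact i.elim0
      · exact i.elim0
      rcases j with (j | j) | j
      · exact j.elim0
      · exact j.elim0
      simpa using orthonormal_iff_ite.1 B.orthonormal i j
    · intro k
      refine B.toBasis.ext_elem_iff.2 fun j => ?_
      -- Since `r ≤ 1` there is a single index, and the only matrix entry `⟨x, w x⟩` vanishes.
      have : j = k := by
        apply Fin.ext; omega
      subst this
      simp [B.repr_apply_apply, inner_self_of_skew w hw]
  | succ q ih =>
    obtain ⟨e, f, b, he, hf, hef, hwe, hwf⟩ := exists_invariant_pair (by omega) w hw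
    let K : Submodule ℝ E := Submodule.span ℝ {e, f}
    have hK : ∀ x ∈ Kᗮ, inner ℝ e x = 0 ∧ inner ℝ f x = 0 := fun x hx =>
      ⟨hx e (Submodule.subset_span (by simp)), hx f (Submodule.subset_span (by simp))⟩
    have hK' : ∀ x, inner ℝ e x = 0 → inner ℝ f x = 0 → x ∈ Kᗮ := by
      intro x h1 h2
      rw [Submodule.mem_orthogonal]
      intro u hu
      obtain ⟨s, t, rfl⟩ := Submodule.mem_span_pair.1 hu
      rw [inner_add_left, inner_smul_left, inner_smul_left, h1, h2]; simp
    have hon : Orthonormal ℝ ![e, f] := by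
      rw [orthonormal_iff_ite]
      intro i j
      fin_cases i <;> fin_cases j <;>
        simp [hef, real_inner_comm, he, hf]
    have hKd : Module.finrank ℝ K = 2 := by
      have := finrank_span_eq_card hon.linearIndependent
      rw [Matrix.range_cons_cons_empty] at this
      simpa using this
    have hKo : Module.finrank ℝ Kᗮ = 2 * q + r := by
      have := K.finrank_add_finrank_orthogonal
      omega
    have hinv : ∀ x ∈ Kᗮ, w x ∈ Kᗮ := by
      intro x hx
      obtain ⟨h1, h2⟩ := hK x hx
      have a1 := hw e x
      have a2 := hw f x
      rw [hwe, inner_smul_left, h2] at a1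
      rw [hwf, inner_smul_left, h1] at a2
      exact hK' _ (by simpa using a1) (by simpa using a2)
    obtain ⟨e', f', g', b', ho, h1, h2, h3⟩ := ih hKo (w.restrict hinv) (fun x y => by
      simpa using hw x y)
    refine ⟨Fin.cons e fun i => (e' i : E), Fin.cons f fun i => (f' i : E), fun k => (g' k : E),
      Fin.cons b b', ?_, ?_, ?_, ?_⟩
    · rw [orthonormal_iff_ite] at ho ⊢
      have oe : ∀ x : Kᗮ, inner ℝ e (x : E) = 0 := fun x => (hK x x.2).1
      have of : ∀ x : Kᗮ, inner ℝ f (x : E) = 0 := fun x => (hK x x.2).2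
      have oe' : ∀ x : Kᗮ, inner ℝ (x : E) e = 0 := fun x => by rw [real_inner_comm, oe]
      have of' : ∀ x : Kᗮ, inner ℝ (x : E) f = 0 := fun x => by rw [real_inner_comm, of]
      have hfe : inner ℝ f e = 0 := by rw [real_inner_comm, hef]
      have a11 := fun i j => ho (Sum.inl (Sum.inl i)) (Sum.inl (Sum.inl j))
      have a12 := fun i j => ho (Sum.inl (Sum.inl i)) (Sum.inl (Sum.inr j))
      have a13 := fun i j => ho (Sum.inl (Sum.inl i)) (Sum.inr j)
      have a21 := fun i j => ho (Sum.inl (Sum.inr i)) (Sum.inl (Sum.inl j))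
      have a22 := fun i j => ho (Sum.inl (Sum.inr i)) (Sum.inl (Sum.inr j))
      have a23 := fun i j => ho (Sum.inl (Sum.inr i)) (Sum.inr j)
      have a31 := fun i j => ho (Sum.inr i) (Sum.inl (Sum.inl j))
      have a32 := fun i j => ho (Sum.inr i) (Sum.inl (Sum.inr j))
      have a33 := fun i j => ho (Sum.inr i) (Sum.inr j)
      simp only [Sum.elim_inl, Sum.elim_inr, Submodule.coe_inner, Sum.inl.injEq, Sum.inr.injEq,
        reduceCtorEq, if_false] at a11 a12 a13 a21 a22 a23 a31 a32 a33
      rintro ((i | i) | i) ((j | j) | j)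
      · refine Fin.cases ?_ (fun i => ?_) i <;> refine Fin.cases ?_ (fun j => ?_) j <;>
          simp [oe, oe', he, a11, Fin.succ_ne_zero, (Fin.succ_ne_zero _).symm]
      · refine Fin.cases ?_ (fun i => ?_) i <;> refine Fin.cases ?_ (fun j => ?_) j <;>
          simp [oe, of', hef, a12]
      · refine Fin.cases ?_ (fun i => ?_) i <;> simp [oe, a13]
      · refine Fin.cases ?_ (fun i => ?_) i <;> refine Fin.cases ?_ (fun j => ?_) j <;>
          simp [of, oe', hfe, a21]
      · refine Fin.cases ?_ (fun i => ?_) i <;> refine Fin.cases ?_ (fun j => ?_) j <;>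
          simp [of, of', hf, a22, Fin.succ_ne_zero, (Fin.succ_ne_zero _).symm]
      · refine Fin.cases ?_ (fun i => ?_) i <;> simp [of, a23]
      · refine Fin.cases ?_ (fun j => ?_) j <;> simp [oe', a31]
      · refine Fin.cases ?_ (fun j => ?_) j <;> simp [of', a32]
      · simp [a33]
    · intro i
      refine Fin.cases ?_ (fun i => ?_) i
      · simpa using hwe
      · simpa using congrArg (Subtype.val) (h1 i)
    · intro i
      refine Fin.cases ?_ (fun i => ?_) i
      · simpa using hwf
      · simpa using congrArg (Subtype.val) (h2 i)
    · intro k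
      simpa using congrArg (Subtype.val) (h3 k)

/-! ### Frames of a skew-symmetric endomorphism with a non-zero real eigenvalue -/

theorem minkInner_self_of_eigenvector {n : ℕ} {F : Matrix (MinkIdx n) (MinkIdx n) ℝ}
    (hF : Fᵀ * minkEta n = -(minkEta n * F)) {ν : ℝ} (hν : ν ≠ 0) {v : MinkIdx n → ℝ}
    (hv : F *ᵥ v = ν • v) : minkInner n v v = 0 := by
  have h := (skew_iff_minkInner F).1 hF v v
  rw [hv, minkInner_smul_left, minkInner_smul_right] at h
  have : ν * minkInner n v v = 0 := by linarith
  simpa [hν] using this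

theorem eq_zero_of_null_of_time_eq_zero {n : ℕ} {v : MinkIdx n → ℝ} (hv : minkInner n v v = 0)
    (h0 : v (Sum.inl 0) = 0) : v = 0 := by
  have hs : 0 ≤ ∑ A, v (Sum.inr A) * v (Sum.inr A) :=
    Finset.sum_nonneg fun A _ => mul_self_nonneg _
  rw [minkInner_eq, h0] at hv
  have h2 : v (Sum.inl 1) = 0 := by
    nlinarith [mul_self_nonneg (v (Sum.inl 1))]
  have h3 : ∑ A, v (Sum.inr A) * v (Sum.inr A) = 0 := by rw [h2] at hv; linarith
  have h4 := (Finset.sum_eq_zero_iff_of_nonneg (fun A _ => mul_self_nonneg _)).1 h3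
  funext j
  rcases j with j | j
  · fin_cases j
    · exact h0
    · exact h2
  · simpa using h4 j (Finset.mem_univ _)

/-- Orthogonal null vectors of Minkowski space are proportional. -/
theorem smul_eq_smul_of_null {n : ℕ} {v w : MinkIdx n → ℝ} (hv : minkInner n v v = 0)
    (hw : minkInner n w w = 0) (hvw : minkInner n v w = 0) :
    w (Sum.inl 0) • v = v (Sum.inl 0) • w := by
  -- This combination is null and its time component cancels.
  have h : w (Sum.inl 0) • v + (-v (Sum.inl 0)) • w = 0 := by
    apply eq_zero_of_null_of_time_eq_zero
    · simp only [minkInner_add_left, minkInner_add_right, minkInner_smul_left,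
        minkInner_smul_right, hv, hw, hvw, minkInner_comm w v]
      ring
    · simp; ring
  rwa [neg_smul, ← sub_eq_add_neg, sub_eq_zero] at h

theorem exists_eigenvector_iff_det {n : ℕ} (F : Matrix (MinkIdx n) (MinkIdx n) ℝ) (ν : ℝ) :
    (∃ v, v ≠ 0 ∧ F *ᵥ v = ν • v) ↔ (F - ν • (1 : Matrix (MinkIdx n) (MinkIdx n) ℝ)).det = 0 := by
  rw [← Matrix.exists_mulVec_eq_zero_iff]
  refine exists_congr fun v => and_congr_right fun _ => ?_
  rw [Matrix.sub_mulVec, Matrix.smul_mulVec, Matrix.one_mulVec, sub_eq_zero]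

/-- `Fᵀ = -η F η`, so `F` and `-F` have the same spectrum. -/
theorem exists_eigenvector_neg {n : ℕ} {F : Matrix (MinkIdx n) (MinkIdx n) ℝ}
    (hF : Fᵀ * minkEta n = -(minkEta n * F)) {ν : ℝ} (h : ∃ v, v ≠ 0 ∧ F *ᵥ v = ν • v) :
    ∃ v, v ≠ 0 ∧ F *ᵥ v = (-ν) • v := by
  rw [exists_eigenvector_iff_det] at h ⊢
  have h1 : (F - ν • (1 : Matrix (MinkIdx n) (MinkIdx n) ℝ))ᵀ =
      -(minkEta n * (F - (-ν) • (1 : Matrix (MinkIdx n) (MinkIdx n) ℝ)) * minkEta n) := by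
    have hF' : Fᵀ = -(minkEta n * F * minkEta n) := by
      rw [← Matrix.neg_mul, ← hF, Matrix.mul_assoc, minkEta_mul_self, Matrix.mul_one]
    rw [Matrix.transpose_sub, hF', Matrix.mul_sub, Matrix.sub_mul, Matrix.mul_smul, Matrix.mul_one,
      Matrix.smul_mul, minkEta_mul_self, Matrix.transpose_smul, Matrix.transpose_one]
    module
  rw [← Matrix.det_transpose, h1, Matrix.det_neg, Matrix.det_mul, Matrix.det_mul] at h
  have h2 : (minkEta n).det * (minkEta n).det = 1 := by
    rw [← Matrix.det_mul, minkEta_mul_self, Matrix.det_one]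
  have h3 : (minkEta n).det ≠ 0 := fun h => by simp [h] at h2
  simpa [h3] using h

/-- An isometric embedding of `𝔼ⁿ` into the orthogonal complement of a null vector. -/
theorem exists_isometry_orthogonal_null {n : ℕ} {p : MinkIdx n → ℝ} (hp : minkInner n p p = 0) :
    ∃ S : Euc n →ₗ[ℝ] (MinkIdx n → ℝ), (∀ u v, minkInner n (S u) (S v) = inner ℝ u v) ∧
      ∀ u, minkInner n p (S u) = 0 := by
  -- Adding the null vector `⟨X, u⟩ (e₀ - e₁)` to `u` keeps products unchanged; `X` is the value
  -- that makes the sum orthogonal to `p`. If the denominator is `0`, nullity forces the spatial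
  -- part of `p` to vanish, and the default value `X = 0` is correct.
  let X : Euc n := WithLp.toLp 2 fun A => p (Sum.inr A) / (p (Sum.inl 0) + p (Sum.inl 1))
  let S : Euc n →ₗ[ℝ] (MinkIdx n → ℝ) :=
    { toFun := fun u => Sum.elim ![inner ℝ X u, -inner ℝ X u] u
      map_add' := by
        intro u v; funext j
        rcases j with j | j
        · fin_cases j <;> simp [inner_add_right] ; ring
        · simp
      map_smul' := by
        intro u v; funext j
        rcases j with j | j
        · fin_cases j <;> simp [inner_smul_right]
        · simp }
  refine ⟨S, fun u v => ?_, fun u => ?_⟩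
  · rw [minkInner_eq, PiLp.inner_apply]
    simp [S, mul_comm]
  · rw [minkInner_eq]
    have hX : (p (Sum.inl 0) + p (Sum.inl 1)) * inner ℝ X u = ∑ A, p (Sum.inr A) * u A := by
      rw [PiLp.inner_apply, Finset.mul_sum]
      refine Finset.sum_congr rfl fun A _ => ?_
      by_cases h : p (Sum.inl 0) + p (Sum.inl 1) = 0
      · have h1 : ∑ A, p (Sum.inr A) * p (Sum.inr A) = 0 := by
          rw [minkInner_eq] at hp
          have h2 : p (Sum.inl 1) = -p (Sum.inl 0) := by linarith
          rw [h2] at hp; linarith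
        have h4 := (Finset.sum_eq_zero_iff_of_nonneg (fun A _ => mul_self_nonneg _)).1 h1 A
          (Finset.mem_univ _)
        have h5 : p (Sum.inr A) = 0 := by simpa using h4
        simp [h, h5]
      · simp [X]; field_simp
    simp [S, ← hX]; ring

/-- Eigenvectors `p`, `m` for `ν` and `-ν` are null. They are not orthogonal, since otherwise they
would be proportional with different eigenvalues. Once they are scaled to product `-1/2`, `F`
preserves their orthogonal complement and acts there as a Euclidean skew map, to which
`exists_skew_normal_form` applies. -/
theorem exists_isNormalFrame_of_eigenvector {n : ℕ} (hn : 1 ≤ n)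
    {F : Matrix (MinkIdx n) (MinkIdx n) ℝ} (hF : Fᵀ * minkEta n = -(minkEta n * F)) {ν : ℝ}
    (hν : ν ≠ 0) (h : ∃ v, v ≠ 0 ∧ F *ᵥ v = ν • v) :
    ∃ (b : Fin (qNum n) → ℝ) (T : FrameModel n →ₗ[ℝ] (MinkIdx n → ℝ)), IsNormalFrame F ν b T := by
  have hsk := (skew_iff_minkInner F).1 hF
  obtain ⟨m, hm0, hm⟩ := exists_eigenvector_neg hF h
  obtain ⟨p, hp0, hp⟩ := h
  have hpp := minkInner_self_of_eigenvector hF hν hp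
  have hmm := minkInner_self_of_eigenvector hF (neg_ne_zero.2 hν) hm
  have hpm0 : minkInner n p m ≠ 0 := by
    intro h0
    have h1 := smul_eq_smul_of_null hpp hmm h0
    have h2 := congrArg (F *ᵥ ·) h1
    simp only [Matrix.mulVec_smul, hp, hm] at h2
    rw [smul_comm, h1, smul_comm (p (Sum.inl 0)), ← sub_eq_zero, ← sub_smul] at h2
    have h3 : ν - -ν ≠ 0 := by
      rw [sub_neg_eq_add, ← two_mul]; exact mul_ne_zero two_ne_zero hν
    rcases smul_eq_zero.1 h2 with h2 | h2
    · exact h3 h2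
    rcases smul_eq_zero.1 h2 with h2 | h2
    · exact hp0 (eq_zero_of_null_of_time_eq_zero hpp h2)
    · exact hm0 h2
  obtain ⟨p, hp, hpp, hpm⟩ : ∃ p', F *ᵥ p' = ν • p' ∧ minkInner n p' p' = 0 ∧
      minkInner n p' m = -1 / 2 := by
    refine ⟨(-1 / 2 / minkInner n p m) • p, ?_, ?_, ?_⟩
    · rw [Matrix.mulVec_smul, hp, smul_comm]
    · rw [minkInner_smul_left, minkInner_smul_right, hpp]; simp
    · rw [minkInner_smul_left]; field_simp
  clear hpm0
  obtain ⟨S₀, hS₀, hpS₀⟩ := exists_isometry_orthogonal_null hpp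
  let mS₀ : Euc n →ₗ[ℝ] ℝ :=
    { toFun := fun u => minkInner n m (S₀ u)
      map_add' := by intro u v; rw [map_add, minkInner_add_right]
      map_smul' := by intro c u; rw [map_smul, minkInner_smul_right]; rfl }
  -- A multiple of `p` changes no product within `p^⊥`. The factor `2` compensates `⟨p, m⟩ = -1/2`
  -- and makes the image orthogonal to `m` as well.
  let S : Euc n →ₗ[ℝ] (MinkIdx n → ℝ) := S₀ + (2 • mS₀).smulRight p
  have hSa : ∀ u, S u = S₀ u + (2 * minkInner n m (S₀ u)) • p := by
    intro u; simp [S, mS₀]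
  have hmp : minkInner n m p = -1 / 2 := by rw [minkInner_comm, hpm]
  have hSp : ∀ u, minkInner n (S u) p = 0 := by
    intro u; rw [hSa, minkInner_add_left, minkInner_smul_left, hpp, minkInner_comm, hpS₀]; simp
  have hSm : ∀ u, minkInner n (S u) m = 0 := by
    intro u; rw [hSa, minkInner_add_left, minkInner_smul_left, hpm, minkInner_comm _ m]; ring
  have hSS : ∀ u v, minkInner n (S u) (S v) = inner ℝ u v := by
    intro u v
    rw [hSa v, minkInner_add_right, minkInner_smul_right, hSp, hSa u, minkInner_add_left,
      minkInner_smul_left, hS₀, hpS₀]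
    ring
  have hpS : ∀ u, minkInner n p (S u) = 0 := fun u => by rw [minkInner_comm, hSp]
  have hmS : ∀ u, minkInner n m (S u) = 0 := fun u => by rw [minkInner_comm, hSm]
  -- a linear isometry from a model of Minkowski space, for any linear isometry into `𝔼ⁿ`
  have hiso : ∀ R : (FrameIdx n → ℝ) →ₗ[ℝ] Euc n,
      (∀ x y, inner ℝ (R x) (R y) = ∑ j, x j * y j) →
      ∃ T : FrameModel n →ₗ[ℝ] (MinkIdx n → ℝ),
        (∀ z, T z = z.1 • p + z.2.1 • m + S (R z.2.2)) ∧
        ∀ z z', minkInner n (T z) (T z') = modelInner z z' := by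
    intro R hR
    refine ⟨{ toFun := fun z => z.1 • p + z.2.1 • m + S (R z.2.2)
              map_add' := ?_
              map_smul' := ?_ }, fun z => rfl, fun z z' => ?_⟩
    · intro z z'; simp only [Prod.fst_add, Prod.snd_add, map_add]; module
    · intro c z; simp only [Prod.smul_fst, Prod.smul_snd, map_smul, RingHom.id_apply]; module
    · simp only [LinearMap.coe_mk, AddHom.coe_mk, minkInner_add_left, minkInner_add_right,
        minkInner_smul_left, minkInner_smul_right, hpp, hmm, hpm, hmp, hSp, hSm, hpS, hmS, hSS, hR,
        modelInner]
      ring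
  have hc : Fintype.card (FrameIdx n) = Fintype.card (Fin n) := by
    rw [card_frameIdx hn, Fintype.card_fin]
  let σ := Fintype.equivOfCardEq hc
  -- This auxiliary frame, from the standard basis of `𝔼ⁿ`, only shows that `p`, `m` and the range
  -- of `S` span the whole space; hence `F` maps the range of `S` to itself.
  obtain ⟨T₀, hT₀, hT₀i⟩ := hiso
    ((WithLp.linearEquiv 2 ℝ (Fin n → ℝ)).symm.toLinearMap ∘ₗ LinearMap.funLeft ℝ ℝ σ.symm) (by
      intro x y
      rw [PiLp.inner_apply, ← Equiv.sum_comp σ]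
      simp [LinearMap.funLeft, mul_comm])
  have hT₀s := (bijective_of_isometry hn hT₀i).2
  have hex : ∀ u : Euc n, ∃ u' : Euc n, F *ᵥ S u = S u' := by
    intro u
    obtain ⟨z, hz⟩ := hT₀s (F *ᵥ S u)
    rw [hT₀] at hz
    set u' := ((WithLp.linearEquiv 2 ℝ (Fin n → ℝ)).symm.toLinearMap ∘ₗ
      LinearMap.funLeft ℝ ℝ σ.symm) z.2.2
    have h1 := hsk (S u) p
    have h2 := hsk (S u) m
    rw [hp, minkInner_smul_right, hSp, ← hz, minkInner_add_left, minkInner_add_left,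
      minkInner_smul_left, minkInner_smul_left, hpp, hmp, hSp] at h1
    rw [hm, minkInner_smul_right, hSm, ← hz, minkInner_add_left, minkInner_add_left,
      minkInner_smul_left, minkInner_smul_left, hmm, hpm, hSm] at h2
    have h3 : z.2.1 = 0 := by linarith
    have h4 : z.1 = 0 := by linarith
    refine ⟨u', ?_⟩
    rw [← hz, h3, h4]; simp
  have hSinj : Function.Injective S := by
    rw [← LinearMap.ker_eq_bot, LinearMap.ker_eq_bot']
    intro u hu
    have := hSS u u
    rw [hu] at this
    rw [← inner_self_eq_zero (𝕜 := ℝ), ← this]; simp [minkInner]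
  choose w₀ hw₀ using hex
  let w : Euc n →ₗ[ℝ] Euc n :=
    { toFun := w₀
      map_add' := by
        intro u v; apply hSinj
        rw [← hw₀, map_add, map_add, Matrix.mulVec_add, hw₀, hw₀]
      map_smul' := by
        intro c u; apply hSinj
        rw [← hw₀, map_smul, map_smul, Matrix.mulVec_smul, hw₀]; rfl }
  have hw : ∀ u, F *ᵥ S u = S (w u) := hw₀
  have hnq : n = 2 * qNum n + (pNum n + 1 - qNum n) := by unfold qNum pNum; omega
  obtain ⟨e, f, g, b, ho, hwe, hwf, hwg⟩ := exists_skew_normal_form (qNum n)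
    (pNum n + 1 - qNum n) (by unfold qNum pNum; omega) (E := Euc n) (by simpa using hnq) w (by
      intro x y
      rw [← hSS, ← hSS, ← hw, ← hw, hsk])
  let R : (FrameIdx n → ℝ) →ₗ[ℝ] Euc n := Fintype.linearCombination ℝ (Sum.elim (Sum.elim e f) g)
  have hR : ∀ x, R x = ∑ i, x (Sum.inl (Sum.inl i)) • e i + ∑ i, x (Sum.inl (Sum.inr i)) • f i
      + ∑ k, x (Sum.inr k) • g k := by
    intro x
    simp [R, Fintype.linearCombination_apply, Fintype.sum_sum_type]
  obtain ⟨T, hT, hTi⟩ := hiso R (by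
    intro x y
    have := ho.inner_sum x y Finset.univ
    simpa [R, Fintype.linearCombination_apply] using this)
  refine ⟨b, T, hTi, fun z => ?_⟩
  rw [hT, hT, Matrix.mulVec_add, Matrix.mulVec_add, Matrix.mulVec_smul, Matrix.mulVec_smul, hp, hm,
    hw]
  have : w (R z.2.2) = R (modelAct ν b z).2.2 := by
    rw [hR, hR]
    simp only [map_add, map_sum, map_smul, hwe, hwf, hwg, modelAct, Sum.elim_inl, Sum.elim_inr,
      Pi.zero_apply, smul_zero, zero_smul, Finset.sum_const_zero, add_zero]
    rw [add_comm]
    congr 1 <;> refine Finset.sum_congr rfl fun i _ => ?_ <;> module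
  rw [this]
  simp only [modelAct]
  module

end

noncomputable section

/-! ### Local conformal maps to `𝔼ⁿ` -/

section

variable {V : Type*} [NormedAddCommGroup V] [NormedSpace ℝ V]

/-- Under `γ ↦ θ² γ` the numerator of `D_Y` scales by `θ⁴` and `|Y|^(n+2)` by `θ^(n+2)`, which
leaves `θ^(2-n)`. -/
theorem IsLocalConformal.equivalentData {W : Type*} [NormedAddCommGroup W] [NormedSpace ℝ W]
    {U : Set V} {γ : V → V → V → ℝ} {U' : Set W} {γ' : W → W → W → ℝ}
    {φ : OpenPartialHomeomorph V W} {θ : V → ℝ} (h : IsLocalConformal U γ U' γ' φ θ) {Y : V → V}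
    {Y' : W → W} (hY : ∀ x ∈ φ.source, fderiv ℝ φ x (Y x) = Y' (φ x)) (n : ℕ) (κ : ℝ) :
    EquivalentData n U γ (ttTensor n κ γ Y) U' γ' (ttTensor n κ γ' Y') := by
  refine ⟨φ, θ, h, fun x hx u v => ?_⟩
  have hθ := h.factor_pos x hx
  have hs : Real.sqrt (θ x ^ 2 * γ x (Y x) (Y x)) = θ x * Real.sqrt (γ x (Y x) (Y x)) := by
    rw [Real.sqrt_mul (sq_nonneg _), Real.sqrt_sq hθ.le]
  simp only [ttTensor, ← hY x hx, h.pullback x hx, hs]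
  have hz : θ x ^ (2 - (n : ℤ)) = θ x ^ 4 / θ x ^ (n + 2) := by
    rw [← zpow_natCast, ← zpow_natCast, ← zpow_sub₀ hθ.ne']
    congr 1; push_cast; ring
  rw [hz, mul_pow]
  set R := Real.sqrt (γ x (Y x) (Y x)) ^ (n + 2)
  have : θ x ^ (n + 2) ≠ 0 := pow_ne_zero _ hθ.ne'
  rw [← div_div]
  field_simp

/-- `D_Y` is homogeneous in `Y` of degree `2 - (n+2) = -n`. -/
theorem ttTensor_smul {n : ℕ} {κ c : ℝ} (hc : 0 < c) {γ : V → V → V → ℝ} {Y : V → V} {x : V}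
    (hl : ∀ u v, γ x (c • u) v = c * γ x u v) (hr : ∀ u v, γ x u (c • v) = c * γ x u v) :
    ttTensor n κ γ (fun x => c • Y x) x = ttTensor n (κ / c ^ n) γ Y x := by
  funext u v
  simp only [ttTensor, hl, hr]
  have hs : Real.sqrt (c * (c * γ x (Y x) (Y x))) = c * Real.sqrt (γ x (Y x) (Y x)) := by
    rw [← mul_assoc, Real.sqrt_mul (mul_self_nonneg c), Real.sqrt_mul_self hc.le]
  rw [hs, mul_pow]
  field_simp
  ring

/-- The pulled-back metric is positive definite, so the derivative is injective, hence bijective by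
dimension, and the inverse function theorem applies. -/
theorem exists_isLocalConformal_flat [FiniteDimensional ℝ V] {n : ℕ}
    (hV : Module.finrank ℝ V = n) {U : Set V} (hU : IsOpen U) {γ : V → V → V → ℝ}
    (hγ : ∀ x ∈ U, ∀ u, u ≠ 0 → 0 < γ x u u) {φ : V → Euc n} {θ : V → ℝ}
    (hφ : ContDiffOn ℝ ∞ φ U) (hθ : ContDiffOn ℝ ∞ θ U) (hθ0 : ∀ x ∈ U, 0 < θ x)
    (hpull : ∀ x ∈ U, ∀ u v, flatMetric n (φ x) (fderiv ℝ φ x u) (fderiv ℝ φ x v)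
      = θ x ^ 2 * γ x u v) {x₀ : V} (hx₀ : x₀ ∈ U) :
    ∃ e : OpenPartialHomeomorph V (Euc n), (e : V → Euc n) = φ ∧ x₀ ∈ e.source ∧
      IsLocalConformal U γ univ (flatMetric n) e θ := by
  have : CompleteSpace V := FiniteDimensional.complete ℝ V
  have hat : ∀ x ∈ U, ContDiffAt ℝ ∞ φ x := fun x hx => hφ.contDiffAt (hU.mem_nhds hx)
  have hequiv : ∀ x ∈ U, ∃ L : V ≃L[ℝ] Euc n, HasFDerivAt φ (L : V →L[ℝ] Euc n) x := by
    intro x hx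
    have hd := ((hat x hx).differentiableAt (by simp)).hasFDerivAt
    have hinj : Function.Injective (fderiv ℝ φ x) := by
      rw [injective_iff_map_eq_zero]
      intro u hu
      by_contra hne
      have h1 := hpull x hx u u
      rw [hu] at h1
      have h2 := mul_pos (pow_pos (hθ0 x hx) 2) (hγ x hx u hne)
      rw [← h1, flatMetric, inner_zero_left] at h2
      exact lt_irrefl _ h2
    let L₀ := LinearEquiv.ofInjectiveOfFinrankEq (fderiv ℝ φ x : V →ₗ[ℝ] Euc n) hinj (by simp [hV])
    exact ⟨L₀.toContinuousLinearEquiv, hd⟩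
  obtain ⟨L, hL⟩ := hequiv x₀ hx₀
  let e₀ := (hat x₀ hx₀).toOpenPartialHomeomorph φ hL (by simp)
  have he₀ : (e₀ : V → Euc n) = φ := rfl
  let e := e₀.restrOpen U hU
  have hs : e.source = e₀.source ∩ U := rfl
  have he : (e : V → Euc n) = φ := rfl
  have hsU : e.source ⊆ U := fun x hx => hx.2
  have hxe : x₀ ∈ e.source := ⟨(hat x₀ hx₀).mem_toOpenPartialHomeomorph_source hL (by simp), hx₀⟩
  refine ⟨e, he, hxe, ⟨⟨x₀, hxe⟩, hsU, subset_univ _, ?_, ?_, hθ.mono hsU, fun x hx => hθ0 x (hsU hx), ?_⟩⟩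
  · rw [he]; exact hφ.mono hsU
  · intro y hy
    have hy' := hsU (e.map_target hy)
    obtain ⟨L', hL'⟩ := hequiv _ hy'
    exact (e.contDiffAt_symm hy (by rw [he]; exact hL') (by rw [he]; exact hat _ hy')).contDiffWithinAt
  · intro x hx
    rw [he]
    exact hpull x (hsU hx)

/-! ### The light cone and `𝔼ⁿ` -/

/-- The point of `𝔼ⁿ` on the null ray through `v`. -/
def coneProj {n : ℕ} (v : MinkIdx n → ℝ) : Euc n :=
  WithLp.toLp 2 fun A => 2 * v (Sum.inr A) / (v (Sum.inl 0) + v (Sum.inl 1))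

theorem contDiffAt_coneProj {n : ℕ} {v : MinkIdx n → ℝ} (hv : v (Sum.inl 0) + v (Sum.inl 1) ≠ 0) :
    ContDiffAt ℝ ∞ (coneProj (n := n)) v := by
  rw [contDiffAt_euclidean]
  intro A
  have : ∀ j : MinkIdx n, ContDiffAt ℝ ∞ (fun v : MinkIdx n → ℝ => v j) v := fun j => by fun_prop
  exact (contDiffAt_const.mul (this _)).div ((this _).add (this _)) hv

/-- The product rule for `S · X_A = 2 N_A`, with `S = N₀ + N₁`, avoids differentiating a quotient.
-/
theorem fderiv_coneProj_comp_apply {n : ℕ} {N : V → MinkIdx n → ℝ}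
    {N' : V →L[ℝ] (MinkIdx n → ℝ)} {x : V} (hN : HasFDerivAt N N' x)
    (hS : N x (Sum.inl 0) + N x (Sum.inl 1) ≠ 0) (u : V) (A : Fin n) :
    (N' u (Sum.inl 0) + N' u (Sum.inl 1)) * coneProj (N x) A
      + (N x (Sum.inl 0) + N x (Sum.inl 1)) * fderiv ℝ (fun y => coneProj (N y)) x u A
      = 2 * N' u (Sum.inr A) := by
  have hφ : HasFDerivAt (fun y => coneProj (N y)) (fderiv ℝ (fun y => coneProj (N y)) x) x :=
    (((contDiffAt_coneProj hS).differentiableAt (by simp)).comp x hN.differentiableAt).hasFDerivAt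
  have h1 : ∀ j, HasFDerivAt (fun y => N y j) ((ContinuousLinearMap.proj j).comp N') x := fun j =>
    hasFDerivAt_pi'.1 hN j
  have h2 := (EuclideanSpace.proj A : Euc n →L[ℝ] ℝ).hasFDerivAt.comp x hφ
  have h3 := ((h1 (Sum.inl 0)).add (h1 (Sum.inl 1))).mul h2
  have hev : ∀ᶠ y in 𝓝 x, (N y (Sum.inl 0) + N y (Sum.inl 1)) * coneProj (N y) A
      = 2 * N y (Sum.inr A) := by
    have hc : ContinuousAt (fun y => N y (Sum.inl 0) + N y (Sum.inl 1)) x :=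
      ((h1 (Sum.inl 0)).add (h1 (Sum.inl 1))).continuousAt
    filter_upwards [hc.eventually_ne hS] with y hy
    simp only [coneProj]
    field_simp
  have h4 := ((h1 (Sum.inr A)).const_mul 2).congr_of_eventuallyEq hev
  have h5 := DFunLike.congr_fun (h3.unique h4) u
  simp at h5
  linarith

/-- Rescaling a null section `N` adds to `dN` multiples of `N`, which is orthogonal to itself and to
`dN`; only the factor `(2/S)²` survives. For this the nullity is needed near `x`, since it is
differentiated. -/
theorem inner_fderiv_coneProj_comp {n : ℕ} {N : V → MinkIdx n → ℝ}
    {N' : V →L[ℝ] (MinkIdx n → ℝ)} {x : V} (hN : HasFDerivAt N N' x)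
    (hS : N x (Sum.inl 0) + N x (Sum.inl 1) ≠ 0)
    (h0 : ∀ᶠ y in 𝓝 x, minkInner n (N y) (N y) = 0) (u v : V) :
    inner ℝ (fderiv ℝ (fun y => coneProj (N y)) x u) (fderiv ℝ (fun y => coneProj (N y)) x v)
      = (2 / (N x (Sum.inl 0) + N x (Sum.inl 1))) ^ 2 * minkInner n (N' u) (N' v) := by
  have hφ := fderiv_coneProj_comp_apply hN hS
  set S := N x (Sum.inl 0) + N x (Sum.inl 1) with hSd
  set P := fderiv ℝ (fun y => coneProj (N y)) x
  have hcp : ∀ A, S * coneProj (N x) A = 2 * N x (Sum.inr A) := by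
    intro A; simp only [coneProj, ← hSd]; field_simp
  have hnull := h0.self_of_nhds
  have hnull' : ∀ u, minkInner n (N x) (N' u) = 0 := by
    intro u
    have h1 : ∀ j, HasFDerivAt (fun y => N y j) ((ContinuousLinearMap.proj j).comp N') x :=
      fun j => hasFDerivAt_pi'.1 hN j
    have h0' := h0
    simp only [minkInner_eq] at h0'
    have h2 := ((((h1 (Sum.inl 0)).mul (h1 (Sum.inl 0))).neg).add
        ((h1 (Sum.inl 1)).mul (h1 (Sum.inl 1)))).add
        (HasFDerivAt.fun_sum (u := Finset.univ) fun A _ => (h1 (Sum.inr A)).mul (h1 (Sum.inr A)))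
    have h3 := DFunLike.congr_fun (h2.unique ((hasFDerivAt_const (0 : ℝ) x).congr_of_eventuallyEq h0')) u
    simp at h3
    rw [minkInner_eq]
    rw [Finset.sum_add_distrib] at h3
    linarith
  rw [PiLp.inner_apply]
  have e1 : ∀ u, ∑ A, N x (Sum.inr A) * N' u (Sum.inr A) =
      N x (Sum.inl 0) * N' u (Sum.inl 0) - N x (Sum.inl 1) * N' u (Sum.inl 1) := by
    intro u; have := hnull' u; rw [minkInner_eq] at this; linarith
  have e0 : ∑ A, N x (Sum.inr A) * N x (Sum.inr A) =
      N x (Sum.inl 0) * N x (Sum.inl 0) - N x (Sum.inl 1) * N x (Sum.inl 1) := by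
    have := hnull; rw [minkInner_eq] at this; linarith
  have hP : ∀ u A, P u A = 2 / S * N' u (Sum.inr A)
      - 2 / S ^ 2 * (N' u (Sum.inl 0) + N' u (Sum.inl 1)) * N x (Sum.inr A) := by
    intro u A
    have a1 := hφ u A
    have a2 := hcp A
    field_simp
    linear_combination S * a1 - (N' u (Sum.inl 0) + N' u (Sum.inl 1)) * a2
  have e2 : ∑ A, inner ℝ (P u A) (P v A) = (2 / S) ^ 2 * ∑ A, N' u (Sum.inr A) * N' v (Sum.inr A)
      - (4 / S ^ 3) * (N' v (Sum.inl 0) + N' v (Sum.inl 1)) * ∑ A, N x (Sum.inr A) * N' u (Sum.inr A)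
      - (4 / S ^ 3) * (N' u (Sum.inl 0) + N' u (Sum.inl 1)) * ∑ A, N x (Sum.inr A) * N' v (Sum.inr A)
      + (4 / S ^ 4) * (N' u (Sum.inl 0) + N' u (Sum.inl 1)) * (N' v (Sum.inl 0) + N' v (Sum.inl 1))
        * ∑ A, N x (Sum.inr A) * N x (Sum.inr A) := by
    simp only [Finset.mul_sum, ← Finset.sum_sub_distrib, ← Finset.sum_add_distrib]
    refine Finset.sum_congr rfl fun A _ => ?_
    simp only [hP, RCLike.inner_apply, conj_trivial]
    field_simp
    ring
  rw [e2, e1, e1, e0, minkInner_eq]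
  have hS1 : N x (Sum.inl 1) = S - N x (Sum.inl 0) := by rw [hSd]; ring
  rw [hS1]
  field_simp
  ring

theorem ckvf_apply {n : ℕ} (F : Matrix (MinkIdx n) (MinkIdx n) ℝ) (X : Euc n) (B : Fin n) :
    ckvf F X B = F (Sum.inl 0) (Sum.inr B) - F (Sum.inl 1) (Sum.inr B)
      - F (Sum.inl 0) (Sum.inl 1) * X B
      - (∑ A, (F (Sum.inl 0) (Sum.inr A) + F (Sum.inl 1) (Sum.inr A)) * X A) / 2 * X B
      + inner ℝ X X / 4 * (F (Sum.inl 0) (Sum.inr B) + F (Sum.inl 1) (Sum.inr B))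
      + ∑ A, F (Sum.inr B) (Sum.inr A) * X A := by
  have h1 : inner ℝ (WithLp.toLp 2 fun A =>
      -(F (Sum.inl 0) (Sum.inr A) + F (Sum.inl 1) (Sum.inr A)) / 2 : Euc n) X =
      -(∑ A, (F (Sum.inl 0) (Sum.inr A) + F (Sum.inl 1) (Sum.inr A)) * X A) / 2 := by
    rw [PiLp.inner_apply, neg_div, Finset.sum_div, ← Finset.sum_neg_distrib]
    refine Finset.sum_congr rfl fun A _ => ?_
    simp only [RCLike.inner_apply, conj_trivial]; ring
  have h2 : ((Matrix.of fun A B => -F (Sum.inr A) (Sum.inr B)) *ᵥ fun B => X B) B =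
      -∑ A, F (Sum.inr B) (Sum.inr A) * X A := by
    simp [Matrix.mulVec, dotProduct]
  simp only [ckvf, h1, PiLp.add_apply, PiLp.sub_apply, PiLp.smul_apply, smul_eq_mul]
  linear_combination -h2

/-- A null `N` over the point `X` is `(S/2) (1 + |X|²/4, 1 - |X|²/4, X)`. Substituting this into `F
*ᵥ N` and removing the radial part produces the quadratic field `ckvf F`. -/
theorem fderiv_coneProj_comp_ckvf {n : ℕ} {N : V → MinkIdx n → ℝ}
    {N' : V →L[ℝ] (MinkIdx n → ℝ)} {x : V} (hN : HasFDerivAt N N' x)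
    (hS : N x (Sum.inl 0) + N x (Sum.inl 1) ≠ 0) (h0 : minkInner n (N x) (N x) = 0)
    {F : Matrix (MinkIdx n) (MinkIdx n) ℝ} (hF : Fᵀ * minkEta n = -(minkEta n * F)) {ξ : V}
    (hξ : N' ξ = F *ᵥ N x) :
    fderiv ℝ (fun y => coneProj (N y)) x ξ = ckvf F (coneProj (N x)) := by
  have hφ := fderiv_coneProj_comp_apply hN hS ξ
  rw [hξ] at hφ
  have hent : ∀ i j, F j i * minkEta n j j = -(minkEta n i i * F i j) := by
    intro i j
    have := congrFun (congrFun hF i) j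
    simpa [minkEta, Matrix.mul_diagonal, Matrix.diagonal_mul] using this
  have f00 := hent (Sum.inl 0) (Sum.inl 0)
  have f11 := hent (Sum.inl 1) (Sum.inl 1)
  have f10 := hent (Sum.inl 0) (Sum.inl 1)
  have fA0 := fun A => hent (Sum.inl 0) (Sum.inr A)
  have fA1 := fun A => hent (Sum.inl 1) (Sum.inr A)
  simp [minkEta] at f00 f11 f10 fA0 fA1
  have f00' : F (Sum.inl 0) (Sum.inl 0) = 0 := by linarith
  have f11' : F (Sum.inl 1) (Sum.inl 1) = 0 := by linarith
  set S := N x (Sum.inl 0) + N x (Sum.inl 1) with hSd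
  set X := coneProj (N x) with hX
  have hcp : ∀ A, N x (Sum.inr A) = S / 2 * X A := by
    intro A; simp only [hX, coneProj, ← hSd]; field_simp
  have hXX : inner ℝ X X = ∑ A, X A * X A := by
    rw [PiLp.inner_apply]; simp [sq]
  have hnull : S * (N x (Sum.inl 0) - N x (Sum.inl 1)) = S ^ 2 / 4 * inner ℝ X X := by
    rw [minkInner_eq] at h0
    simp only [hcp] at h0
    rw [hXX, Finset.mul_sum]
    have : ∑ A, S / 2 * X A * (S / 2 * X A) = ∑ A, S ^ 2 / 4 * (X A * X A) :=
      Finset.sum_congr rfl fun A _ => by ring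
    rw [this] at h0
    rw [hSd] at *
    linarith
  have hN0 : N x (Sum.inl 0) = S / 2 * (1 + inner ℝ X X / 4) := by
    have : N x (Sum.inl 0) - N x (Sum.inl 1) = S / 4 * inner ℝ X X := by
      apply mul_left_cancel₀ hS; rw [hnull]; ring
    linarith
  have hN1 : N x (Sum.inl 1) = S / 2 * (1 - inner ℝ X X / 4) := by
    have : N x (Sum.inl 1) = S - N x (Sum.inl 0) := by rw [hSd]; ring
    rw [this, hN0]; ring
  ext B
  have h1 := hφ B
  apply mul_left_cancel₀ hS
  simp only [Matrix.mulVec, dotProduct, Fintype.sum_sum_type, Fin.sum_univ_two, hN0, hN1, hcp,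
    f00', f11', f10, fA0, fA1] at h1
  have s1 : ∀ G : Fin n → ℝ, ∑ A, G A * (S / 2 * X A) = S / 2 * ∑ A, G A * X A := by
    intro G; rw [Finset.mul_sum]; exact Finset.sum_congr rfl fun A _ => by ring
  rw [s1, s1, s1] at h1
  rw [ckvf_apply]
  simp only [add_mul, Finset.sum_add_distrib]
  linear_combination h1

end

end

noncomputable section

/-! ### The coordinates at infinity -/

theorem pNum_le_qNum (n : ℕ) : pNum n ≤ qNum n := by
  unfold qNum pNum; omega

theorem finrank_scriCoord {n : ℕ} (hn : 1 ≤ n) : Module.finrank ℝ (ScriCoord n) = n := by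
  simp only [Module.finrank_prod, Module.finrank_self, Module.finrank_fin_fun]
  unfold qNum pNum; omega

/-- Either `q = p + 1` (`n` even, all directions paired with an angle) or `q = p` (`n` odd, the last
one unpaired). -/
theorem sum_univ_castLE {p q : ℕ} (h : q ≤ p + 1) (h' : p ≤ q) (f : Fin (p + 1) → ℝ) :
    ∑ i, f i = ∑ i : Fin q, f (Fin.castLE h i) + if p = q then f (Fin.last p) else 0 := by
  rcases h'.eq_or_lt with rfl | h'
  · rw [Fin.sum_univ_castSucc]; simp; rfl
  · obtain rfl : q = p + 1 := by omega
    simp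

theorem sum_const_frame (n : ℕ) (c : ℝ) :
    ∑ _k : Fin (pNum n + 1 - qNum n), c = if pNum n = qNum n then c else 0 := by
  split_ifs with h
  · simp [h]
  · have : pNum n + 1 - qNum n = 0 := by
      have := pNum_le_qNum n; omega
    simp [this]

theorem isOpen_kdsDomain (n : ℕ) : IsOpen (kdsDomain n) := by
  have : kdsDomain n = (⋂ i, {x : ScriCoord n | 0 < x.2.1 i}) ∩ ({x | ∑ i, x.2.1 i ^ 2 < 1} ∩
      ⋂ i, ({x : ScriCoord n | 0 < x.2.2 i} ∩ {x | x.2.2 i < 2 * Real.pi})) := by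
    ext x; simp [kdsDomain]
  rw [this]
  refine (isOpen_iInter_of_finite fun i => isOpen_lt (by fun_prop) (by fun_prop)).inter
    ((isOpen_lt (by fun_prop) (by fun_prop)).inter (isOpen_iInter_of_finite fun i =>
      (isOpen_lt (by fun_prop) (by fun_prop)).inter (isOpen_lt (by fun_prop) (by fun_prop))))

theorem exists_mem_kdsDomain (n : ℕ) : ∃ α φ, ∀ t : ℝ, (t, α, φ) ∈ kdsDomain n := by
  have hp : (0 : ℝ) < pNum n + 1 := by positivity
  refine ⟨fun _ => 1 / (pNum n + 1), fun _ => 1, fun t => ⟨fun i => by positivity, ?_, fun i =>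
    ⟨one_pos, ?_⟩⟩⟩
  · simp only [Finset.sum_const, Finset.card_univ, Fintype.card_fin, nsmul_eq_mul]
    rw [one_div, inv_pow, ← div_eq_mul_inv, div_lt_one (by positivity)]
    nlinarith
  · have := Real.pi_gt_three
    show (1 : ℝ) < _
    linarith

variable {n : ℕ} {lam : ℝ} {a : Fin (qNum n) → ℝ} {x : ScriCoord n}

theorem contDiffAt_kdsAlpha (hx : x ∈ kdsDomain n) (i : Fin (pNum n + 1)) :
    ContDiffAt ℝ ∞ (fun x : ScriCoord n => kdsAlpha x i) x := by
  refine Fin.lastCases ?_ (fun i => ?_) i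
  · simp only [kdsAlpha, Fin.snoc_last]
    refine ContDiffAt.sqrt (by fun_prop) ?_
    have := hx.2.1
    exact (by linarith : (0 : ℝ) < 1 - ∑ i, x.2.1 i ^ 2).ne'
  · simp only [kdsAlpha, Fin.snoc_castSucc]
    fun_prop

theorem kdsAlpha_pos (hx : x ∈ kdsDomain n) (i : Fin (pNum n + 1)) : 0 < kdsAlpha x i := by
  refine Fin.lastCases ?_ (fun i => ?_) i
  · simp only [kdsAlpha, Fin.snoc_last]
    exact Real.sqrt_pos.2 (by have := hx.2.1; linarith)
  · simp only [kdsAlpha, Fin.snoc_castSucc]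
    exact hx.1 i

theorem sum_kdsAlpha_sq (hx : x ∈ kdsDomain n) : ∑ i, kdsAlpha x i ^ 2 = 1 := by
  rw [Fin.sum_univ_castSucc]
  simp only [kdsAlpha, Fin.snoc_last, Fin.snoc_castSucc]
  rw [Real.sq_sqrt (by have := hx.2.1; linarith)]
  ring

theorem sqrt_kdsRot_pos (hlam : 0 < lam) (i : Fin (pNum n + 1)) :
    0 < Real.sqrt (1 + lam * kdsRot a i ^ 2) :=
  Real.sqrt_pos.2 (by positivity)

theorem kdsAlphaHat_pos (hlam : 0 < lam) (hx : x ∈ kdsDomain n) (i : Fin (pNum n + 1)) :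
    0 < kdsAlphaHat lam a i x :=
  div_pos (kdsAlpha_pos hx i) (sqrt_kdsRot_pos hlam i)

theorem contDiffAt_kdsAlphaHat (hx : x ∈ kdsDomain n) (i : Fin (pNum n + 1)) :
    ContDiffAt ℝ ∞ (kdsAlphaHat lam a i) x :=
  (contDiffAt_kdsAlpha hx i).div_const _

theorem kdsW_pos (hlam : 0 < lam) (hx : x ∈ kdsDomain n) : 0 < kdsW lam a x :=
  Finset.sum_pos (fun i _ => pow_pos (kdsAlphaHat_pos hlam hx i) 2) ⟨0, Finset.mem_univ _⟩

theorem contDiffAt_kdsW (hx : x ∈ kdsDomain n) : ContDiffAt ℝ ∞ (kdsW lam a) x :=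
  ContDiffAt.sum fun i _ => (contDiffAt_kdsAlphaHat hx i).pow 2

theorem hasFDerivAt_kdsAlphaHat (hx : x ∈ kdsDomain n) (i : Fin (pNum n + 1)) :
    HasFDerivAt (kdsAlphaHat lam a i) (fderiv ℝ (kdsAlphaHat lam a i) x) x :=
  ((contDiffAt_kdsAlphaHat hx i).differentiableAt (by simp)).hasFDerivAt

theorem fderiv_kdsW_apply (hx : x ∈ kdsDomain n) (u : ScriCoord n) :
    fderiv ℝ (kdsW lam a) x u =
      2 * ∑ i, kdsAlphaHat lam a i x * fderiv ℝ (kdsAlphaHat lam a i) x u := by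
  have h : HasFDerivAt (kdsW lam a) _ x := HasFDerivAt.fun_sum (u := Finset.univ) fun i _ =>
    (hasFDerivAt_kdsAlphaHat (lam := lam) (a := a) hx i).pow 2
  rw [h.fderiv]
  simp [Finset.mul_sum, mul_assoc]

/-- `α̂_i` depends only on the `α`-coordinates. No domain hypothesis is needed, since `fderiv` is
`0` where the function is not differentiable. -/
theorem fderiv_kdsAlphaHat_eq_zero (i : Fin (pNum n + 1)) {u : ScriCoord n} (hu : u.2.1 = 0) :
    fderiv ℝ (kdsAlphaHat lam a i) x u = 0 := by
  by_cases hd : DifferentiableAt ℝ (kdsAlphaHat lam a i) x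
  · rw [← hd.lineDeriv_eq_fderiv, lineDeriv]
    have : (fun t : ℝ => kdsAlphaHat lam a i (x + t • u)) = fun _ => kdsAlphaHat lam a i x := by
      funext t
      simp [kdsAlphaHat, kdsAlpha, hu]
    rw [this, deriv_const]
  · rw [fderiv_zero_of_not_differentiableAt hd]; rfl

theorem fderiv_kdsAlphaHatQ (i : Fin (qNum n)) :
    fderiv ℝ (kdsAlphaHatQ lam a i) x = fderiv ℝ (kdsAlphaHat lam a (Fin.castLE (qNum_le n) i)) x :=
  rfl

theorem kdsGamma_eq (u v : ScriCoord n) :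
    kdsGamma lam a x u v = lam * kdsW lam a x * (u.1 * v.1)
      + ∑ i, fderiv ℝ (kdsAlphaHat lam a i) x u * fderiv ℝ (kdsAlphaHat lam a i) x v
      + ∑ i, kdsAlphaHatQ lam a i x ^ 2 * (u.2.2 i * v.2.2 i)
      - 1 / kdsW lam a x * (fderiv ℝ (kdsW lam a) x u * fderiv ℝ (kdsW lam a) x v / 4) := by
  rw [sum_univ_castLE (qNum_le n) (pNum_le_qNum n), kdsGamma, Finset.sum_add_distrib]
  simp only [fderiv_kdsAlphaHatQ]
  ring

theorem kdsGamma_smul_left (c : ℝ) (u v : ScriCoord n) :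
    kdsGamma lam a x (c • u) v = c * kdsGamma lam a x u v := by
  simp only [kdsGamma_eq, Prod.smul_fst, Prod.smul_snd, map_smul, smul_eq_mul, Pi.smul_apply,
    mul_sub, mul_add, Finset.mul_sum]
  congr 1
  · congr 1
    · congr 1
      · ring
      · exact Finset.sum_congr rfl fun i _ => by ring
    · exact Finset.sum_congr rfl fun i _ => by ring
  · ring

theorem kdsGamma_comm (u v : ScriCoord n) : kdsGamma lam a x u v = kdsGamma lam a x v u := by
  simp only [kdsGamma, mul_comm]

theorem kdsGamma_kdsField (hlam : 0 < lam) (hx : x ∈ kdsDomain n) (u : ScriCoord n) :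
    kdsGamma lam a x (kdsField lam a x) u =
      kdsW lam a x * u.1 - ∑ i, a i * kdsAlphaHatQ lam a i x ^ 2 * u.2.2 i := by
  have h : ∀ i, fderiv ℝ (kdsAlphaHat lam a i) x (lam⁻¹, 0, -a) = 0 := fun i =>
    fderiv_kdsAlphaHat_eq_zero i rfl
  rw [kdsGamma_eq, fderiv_kdsW_apply hx]
  simp only [h, kdsField, Pi.neg_apply]
  rw [sub_eq_add_neg (kdsW lam a x * u.1), ← Finset.sum_neg_distrib]
  have : ∀ i, kdsAlphaHatQ lam a i x ^ 2 * (-a i * u.2.2 i) =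
      -(a i * kdsAlphaHatQ lam a i x ^ 2 * u.2.2 i) := fun i => by ring
  simp only [this]
  simp
  field_simp

/-! ### The Kerr-de Sitter metric at infinity -/

theorem tendsto_kdsXi (hx : x ∈ kdsDomain n) :
    Tendsto (fun ρ => kdsXi a ρ x) (𝓝[>] 0) (𝓝 1) := by
  have h : ContinuousAt (fun ρ => kdsXi a ρ x) 0 := by
    unfold kdsXi
    refine tendsto_finsetSum _ fun i _ => ContinuousAt.div (by fun_prop) (by fun_prop) (by simp)
  have h0 : kdsXi a 0 x = 1 := by simp [kdsXi, sum_kdsAlpha_sq hx]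
  have := h.tendsto
  rw [h0] at this
  exact this.mono_left nhdsWithin_le_nhds

theorem tendsto_kdsK (hlam : 0 < lam) (hx : x ∈ kdsDomain n) (u : ScriCoord n) :
    Tendsto (fun ρ : ℝ => kdsK lam a ρ x (0, u)) (𝓝[>] 0)
      (𝓝 (kdsGamma lam a x (kdsField lam a x) u)) := by
  rw [kdsGamma_kdsField hlam hx]
  simp only [kdsK, mul_zero, sub_zero]
  exact tendsto_const_nhds

/-- On tangential vectors `ρ²` times the background is polynomial in `ρ`, with value `γ_a` at `0`;
the mass term carries `ρ² ρ^(n-2)` and disappears. -/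
theorem tendsto_sq_mul_kdsMetric (hn : 3 ≤ n) (hlam : 0 < lam) (M : ℝ) (hx : x ∈ kdsDomain n)
    (u v : ScriCoord n) :
    Tendsto (fun ρ : ℝ => ρ ^ 2 * kdsMetric lam a M ρ x (0, u) (0, v)) (𝓝[>] 0)
      (𝓝 (kdsGamma lam a x u v)) := by
  have hid : Tendsto (fun ρ : ℝ => ρ) (𝓝[>] 0) (𝓝 0) := nhdsWithin_le_nhds
  have hPi : Tendsto (fun ρ => kdsPi a ρ) (𝓝[>] 0) (𝓝 1) := by
    have h : Continuous (fun ρ => kdsPi a ρ) := by unfold kdsPi; fun_prop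
    have h0 : kdsPi a 0 = 1 := by simp [kdsPi]
    have := h.tendsto 0
    rw [h0] at this
    exact this.mono_left nhdsWithin_le_nhds
  have hM : Tendsto (fun ρ : ℝ => ρ ^ 2 * (2 * M * ρ ^ (n - 2) / (kdsPi a ρ * kdsXi a ρ x) *
      (kdsK lam a ρ x (0, u) * kdsK lam a ρ x (0, v)))) (𝓝[>] 0) (𝓝 0) := by
    have h1 : Tendsto (fun ρ : ℝ => ρ ^ (n - 2)) (𝓝[>] 0) (𝓝 0) := by
      simpa [show n - 2 ≠ 0 by omega] using hid.pow (n - 2)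
    have := (hid.pow 2).mul ((((h1.const_mul (2 * M)).div (hPi.mul (tendsto_kdsXi (a := a) hx))
      (by norm_num))).mul ((tendsto_kdsK (a := a) hlam hx u).mul
        (tendsto_kdsK (a := a) hlam hx v)))
    simpa using this
  have hB : Tendsto (fun ρ : ℝ =>
      -kdsW lam a x * (ρ ^ 2 - lam) * (u.1 * v.1)
      + (if pNum n = qNum n then
      fderiv ℝ (kdsAlphaHat lam a (Fin.last (pNum n))) x u
        * fderiv ℝ (kdsAlphaHat lam a (Fin.last (pNum n))) x v else 0)
      + ∑ i, (1 + ρ ^ 2 * a i ^ 2) *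
      (fderiv ℝ (kdsAlphaHatQ lam a i) x u * fderiv ℝ (kdsAlphaHatQ lam a i) x v
        + kdsAlphaHatQ lam a i x ^ 2 * (u.2.2 i * v.2.2 i))
      + (ρ ^ 2 - lam) / (lam * kdsW lam a x)
      * (fderiv ℝ (kdsW lam a) x u * fderiv ℝ (kdsW lam a) x v / 4)) (𝓝[>] 0)
      (𝓝 (kdsGamma lam a x u v)) := by
    refine Tendsto.mono_left ?_ nhdsWithin_le_nhds
    refine Continuous.tendsto' (by fun_prop) _ _ ?_
    have hW := (kdsW_pos (a := a) hlam hx).ne'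
    simp only [kdsGamma]
    simp
    field_simp
    ring
  have := hB.add hM
  rw [add_zero] at this
  refine this.congr' ?_
  filter_upwards [self_mem_nhdsWithin] with ρ hρ
  have hρ : ρ ≠ 0 := ne_of_gt hρ
  have hW := (kdsW_pos (a := a) hlam hx).ne'
  rw [kdsMetric, mul_add]
  congr 1
  simp only [kdsBackground, mul_add, Finset.mul_sum]
  congr 1
  · congr 1
    · congr 1
      · simp only [mul_zero, zero_div, add_zero]
        field_simp
      · split_ifs
        · field_simp
        · simp
    · refine Finset.sum_congr rfl fun i _ => ?_
      field_simp
  · field_simp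

/-! ### The conformal embedding of the boundary into the light cone -/

/-- The direction cosines `α̂_i / √W` on the unit sphere. -/
def kdsSphere (lam : ℝ) (a : Fin (qNum n) → ℝ) (i : Fin (pNum n + 1)) (x : ScriCoord n) : ℝ :=
  kdsAlphaHat lam a i x / Real.sqrt (kdsW lam a x)

theorem contDiffAt_kdsSphere (hlam : 0 < lam) (hx : x ∈ kdsDomain n) (i : Fin (pNum n + 1)) :
    ContDiffAt ℝ ∞ (kdsSphere lam a i) x :=
  (contDiffAt_kdsAlphaHat hx i).div ((contDiffAt_kdsW hx).sqrt (kdsW_pos hlam hx).ne')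
    (Real.sqrt_pos.2 (kdsW_pos hlam hx)).ne'

theorem kdsSphere_pos (hlam : 0 < lam) (hx : x ∈ kdsDomain n) (i : Fin (pNum n + 1)) :
    0 < kdsSphere lam a i x :=
  div_pos (kdsAlphaHat_pos hlam hx i) (Real.sqrt_pos.2 (kdsW_pos hlam hx))

theorem sum_kdsSphere_sq (hlam : 0 < lam) (hx : x ∈ kdsDomain n) :
    ∑ i, kdsSphere lam a i x ^ 2 = 1 := by
  have hW := kdsW_pos (a := a) hlam hx
  simp only [kdsSphere, div_pow, Real.sq_sqrt hW.le]
  rw [← Finset.sum_div]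
  exact div_self hW.ne'

theorem fderiv_kdsSphere_apply (hlam : 0 < lam) (hx : x ∈ kdsDomain n) (i : Fin (pNum n + 1))
    (u : ScriCoord n) :
    fderiv ℝ (kdsSphere lam a i) x u = (fderiv ℝ (kdsAlphaHat lam a i) x u
      - kdsAlphaHat lam a i x * (fderiv ℝ (kdsW lam a) x u / (2 * kdsW lam a x)))
        / Real.sqrt (kdsW lam a x) := by
  have hW := kdsW_pos (a := a) hlam hx
  have hs := Real.sqrt_pos.2 hW
  have h1 := (((contDiffAt_kdsW (lam := lam) (a := a) hx).differentiableAt (by simp)).hasFDerivAt.sqrt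
    hW.ne')
  have h2 := ((contDiffAt_kdsSphere (a := a) hlam hx i).differentiableAt (by simp)).hasFDerivAt.mul h1
  have h3 : (fun y => kdsSphere lam a i y * Real.sqrt (kdsW lam a y)) =ᶠ[𝓝 x]
      kdsAlphaHat lam a i := by
    filter_upwards [(isOpen_kdsDomain n).mem_nhds hx] with y hy
    exact div_mul_cancel₀ _ (Real.sqrt_pos.2 (kdsW_pos hlam hy)).ne'
  have h4 := DFunLike.congr_fun (h2.unique ((hasFDerivAt_kdsAlphaHat hx i).congr_of_eventuallyEq h3)) u
  have h5 := Real.sq_sqrt hW.le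
  simp [kdsSphere] at h4
  rw [eq_div_iff hs.ne', ← h4]
  field_simp
  rw [h5]
  ring

/-- The relation `∑ α̂_i dα̂_i = dW/2` merges the cross terms into `-dW²/(4W)`, exactly the last
term of `γ_a`. -/
theorem sum_fderiv_kdsSphere (hlam : 0 < lam) (hx : x ∈ kdsDomain n) (u v : ScriCoord n) :
    ∑ i, fderiv ℝ (kdsSphere lam a i) x u * fderiv ℝ (kdsSphere lam a i) x v =
      (∑ i, fderiv ℝ (kdsAlphaHat lam a i) x u * fderiv ℝ (kdsAlphaHat lam a i) x v
      - 1 / kdsW lam a x * (fderiv ℝ (kdsW lam a) x u * fderiv ℝ (kdsW lam a) x v / 4))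
        / kdsW lam a x := by
  have hW := kdsW_pos (a := a) hlam hx
  have hs := Real.sqrt_pos.2 hW
  have h3 := Real.mul_self_sqrt hW.le
  have hu := fderiv_kdsW_apply (lam := lam) (a := a) hx u
  have hv := fderiv_kdsW_apply (lam := lam) (a := a) hx v
  have hw : kdsW lam a x = ∑ i, kdsAlphaHat lam a i x * kdsAlphaHat lam a i x := by
    simp only [kdsW, sq]
  have hyu := fun i => fderiv_kdsSphere_apply (a := a) hlam hx i u
  have hyv := fun i => fderiv_kdsSphere_apply (a := a) hlam hx i v
  set dWu := fderiv ℝ (kdsW lam a) x u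
  set dWv := fderiv ℝ (kdsW lam a) x v
  set W := kdsW lam a x
  have e : ∀ i, fderiv ℝ (kdsSphere lam a i) x u * fderiv ℝ (kdsSphere lam a i) x v =
      (fderiv ℝ (kdsAlphaHat lam a i) x u * fderiv ℝ (kdsAlphaHat lam a i) x v
      - dWv / (2 * W) * (kdsAlphaHat lam a i x * fderiv ℝ (kdsAlphaHat lam a i) x u)
      - dWu / (2 * W) * (kdsAlphaHat lam a i x * fderiv ℝ (kdsAlphaHat lam a i) x v)
      + dWu * dWv / (4 * W ^ 2) * (kdsAlphaHat lam a i x * kdsAlphaHat lam a i x)) / W := by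
    intro i
    rw [hyu, hyv, div_mul_div_comm, h3]
    congr 1
    field_simp
    ring
  simp only [e]
  rw [← Finset.sum_div, Finset.sum_add_distrib, Finset.sum_sub_distrib, Finset.sum_sub_distrib,
    ← Finset.mul_sum, ← Finset.mul_sum, ← Finset.mul_sum, ← hw]
  have hu' : ∑ i, kdsAlphaHat lam a i x * fderiv ℝ (kdsAlphaHat lam a i) x u = dWu / 2 := by
    rw [hu]; ring
  have hv' : ∑ i, kdsAlphaHat lam a i x * fderiv ℝ (kdsAlphaHat lam a i) x v = dWv / 2 := by
    rw [hv]; ring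
  rw [hu', hv']
  congr 1
  field_simp
  ring

/-- The bracket is the product metric on a line times the unit sphere in polar coordinates; the
rotation parameters enter only through the conformal factor and the choice of coordinates. -/
theorem kdsGamma_eq_mul (hlam : 0 < lam) (hx : x ∈ kdsDomain n) (u v : ScriCoord n) :
    kdsGamma lam a x u v = kdsW lam a x * (lam * (u.1 * v.1)
      + ∑ i, fderiv ℝ (kdsSphere lam a i) x u * fderiv ℝ (kdsSphere lam a i) x v
      + ∑ i, kdsSphere lam a (Fin.castLE (qNum_le n) i) x ^ 2 * (u.2.2 i * v.2.2 i)) := by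
  have hW := kdsW_pos (a := a) hlam hx
  have e : ∑ i, kdsSphere lam a (Fin.castLE (qNum_le n) i) x ^ 2 * (u.2.2 i * v.2.2 i) =
      (∑ i, kdsAlphaHatQ lam a i x ^ 2 * (u.2.2 i * v.2.2 i)) / kdsW lam a x := by
    rw [Finset.sum_div]
    refine Finset.sum_congr rfl fun i _ => ?_
    rw [kdsSphere, div_pow, Real.sq_sqrt hW.le, kdsAlphaHatQ]
    ring
  rw [kdsGamma_eq, sum_fderiv_kdsSphere hlam hx, e]
  field_simp
  ring

/-- If the sum of squares vanishes, the `t` and `φ` components are zero and the direction cosines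
are stationary, so `dα_i = τ α_i` with a common `τ`. Differentiating `∑ α_i² = 1` gives `τ = 0`. -/
theorem kdsGamma_pos (hlam : 0 < lam) (hx : x ∈ kdsDomain n) {u : ScriCoord n} (hu : u ≠ 0) :
    0 < kdsGamma lam a x u u := by
  have hW := kdsW_pos (a := a) hlam hx
  rw [kdsGamma_eq_mul hlam hx]
  refine mul_pos hW ?_
  by_contra hneg
  apply hu
  have p1 : 0 ≤ lam * (u.1 * u.1) := mul_nonneg hlam.le (mul_self_nonneg _)
  have p2 : 0 ≤ ∑ i, fderiv ℝ (kdsSphere lam a i) x u * fderiv ℝ (kdsSphere lam a i) x u :=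
    Finset.sum_nonneg fun i _ => mul_self_nonneg _
  have p3 : ∀ i ∈ Finset.univ,
      0 ≤ kdsSphere lam a (Fin.castLE (qNum_le n) i) x ^ 2 * (u.2.2 i * u.2.2 i) :=
    fun i _ => mul_nonneg (sq_nonneg _) (mul_self_nonneg _)
  have p3' := Finset.sum_nonneg p3
  have z1 : lam * (u.1 * u.1) = 0 := by linarith
  have z2 : ∑ i, fderiv ℝ (kdsSphere lam a i) x u * fderiv ℝ (kdsSphere lam a i) x u = 0 := by
    linarith
  have z3 : ∑ i, kdsSphere lam a (Fin.castLE (qNum_le n) i) x ^ 2 * (u.2.2 i * u.2.2 i) = 0 := by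
    linarith
  have h1 : u.1 = 0 := by simpa [hlam.ne'] using z1
  have h3 : u.2.2 = 0 := by
    funext i
    have := (Finset.sum_eq_zero_iff_of_nonneg p3).1 z3 i (Finset.mem_univ _)
    simpa [(kdsSphere_pos hlam hx _).ne'] using this
  have h2 : ∀ i, fderiv ℝ (kdsAlphaHat lam a i) x u =
      kdsAlphaHat lam a i x * (fderiv ℝ (kdsW lam a) x u / (2 * kdsW lam a x)) := by
    intro i
    have := (Finset.sum_eq_zero_iff_of_nonneg (fun i _ => mul_self_nonneg _)).1 z2 i
      (Finset.mem_univ _)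
    rw [mul_self_eq_zero, fderiv_kdsSphere_apply hlam hx, div_eq_zero_iff, sub_eq_zero] at this
    exact this.resolve_right (Real.sqrt_pos.2 hW).ne'
  set τ := fderiv ℝ (kdsW lam a) x u / (2 * kdsW lam a x)
  have hα : ∀ i, HasFDerivAt (fun x : ScriCoord n => kdsAlpha x i)
      (fderiv ℝ (fun x : ScriCoord n => kdsAlpha x i) x) x := fun i =>
    ((contDiffAt_kdsAlpha hx i).differentiableAt (by simp)).hasFDerivAt
  have h4 : ∀ i, fderiv ℝ (fun x : ScriCoord n => kdsAlpha x i) x u = kdsAlpha x i * τ := by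
    intro i
    have e := (hα i).mul_const (Real.sqrt (1 + lam * kdsRot a i ^ 2))⁻¹
    have e' : HasFDerivAt (kdsAlphaHat lam a i) _ x := e
    have h := h2 i
    rw [e'.fderiv, kdsAlphaHat] at h
    have hs := (sqrt_kdsRot_pos (a := a) hlam i).ne'
    simp at h
    field_simp at h
    exact h
  have h5 : ∑ i, kdsAlpha x i * fderiv ℝ (fun x : ScriCoord n => kdsAlpha x i) x u = 0 := by
    have e := HasFDerivAt.fun_sum (u := Finset.univ) fun i _ => (hα i).pow 2
    have e' := e.unique ((hasFDerivAt_const (1 : ℝ) x).congr_of_eventuallyEq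
      (by filter_upwards [(isOpen_kdsDomain n).mem_nhds hx] with y hy using sum_kdsAlpha_sq hy))
    have := DFunLike.congr_fun e' u
    simp [mul_assoc, ← Finset.mul_sum] at this
    exact this
  have hτ : τ = 0 := by
    have : ∑ i, kdsAlpha x i * fderiv ℝ (fun x : ScriCoord n => kdsAlpha x i) x u =
        (∑ i, kdsAlpha x i ^ 2) * τ := by
      rw [Finset.sum_mul]
      exact Finset.sum_congr rfl fun i _ => by rw [h4]; ring
    rw [h5, sum_kdsAlpha_sq hx, one_mul] at this
    exact this.symm
  have h6 : u.2.1 = 0 := by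
    funext i
    have := h4 i.castSucc
    rw [hτ, mul_zero] at this
    have e : HasFDerivAt (fun x : ScriCoord n => kdsAlpha x i.castSucc)
        ((ContinuousLinearMap.proj i).comp ((ContinuousLinearMap.fst ℝ _ _).comp
          (ContinuousLinearMap.snd ℝ _ _))) x := by
      simp only [kdsAlpha, Fin.snoc_castSucc]
      exact ContinuousLinearMap.hasFDerivAt (E := ScriCoord n) ((ContinuousLinearMap.proj i).comp
        ((ContinuousLinearMap.fst ℝ _ _).comp (ContinuousLinearMap.snd ℝ _ _)))
    rw [e.fderiv] at this
    simpa using this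
  exact Prod.ext h1 (Prod.ext h6 h3)

/-- The boundary at infinity, conformally embedded into the light cone of the model. -/
def kdsCone (lam : ℝ) (a : Fin (qNum n) → ℝ) (x : ScriCoord n) : FrameModel n :=
  (Real.exp (Real.sqrt lam * x.1), Real.exp (-(Real.sqrt lam * x.1)), Sum.elim (Sum.elim
    (fun i => kdsSphere lam a (Fin.castLE (qNum_le n) i) x * Real.cos (x.2.2 i))
    (fun i => kdsSphere lam a (Fin.castLE (qNum_le n) i) x * Real.sin (x.2.2 i)))
    (fun _ => kdsSphere lam a (Fin.last _) x))

theorem contDiffAt_kdsCone (hlam : 0 < lam) (hx : x ∈ kdsDomain n) :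
    ContDiffAt ℝ ∞ (kdsCone lam a) x := by
  unfold kdsCone
  refine ContDiffAt.prodMk (by fun_prop) (ContDiffAt.prodMk (by fun_prop) ?_)
  rw [contDiffAt_pi]
  rintro ((i | i) | i)
  · exact (contDiffAt_kdsSphere hlam hx _).mul (by fun_prop)
  · exact (contDiffAt_kdsSphere hlam hx _).mul (by fun_prop)
  · exact contDiffAt_kdsSphere hlam hx _

theorem modelInner_kdsCone (hlam : 0 < lam) (hx : x ∈ kdsDomain n) :
    modelInner (kdsCone lam a x) (kdsCone lam a x) = 0 := by
  have h := sum_kdsSphere_sq (a := a) hlam hx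
  rw [sum_univ_castLE (qNum_le n) (pNum_le_qNum n), ← sum_const_frame] at h
  simp only [modelInner, kdsCone, Fintype.sum_sum_type, Sum.elim_inl, Sum.elim_inr,
    ← Real.exp_add, ← Finset.sum_add_distrib, add_neg_cancel, neg_add_cancel, Real.exp_zero,
    ← sq]
  have e : ∀ i : Fin (qNum n), (kdsSphere lam a (Fin.castLE (qNum_le n) i) x * Real.cos (x.2.2 i)) ^ 2
      + (kdsSphere lam a (Fin.castLE (qNum_le n) i) x * Real.sin (x.2.2 i)) ^ 2 =
      kdsSphere lam a (Fin.castLE (qNum_le n) i) x ^ 2 := by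
    intro i
    rw [mul_pow, mul_pow, ← mul_add, Real.cos_sq_add_sin_sq, mul_one]
  simp only [e]
  linarith

theorem exists_hasFDerivAt_kdsCone (hlam : 0 < lam) (hx : x ∈ kdsDomain n) :
    ∃ N' : ScriCoord n →L[ℝ] FrameModel n, HasFDerivAt (kdsCone lam a) N' x ∧ ∀ u, N' u =
      (Real.sqrt lam * u.1 * Real.exp (Real.sqrt lam * x.1),
        -(Real.sqrt lam * u.1 * Real.exp (-(Real.sqrt lam * x.1))), Sum.elim (Sum.elim
        (fun i => fderiv ℝ (kdsSphere lam a (Fin.castLE (qNum_le n) i)) x u * Real.cos (x.2.2 i)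
          - kdsSphere lam a (Fin.castLE (qNum_le n) i) x * Real.sin (x.2.2 i) * u.2.2 i)
        (fun i => fderiv ℝ (kdsSphere lam a (Fin.castLE (qNum_le n) i)) x u * Real.sin (x.2.2 i)
          + kdsSphere lam a (Fin.castLE (qNum_le n) i) x * Real.cos (x.2.2 i) * u.2.2 i))
        (fun _ => fderiv ℝ (kdsSphere lam a (Fin.last _)) x u)) := by
  have hS : ∀ i, HasFDerivAt (kdsSphere lam a i) (fderiv ℝ (kdsSphere lam a i) x) x := fun i =>
    ((contDiffAt_kdsSphere hlam hx i).differentiableAt (by simp)).hasFDerivAt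
  have hφ : ∀ i : Fin (qNum n), HasFDerivAt (fun x : ScriCoord n => x.2.2 i)
      ((ContinuousLinearMap.proj i).comp ((ContinuousLinearMap.snd ℝ _ _).comp
          (ContinuousLinearMap.snd ℝ _ _))) x := fun i =>
    ContinuousLinearMap.hasFDerivAt (E := ScriCoord n) ((ContinuousLinearMap.proj i).comp
      ((ContinuousLinearMap.snd ℝ _ _).comp (ContinuousLinearMap.snd ℝ _ _)))
  have ht : HasFDerivAt (fun x : ScriCoord n => x.1) (ContinuousLinearMap.fst ℝ _ _) x :=
    hasFDerivAt_fst
  have hv : ∀ j, ∃ g : ScriCoord n →L[ℝ] ℝ, HasFDerivAt (fun x => (kdsCone lam a x).2.2 j) g x ∧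
      ∀ u, g u = Sum.elim (Sum.elim
        (fun i => fderiv ℝ (kdsSphere lam a (Fin.castLE (qNum_le n) i)) x u * Real.cos (x.2.2 i)
          - kdsSphere lam a (Fin.castLE (qNum_le n) i) x * Real.sin (x.2.2 i) * u.2.2 i)
        (fun i => fderiv ℝ (kdsSphere lam a (Fin.castLE (qNum_le n) i)) x u * Real.sin (x.2.2 i)
          + kdsSphere lam a (Fin.castLE (qNum_le n) i) x * Real.cos (x.2.2 i) * u.2.2 i))
        (fun _ => fderiv ℝ (kdsSphere lam a (Fin.last _)) x u) j := by
    rintro ((i | i) | i)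
    · refine ⟨_, (hS _).mul (hφ i).cos, fun u => ?_⟩
      simp; ring
    · refine ⟨_, (hS _).mul (hφ i).sin, fun u => ?_⟩
      simp; ring
    · exact ⟨_, hS _, fun u => rfl⟩
  choose g hg hgu using hv
  refine ⟨_, ((ht.const_mul _).exp).prodMk (((ht.const_mul _).neg.exp).prodMk
    (hasFDerivAt_pi.2 hg)), fun u => ?_⟩
  refine Prod.ext ?_ (Prod.ext ?_ ?_)
  · simp; ring
  · simp; ring
  · funext j
    exact hgu j u

theorem modelInner_fderiv_kdsCone (hlam : 0 < lam) (hx : x ∈ kdsDomain n)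
    {N' : ScriCoord n →L[ℝ] FrameModel n} (hN' : HasFDerivAt (kdsCone lam a) N' x)
    (u v : ScriCoord n) :
    modelInner (N' u) (N' v) = kdsGamma lam a x u v / kdsW lam a x := by
  obtain ⟨N'', hN'', hN''u⟩ := exists_hasFDerivAt_kdsCone (a := a) hlam hx
  obtain rfl := hN'.unique hN''
  have hW := (kdsW_pos (a := a) hlam hx).ne'
  rw [kdsGamma_eq_mul hlam hx, mul_div_cancel_left₀ _ hW,
    sum_univ_castLE (qNum_le n) (pNum_le_qNum n), ← sum_const_frame, hN''u, hN''u]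
  simp only [modelInner, Fintype.sum_sum_type, Sum.elim_inl, Sum.elim_inr]
  have e1 : Real.sqrt lam * u.1 * Real.exp (Real.sqrt lam * x.1) *
      (Real.sqrt lam * v.1 * Real.exp (-(Real.sqrt lam * x.1))) = lam * (u.1 * v.1) := by
    have h1 : Real.exp (Real.sqrt lam * x.1) * Real.exp (-(Real.sqrt lam * x.1)) = 1 := by
      rw [← Real.exp_add, add_neg_cancel, Real.exp_zero]
    have h2 := Real.mul_self_sqrt hlam.le
    linear_combination (Real.sqrt lam * Real.sqrt lam * u.1 * v.1) * h1 + u.1 * v.1 * h2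
  have e2 := Finset.sum_congr rfl fun (i : Fin (qNum n)) (_ : i ∈ Finset.univ) =>
    show (fderiv ℝ (kdsSphere lam a (Fin.castLE (qNum_le n) i)) x u * Real.cos (x.2.2 i)
          - kdsSphere lam a (Fin.castLE (qNum_le n) i) x * Real.sin (x.2.2 i) * u.2.2 i) *
        (fderiv ℝ (kdsSphere lam a (Fin.castLE (qNum_le n) i)) x v * Real.cos (x.2.2 i)
          - kdsSphere lam a (Fin.castLE (qNum_le n) i) x * Real.sin (x.2.2 i) * v.2.2 i) +
        (fderiv ℝ (kdsSphere lam a (Fin.castLE (qNum_le n) i)) x u * Real.sin (x.2.2 i)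
          + kdsSphere lam a (Fin.castLE (qNum_le n) i) x * Real.cos (x.2.2 i) * u.2.2 i) *
        (fderiv ℝ (kdsSphere lam a (Fin.castLE (qNum_le n) i)) x v * Real.sin (x.2.2 i)
          + kdsSphere lam a (Fin.castLE (qNum_le n) i) x * Real.cos (x.2.2 i) * v.2.2 i) =
        fderiv ℝ (kdsSphere lam a (Fin.castLE (qNum_le n) i)) x u *
          fderiv ℝ (kdsSphere lam a (Fin.castLE (qNum_le n) i)) x v +
        kdsSphere lam a (Fin.castLE (qNum_le n) i) x ^ 2 * (u.2.2 i * v.2.2 i) by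
      have := Real.cos_sq_add_sin_sq (x.2.2 i)
      linear_combination (fderiv ℝ (kdsSphere lam a (Fin.castLE (qNum_le n) i)) x u *
        fderiv ℝ (kdsSphere lam a (Fin.castLE (qNum_le n) i)) x v +
        kdsSphere lam a (Fin.castLE (qNum_le n) i) x ^ 2 * (u.2.2 i * v.2.2 i)) * this
  rw [Finset.sum_add_distrib, Finset.sum_add_distrib] at e2
  linear_combination e1 + e2

/-- Along `c λ⁻¹ ∂_t` the exponentials grow at rates `± √λ · c/λ = ± c/√λ`, while `-c a_i ∂_{φ_i}`
rotates the `i`-th plane. -/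
theorem fderiv_kdsCone_kdsField (hlam : 0 < lam) (hx : x ∈ kdsDomain n)
    {N' : ScriCoord n →L[ℝ] FrameModel n} (hN' : HasFDerivAt (kdsCone lam a) N' x) (c : ℝ) :
    N' (c • kdsField lam a x) = modelAct (c / Real.sqrt lam) (c • a) (kdsCone lam a x) := by
  obtain ⟨N'', hN'', hN''u⟩ := exists_hasFDerivAt_kdsCone (a := a) hlam hx
  obtain rfl := hN'.unique hN''
  have h0 : ∀ i, fderiv ℝ (kdsSphere lam a i) x (c • kdsField lam a x) = 0 := by
    intro i
    have h : ∀ i, fderiv ℝ (kdsAlphaHat lam a i) x (c • kdsField lam a x) = 0 := fun i =>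
      fderiv_kdsAlphaHat_eq_zero i (by simp [kdsField])
    rw [fderiv_kdsSphere_apply hlam hx, fderiv_kdsW_apply hx]
    simp [h]
  have hs : Real.sqrt lam * (c * lam⁻¹) = c / Real.sqrt lam := by
    have := Real.sqrt_pos.2 hlam
    field_simp
    rw [Real.sq_sqrt hlam.le, mul_comm]
  rw [hN''u]
  simp only [h0]
  refine Prod.ext ?_ (Prod.ext ?_ ?_)
  · simp [modelAct, kdsField, kdsCone, hs]
  · simp [modelAct, kdsField, kdsCone, hs]
  · funext j
    rcases j with (i | i) | i
    · simp [modelAct, kdsField, kdsCone]; ring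
    · simp [modelAct, kdsField, kdsCone]; ring
    · simp [modelAct]

/-- Provides a point where the chart `coneProj` is defined. If `v₀ + v₁` vanished along a whole
`t`-line, it would vanish on the images `p`, `m` of both null vectors. Then the null vector `p` has
no spatial part beyond `e₁`, and `⟨p, m⟩ = 0` instead of `-1/2`. -/
theorem exists_kdsCone_ne_zero {T : FrameModel n →ₗ[ℝ] (MinkIdx n → ℝ)}
    (hT : ∀ z z', minkInner n (T z) (T z') = modelInner z z') (hlam : 0 < lam)
    (a : Fin (qNum n) → ℝ) :
    ∃ x ∈ kdsDomain n, T (kdsCone lam a x) (Sum.inl 0) + T (kdsCone lam a x) (Sum.inl 1) ≠ 0 := by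
  obtain ⟨α, φ, hD⟩ := exists_mem_kdsDomain n
  by_contra! h
  let v := (kdsCone lam a (0, α, φ)).2.2
  have hv : ∀ t, (kdsCone lam a (t, α, φ)).2.2 = v := fun t => rfl
  have key : ∀ X : ℝ, 0 < X → T (X, X⁻¹, v) (Sum.inl 0) + T (X, X⁻¹, v) (Sum.inl 1) = 0 := by
    intro X hX
    have := h (Real.log X / Real.sqrt lam, α, φ) (hD _)
    have hs := (Real.sqrt_pos.2 hlam).ne'
    have e : kdsCone lam a (Real.log X / Real.sqrt lam, α, φ) = (X, X⁻¹, v) := by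
      refine Prod.ext ?_ (Prod.ext ?_ (hv _))
      · simp only [kdsCone]
        rw [mul_div_cancel₀ _ hs, Real.exp_log hX]
      · simp only [kdsCone]
        rw [mul_div_cancel₀ _ hs, Real.exp_neg, Real.exp_log hX]
    rwa [e] at this
  set p := T (1, 0, 0) with hp
  set m := T (0, 1, 0) with hm
  set r := T (0, 0, v) with hr
  have hlin : ∀ X Y : ℝ, T (X, Y, v) = X • p + Y • m + r := by
    intro X Y
    rw [hp, hm, hr, ← map_smul, ← map_smul, ← map_add, ← map_add]
    congr 1
    simp
  -- Three values of `X` separate the coefficients of `X`, `X⁻¹` and `1`.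
  have k1 := key 1 one_pos
  have k2 := key 2 two_pos
  have k3 := key (1 / 2) (by norm_num)
  simp only [hlin, Pi.add_apply, Pi.smul_apply, smul_eq_mul] at k1 k2 k3
  norm_num at k1 k2 k3
  have hpz : p (Sum.inl 1) = -p (Sum.inl 0) := by linarith
  have hmz : m (Sum.inl 1) = -m (Sum.inl 0) := by linarith
  have hpp : minkInner n p p = 0 := by rw [hp, hT]; simp [modelInner]
  have hpm : minkInner n p m = -1 / 2 := by rw [hp, hm, hT]; simp [modelInner]
  rw [minkInner_eq, hpz] at hpp
  rw [minkInner_eq, hpz, hmz] at hpm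
  have hps : ∑ A, p (Sum.inr A) * p (Sum.inr A) = 0 := by linarith
  have hp0 : ∀ A, p (Sum.inr A) = 0 := fun A => by
    simpa using (Finset.sum_eq_zero_iff_of_nonneg (fun A _ => mul_self_nonneg _)).1 hps A
      (Finset.mem_univ _)
  simp [hp0] at hpm
  norm_num at hpm

/-- If the conformal class of `F` contains boost and rotations with the rates of `c • ξ`, then the
boundary metric of the Kerr-de Sitter family is locally conformal to `𝔼ⁿ` by a map that sends
`c • ξ` to the conformal Killing field of `F`. -/
theorem IsNormalFrame.exists_isLocalConformal_kds (hn : 1 ≤ n) (hlam : 0 < lam)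
    {F : Matrix (MinkIdx n) (MinkIdx n) ℝ} (hF : Fᵀ * minkEta n = -(minkEta n * F)) {c : ℝ}
    {T : FrameModel n →ₗ[ℝ] (MinkIdx n → ℝ)}
    (h : IsNormalFrame F (c / Real.sqrt lam) (c • a) T) :
    ∃ (e : OpenPartialHomeomorph (ScriCoord n) (Euc n)) (θ : ScriCoord n → ℝ),
      IsLocalConformal (kdsDomain n) (kdsGamma lam a) univ (flatMetric n) e θ ∧
      ∀ x ∈ e.source, fderiv ℝ e x (c • kdsField lam a x) = ckvf F (e x) := by
  obtain ⟨x₀, hx₀, hS₀⟩ := exists_kdsCone_ne_zero h.inner hlam a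
  wlog hpos : 0 < T (kdsCone lam a x₀) (Sum.inl 0) + T (kdsCone lam a x₀) (Sum.inl 1)
    generalizing T
  · refine this h.neg ?_ ?_
    · simp only [LinearMap.neg_apply, Pi.neg_apply]
      rw [← neg_add]
      exact neg_ne_zero.2 hS₀
    · simp only [LinearMap.neg_apply, Pi.neg_apply]
      have := lt_of_le_of_ne (not_lt.1 hpos) hS₀
      linarith
  let T' : FrameModel n →L[ℝ] (MinkIdx n → ℝ) := LinearMap.toContinuousLinearMap T
  have hT' : ∀ z, T' z = T z := fun z => rfl
  let N : ScriCoord n → MinkIdx n → ℝ := fun x => T' (kdsCone lam a x)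
  have hN : ∀ x ∈ kdsDomain n, ContDiffAt ℝ ∞ N x := fun x hx =>
    T'.contDiff.contDiffAt.comp x (contDiffAt_kdsCone hlam hx)
  let S : ScriCoord n → ℝ := fun x => N x (Sum.inl 0) + N x (Sum.inl 1)
  have hNj : ∀ j, ∀ x ∈ kdsDomain n, ContDiffAt ℝ ∞ (fun x => N x j) x := fun j x hx =>
    contDiffAt_pi.1 (hN x hx) j
  have hS : ∀ x ∈ kdsDomain n, ContDiffAt ℝ ∞ S x := fun x hx =>
    (hNj _ x hx).add (hNj _ x hx)
  let U := kdsDomain n ∩ S ⁻¹' Ioi 0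
  have hU : IsOpen U := ContinuousOn.isOpen_inter_preimage
    (fun x hx => (hS x hx).continuousAt.continuousWithinAt) (isOpen_kdsDomain n) isOpen_Ioi
  have hUS : ∀ x ∈ U, N x (Sum.inl 0) + N x (Sum.inl 1) ≠ 0 := fun x hx =>
    (show (0 : ℝ) < S x from hx.2).ne'
  have hnull : ∀ x ∈ kdsDomain n, minkInner n (N x) (N x) = 0 := fun x hx => by
    rw [← modelInner_kdsCone (a := a) hlam hx, ← h.inner]; rfl
  -- `2 / S` comes from the chart of the cone and `1 / √W` from the embedding of the boundary into
  -- it.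
  let θ : ScriCoord n → ℝ := fun x => 2 / (S x * Real.sqrt (kdsW lam a x))
  have hder : ∀ x ∈ U, ∃ N₁ : ScriCoord n →L[ℝ] FrameModel n,
      HasFDerivAt (kdsCone lam a) N₁ x ∧ HasFDerivAt N (T'.comp N₁) x := fun x hx => by
    obtain ⟨N₁, hN₁, -⟩ := exists_hasFDerivAt_kdsCone (a := a) hlam hx.1
    exact ⟨N₁, hN₁, T'.hasFDerivAt.comp x hN₁⟩
  have hW : ∀ x ∈ U, 0 < Real.sqrt (kdsW lam a x) := fun x hx =>
    Real.sqrt_pos.2 (kdsW_pos hlam hx.1)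
  obtain ⟨e, he, -, hc⟩ := exists_isLocalConformal_flat (finrank_scriCoord hn) hU
    (γ := kdsGamma lam a) (φ := fun x => coneProj (N x)) (θ := θ) (x₀ := x₀)
    (fun x hx u hu => kdsGamma_pos hlam hx.1 hu)
    (fun x hx => ((contDiffAt_coneProj (hUS x hx)).comp x (hN x hx.1)).contDiffWithinAt)
    (fun x hx => (contDiffAt_const.div ((hS x hx.1).mul ((contDiffAt_kdsW hx.1).sqrt
      (kdsW_pos hlam hx.1).ne')) (mul_ne_zero (hUS x hx) (hW x hx).ne')).contDiffWithinAt)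
    (fun x hx => div_pos two_pos (mul_pos hx.2 (hW x hx)))
    (fun x hx u v => by
      obtain ⟨N₁, hN₁, hN₁'⟩ := hder x hx
      rw [flatMetric, inner_fderiv_coneProj_comp hN₁' (hUS x hx)
        (by filter_upwards [hU.mem_nhds hx] with y hy using hnull y hy.1)]
      have e1 : minkInner n ((T'.comp N₁) u) ((T'.comp N₁) v) =
          kdsGamma lam a x u v / kdsW lam a x := by
        rw [← modelInner_fderiv_kdsCone hlam hx.1 hN₁, ← h.inner]; rfl
      rw [e1]
      simp only [θ, div_pow, mul_pow, Real.sq_sqrt (kdsW_pos (a := a) hlam hx.1).le, S]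
      rw [div_mul_div_comm]
      ring) ⟨hx₀, hpos⟩
  refine ⟨e, θ, { hc with source_subset := hc.source_subset.trans inter_subset_left }, ?_⟩
  intro x hx
  have hxU := hc.source_subset hx
  obtain ⟨N₁, hN₁, hN₁'⟩ := hder x hxU
  rw [he]
  refine fderiv_coneProj_comp_ckvf hN₁' (hUS x hxU) (hnull x hxU.1) hF ?_
  change T (N₁ _) = F *ᵥ T _
  rw [h.act, fderiv_kdsCone_kdsField hlam hxU.1 hN₁]

end

noncomputable section

/-! ### Conformal Killing fields of `𝔼ⁿ` -/

/-- A symmetric bilinear form `H` on `𝔼ⁿ`, `n ≥ 3`, whose Kulkarni-Nomizu type product with the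
metric vanishes is zero. -/
theorem eq_zero_of_hessian_identity {n : ℕ} (hn : 3 ≤ n) (H : Euc n →L[ℝ] Euc n →L[ℝ] ℝ)
    (h : ∀ z u v w, H z v * inner ℝ u w - H z w * inner ℝ u v
      = H u v * inner ℝ z w - H u w * inner ℝ z v) : H = 0 := by
  let e := EuclideanSpace.basisFun (Fin n) ℝ
  have he : ∀ i j, inner ℝ (e i) (e j) = if i = j then (1 : ℝ) else 0 :=
    orthonormal_iff_ite.1 e.orthonormal
  -- This is where `n ≥ 3` enters: diagonal entries are pairwise opposite, so three of them must
  -- vanish, and an off-diagonal entry needs an index different from its two.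
  have third : ∀ i k : Fin n, ∃ j, j ≠ i ∧ j ≠ k := by
    intro i k
    have : ({i, k} : Finset (Fin n)).card < Fintype.card (Fin n) := by
      rw [Fintype.card_fin]
      exact lt_of_le_of_lt Finset.card_le_two (by omega)
    obtain ⟨j, hj⟩ := Finset.exists_mem_notMem_of_card_lt_card (s := {i, k}) (t := Finset.univ)
      (by simpa using this)
    simp only [Finset.mem_insert, Finset.mem_singleton, not_or] at hj
    exact ⟨j, hj.2.1, hj.2.2⟩
  have hdiag : ∀ i j, i ≠ j → H (e i) (e i) = -H (e j) (e j) := by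
    intro i j hij
    have := h (e i) (e j) (e i) (e j)
    simp only [he, if_neg hij, if_neg hij.symm, if_true] at this
    linarith
  have hall : ∀ i k, H (e i) (e k) = 0 := by
    intro i k
    obtain ⟨j, hji, hjk⟩ := third i k
    by_cases hik : i = k
    · subst hik
      obtain ⟨l, hli, hlj⟩ := third i j
      have h1 := hdiag i j hji.symm
      have h2 := hdiag j l hlj.symm
      have h3 := hdiag l i hli
      linarith
    · have := h (e i) (e j) (e k) (e j)
      simp only [he, if_neg hji.symm, if_neg hik, if_neg hjk, if_true] at this
      linarith
  have h1 : ∀ i, H (e i) = 0 := fun i => ContinuousLinearMap.coe_injective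
    (e.toBasis.ext fun k => by simpa using hall i k)
  exact ContinuousLinearMap.coe_injective (e.toBasis.ext fun i => by simpa using h1 i)

theorem skewMatrix_skew {n : ℕ} (ν : ℝ) (a b : Fin n → ℝ) {w : Matrix (Fin n) (Fin n) ℝ}
    (hw : wᵀ = -w) :
    (skewMatrix ν a b w)ᵀ * minkEta n = -(minkEta n * skewMatrix ν a b w) := by
  have hw' : ∀ i j, w j i = -w i j := fun i j => congrFun (congrFun hw i) j
  ext i j
  rw [minkEta, Matrix.mul_diagonal, Matrix.neg_apply, Matrix.diagonal_mul, Matrix.transpose_apply]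
  rcases i with i | i <;> rcases j with j | j
  · fin_cases i <;> fin_cases j <;> simp [skewMatrix]
  · fin_cases i <;> simp [skewMatrix]
    ring
  · fin_cases j <;> simp [skewMatrix]
    ring
  · simp [skewMatrix, hw' i j]

section

variable {n : ℕ} {Y : Euc n → Euc n} {h : Euc n → ℝ} {B : Set (Euc n)}

theorem contDiffAt_fderiv_of_contDiffOn {V W : Type*} [NormedAddCommGroup V] [NormedSpace ℝ V]
    [NormedAddCommGroup W] [NormedSpace ℝ W] {f : V → W} {s : Set V} (hs : IsOpen s)
    (hf : ContDiffOn ℝ ∞ f s) {x : V} (hx : x ∈ s) : ContDiffAt ℝ ∞ (fderiv ℝ f) x :=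
  (hf.contDiffAt (hs.mem_nhds hx)).fderiv_right (by simp)

theorem isSymmSndFDerivAt_of_contDiffOn {V W : Type*} [NormedAddCommGroup V] [NormedSpace ℝ V]
    [NormedAddCommGroup W] [NormedSpace ℝ W] {f : V → W} {s : Set V} (hs : IsOpen s)
    (hf : ContDiffOn ℝ ∞ f s) {x : V} (hx : x ∈ s) : IsSymmSndFDerivAt ℝ f x :=
  (hf.contDiffAt (hs.mem_nhds hx)).isSymmSndFDerivAt
    (by rw [minSmoothness_of_isRCLikeNormedField]
        exact WithTop.coe_le_coe.2 (le_top (a := (2 : ℕ∞))))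

theorem hasFDerivAt_fderiv_apply {V W : Type*} [NormedAddCommGroup V] [NormedSpace ℝ V]
    [NormedAddCommGroup W] [NormedSpace ℝ W] {f : V → W} {s : Set V} (hs : IsOpen s)
    (hf : ContDiffOn ℝ ∞ f s) {x : V} (hx : x ∈ s) (u : V) :
    HasFDerivAt (fun y => fderiv ℝ f y u) ((fderiv ℝ (fderiv ℝ f) x).flip u) x := by
  have h := ((contDiffAt_fderiv_of_contDiffOn hs hf hx).differentiableAt (by simp)).hasFDerivAt
  have := h.clm_apply (hasFDerivAt_const u x)
  simpa using this

/-- Differentiate the Killing equation and combine three permutations of the arguments, as for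
Christoffel symbols. -/
theorem conformalKilling_sndFDeriv (hB : IsOpen B) (hY : ContDiffOn ℝ ∞ Y B)
    (hh : ContDiffOn ℝ ∞ h B)
    (hK : ∀ x ∈ B, ∀ u v, inner ℝ (fderiv ℝ Y x u) v + inner ℝ u (fderiv ℝ Y x v)
      = 2 * h x * inner ℝ u v) {x : Euc n} (hx : x ∈ B) (u v w : Euc n) :
    inner ℝ (fderiv ℝ (fderiv ℝ Y) x u v) w =
      fderiv ℝ h x u * inner ℝ v w + fderiv ℝ h x v * inner ℝ u w
        - fderiv ℝ h x w * inner ℝ u v := by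
  have hd : HasFDerivAt h (fderiv ℝ h x) x :=
    ((hh.contDiffAt (hB.mem_nhds hx)).differentiableAt (by simp)).hasFDerivAt
  have key : ∀ z u v, inner ℝ (fderiv ℝ (fderiv ℝ Y) x z u) v
      + inner ℝ (fderiv ℝ (fderiv ℝ Y) x z v) u = 2 * fderiv ℝ h x z * inner ℝ u v := by
    intro z u v
    have h1 := ((hasFDerivAt_fderiv_apply hB hY hx u).inner ℝ (hasFDerivAt_const v x)).add
      ((hasFDerivAt_const u x).inner ℝ (hasFDerivAt_fderiv_apply hB hY hx v))
    have h2 := (hd.const_mul 2).mul_const (inner ℝ u v)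
    have h3 := h1.unique (h2.congr_of_eventuallyEq
      (by filter_upwards [hB.mem_nhds hx] with y hy using hK y hy u v))
    have h4 := DFunLike.congr_fun h3 z
    simp at h4
    rw [real_inner_comm u]
    linarith
  have hs : ∀ a b, fderiv ℝ (fderiv ℝ Y) x a b = fderiv ℝ (fderiv ℝ Y) x b a := fun a b =>
    isSymmSndFDerivAt_of_contDiffOn hB hY hx a b
  have k1 := key u v w
  have k2 := key v u w
  have k3 := key w u v
  rw [hs v u] at k2
  rw [hs w u, hs w v] at k3
  linarith

/-- The second derivatives of `Y` are expressed by `dh`. Symmetry of one further derivative is the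
integrability condition on the Hessian of `h` treated in `eq_zero_of_hessian_identity`. -/
theorem conformalKilling_hessian_eq_zero (hn : 3 ≤ n) (hB : IsOpen B) (hY : ContDiffOn ℝ ∞ Y B)
    (hh : ContDiffOn ℝ ∞ h B)
    (hK : ∀ x ∈ B, ∀ u v, inner ℝ (fderiv ℝ Y x u) v + inner ℝ u (fderiv ℝ Y x v)
      = 2 * h x * inner ℝ u v) {x : Euc n} (hx : x ∈ B) : fderiv ℝ (fderiv ℝ h) x = 0 := by
  refine eq_zero_of_hessian_identity hn _ fun z u v w => ?_
  have hs : ∀ a b, fderiv ℝ (fderiv ℝ h) x a b = fderiv ℝ (fderiv ℝ h) x b a := fun a b =>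
    isSymmSndFDerivAt_of_contDiffOn hB hh hx a b
  let s : Euc n → ℝ := fun y => inner ℝ (fderiv ℝ Y y v) w
  have hsc : ContDiffOn ℝ ∞ s B := fun y hy =>
    (((contDiffAt_fderiv_of_contDiffOn hB hY hy).clm_apply contDiffAt_const).inner ℝ
      contDiffAt_const).contDiffWithinAt
  have hsd : ∀ y ∈ B, ∀ u, fderiv ℝ s y u = fderiv ℝ h y u * inner ℝ v w
      + fderiv ℝ h y v * inner ℝ u w - fderiv ℝ h y w * inner ℝ u v := by
    intro y hy u
    have h1 : HasFDerivAt s _ y :=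
      (hasFDerivAt_fderiv_apply hB hY hy v).inner ℝ (hasFDerivAt_const w y)
    rw [h1.fderiv, ← conformalKilling_sndFDeriv hB hY hh hK hy]
    simp
  have key : ∀ z u, fderiv ℝ (fderiv ℝ s) x z u = fderiv ℝ (fderiv ℝ h) x z u * inner ℝ v w
      + fderiv ℝ (fderiv ℝ h) x z v * inner ℝ u w - fderiv ℝ (fderiv ℝ h) x z w * inner ℝ u v := by
    intro z u
    have h1 := hasFDerivAt_fderiv_apply hB hsc hx u
    have h2 := (((hasFDerivAt_fderiv_apply hB hh hx u).mul_const (inner ℝ v w)).add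
      ((hasFDerivAt_fderiv_apply hB hh hx v).mul_const (inner ℝ u w))).sub
      ((hasFDerivAt_fderiv_apply hB hh hx w).mul_const (inner ℝ u v))
    have h3 := h1.unique (h2.congr_of_eventuallyEq
      (by filter_upwards [hB.mem_nhds hx] with y hy using hsd y hy u))
    have h4 := DFunLike.congr_fun h3 z
    simp at h4
    linarith
  have hss : fderiv ℝ (fderiv ℝ s) x z u = fderiv ℝ (fderiv ℝ s) x u z :=
    isSymmSndFDerivAt_of_contDiffOn hB hsc hx z u
  rw [key, key, hs z u] at hss
  linarith

/-- Infinitesimal Liouville theorem: for `n ≥ 3` the conformal Killing fields of a domain of `𝔼ⁿ`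
are the fields `ckvf F`. -/
theorem exists_eq_ckvf_of_conformalKilling (hn : 3 ≤ n) (hB : IsOpen B) (hBc : IsPreconnected B)
    (hBn : B.Nonempty) (hY : ContDiffOn ℝ ∞ Y B)
    (hK : ∀ x ∈ B, ∀ u v, inner ℝ (fderiv ℝ Y x u) v + inner ℝ u (fderiv ℝ Y x v)
      = 2 * h x * inner ℝ u v) : ∃ F : SkewEnd n, ∀ x ∈ B, Y x = ckvf F.1 x := by
  obtain ⟨z₀, hz₀⟩ := hBn
  -- Smoothness of `h` is not assumed; the Killing equation evaluated on a unit vector expresses `h`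
  -- by `dY`.
  have hh : ContDiffOn ℝ ∞ h B := by
    let e : Euc n := EuclideanSpace.single ⟨0, by omega⟩ 1
    have h1 : ContDiffOn ℝ ∞ (fun y => inner ℝ (fderiv ℝ Y y e) e) B := fun y hy =>
      (((contDiffAt_fderiv_of_contDiffOn hB hY hy).clm_apply contDiffAt_const).inner ℝ
        contDiffAt_const).contDiffWithinAt
    refine h1.congr fun y hy => ?_
    have h2 := hK y hy e e
    have he : inner ℝ e e = (1 : ℝ) := by
      rw [real_inner_self_eq_norm_sq]; simp [e]
    rw [he, real_inner_comm (fderiv ℝ Y y e) e] at h2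
    linarith
  have hdh : ∀ x ∈ B, fderiv ℝ h x = fderiv ℝ h z₀ := fun x hx =>
    hB.is_const_of_fderiv_eq_zero hBc
      (fun y hy => ((contDiffAt_fderiv_of_contDiffOn hB hh hy).differentiableAt
        (by simp)).differentiableWithinAt)
      (fun y hy => conformalKilling_hessian_eq_zero hn hB hY hh hK hy) hx hz₀
  -- `h` is affine with gradient `a` and constant term `ν`; `w` and then `b` are fixed by matching
  -- `dY` and `Y` at `z₀`.
  let a : Euc n := (InnerProductSpace.toDual ℝ (Euc n)).symm (fderiv ℝ h z₀)
  have ha : ∀ u, fderiv ℝ h z₀ u = inner ℝ a u := fun u => by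
    simp [a]
  let ν : ℝ := h z₀ - inner ℝ a z₀
  -- the derivative of `X ↦ ν X + ⟨a, X⟩ X - (|X| ^ 2 / 2) a` in the direction `u`
  let P : Euc n → Euc n → Euc n := fun X u =>
    ν • u + (inner ℝ a u : ℝ) • X + (inner ℝ a X : ℝ) • u - (inner ℝ X u : ℝ) • a
  let w : Euc n →ₗ[ℝ] Euc n :=
    { toFun := fun u => P z₀ u - fderiv ℝ Y z₀ u
      map_add' := by intro u v; simp only [P, map_add, inner_add_right]; module
      map_smul' := by
        intro c u; simp only [P, map_smul, inner_smul_right, RingHom.id_apply]; module }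
  have hw : ∀ u v, inner ℝ (w u) v = -inner ℝ u (w v) := by
    intro u v
    have h1 := hK z₀ hz₀ u v
    simp only [w, P, LinearMap.coe_mk, AddHom.coe_mk, inner_sub_left, inner_sub_right,
      inner_add_left, inner_add_right, inner_smul_left, inner_smul_right, conj_trivial]
    rw [real_inner_comm a u, real_inner_comm z₀ u]
    simp only [ν]
    linear_combination -h1
  let wm : Matrix (Fin n) (Fin n) ℝ := Matrix.toEuclideanLin.symm w
  have hwm : ∀ u : Euc n, (WithLp.toLp 2 (wm *ᵥ fun A => u A) : Euc n) = w u := by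
    intro u
    have : Matrix.toEuclideanLin wm u = w u := by simp [wm]
    rw [← this]; rfl
  have hwm' : wmᵀ = -wm := by
    ext i j
    have h1 := hw (EuclideanSpace.single i 1) (EuclideanSpace.single j 1)
    rw [← hwm, ← hwm] at h1
    simpa [EuclideanSpace.inner_single_left, EuclideanSpace.inner_single_right, Matrix.mulVec,
      dotProduct] using h1
  let Q : Euc n → Euc n := fun X => ν • X + (inner ℝ a X : ℝ) • X - (inner ℝ X X / 2 : ℝ) • a - w X
  let b : Euc n := Y z₀ - Q z₀
  refine ⟨⟨skewMatrix ν a b wm, skewMatrix_skew ν a b hwm'⟩, fun x hx => ?_⟩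
  have hF : ckvf (skewMatrix ν a b wm) x = b + Q x := by
    rw [ckvf_skewMatrix, hwm]
    simp only [Q]
    module
  rw [hF]
  have hQ : ∀ X, ∃ Q' : Euc n →L[ℝ] Euc n, HasFDerivAt Q Q' X ∧ ∀ u, Q' u = P X u - w u := by
    intro X
    let w' : Euc n →L[ℝ] Euc n := LinearMap.toContinuousLinearMap w
    have hid := hasFDerivAt_id (𝕜 := ℝ) X
    refine ⟨_, ((((hid.const_smul ν).add (((hasFDerivAt_const a X).inner ℝ hid).smul hid)).sub
      (((hid.inner ℝ hid).mul_const (1 / 2 : ℝ)).smul_const a)).sub w'.hasFDerivAt).congr_of_eventuallyEq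
        (Eventually.of_forall fun X => ?_), fun u => ?_⟩
    · simp [Q, w', div_eq_mul_inv]
    · simp [P, w', real_inner_comm X u]
      module
  -- Both sides have the same derivative, by the formula for the second derivative of `Y`, and agree
  -- at `z₀` by the choice of `w`.
  have hDY : ∀ X ∈ B, ∀ u, fderiv ℝ Y X u = P X u - w u := by
    intro X hX u
    have hd : ∀ y ∈ B, HasFDerivAt (fun y => fderiv ℝ Y y u - (P y u - w u))
        (0 : Euc n →L[ℝ] Euc n) y := by
      intro y hy
      have hid := hasFDerivAt_id (𝕜 := ℝ) y
      have h1 := (hasFDerivAt_fderiv_apply hB hY hy u).sub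
        ((((((hasFDerivAt_const (ν • u) y).add (hid.const_smul (inner ℝ a u : ℝ))).add
          (((hasFDerivAt_const a y).inner ℝ hid).smul_const u)).sub
          ((hid.inner ℝ (hasFDerivAt_const u y)).smul_const a))).sub (hasFDerivAt_const (w u) y))
      refine (h1.congr_fderiv ?_).congr_of_eventuallyEq (Eventually.of_forall fun X => ?_)
      · ext1 z
        refine ext_inner_right ℝ fun v => ?_
        have h2 := conformalKilling_sndFDeriv hB hY hh hK hy z u v
        rw [hdh y hy, ha, ha, ha] at h2
        simp [inner_sub_left, inner_add_left, inner_smul_left, h2]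
        ring
      · simp [P]
    have h1 := hB.is_const_of_fderiv_eq_zero hBc
      (fun y hy => (hd y hy).differentiableAt.differentiableWithinAt)
      (fun y hy => (hd y hy).fderiv) hX hz₀
    have h2 : w u = P z₀ u - fderiv ℝ Y z₀ u := rfl
    have h3 : fderiv ℝ Y z₀ u - (P z₀ u - w u) = 0 := by rw [h2]; abel
    simp only [h3] at h1
    exact sub_eq_zero.1 h1
  have hZ : ∀ y ∈ B, HasFDerivAt (fun y => Y y - Q y) (0 : Euc n →L[ℝ] Euc n) y := by
    intro y hy
    obtain ⟨Q', hQ', hQu⟩ := hQ y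
    have h1 := (((hY.contDiffAt (hB.mem_nhds hy)).differentiableAt (by simp)).hasFDerivAt).sub hQ'
    refine h1.congr_fderiv ?_
    ext1 u
    simp [hQu, hDY y hy]
  have h1 := hB.is_const_of_fderiv_eq_zero hBc
    (fun y hy => (hZ y hy).differentiableAt.differentiableWithinAt)
    (fun y hy => (hZ y hy).fderiv) hx hz₀
  change Y x - Q x = b at h1
  rw [← h1]; abel

end

/-! ### Conformally flat conformal Killing fields -/

/-- The image field has squared length `θ² γ(Y, Y) > 0`, so the target avoids its zeros. -/
theorem IsLocalConformal.subset_ne_zero {V W : Type*} [NormedAddCommGroup V] [NormedSpace ℝ V]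
    [NormedAddCommGroup W] [NormedSpace ℝ W] {U : Set V} {γ : V → V → V → ℝ} {U' : Set W}
    {γ' : W → W → W → ℝ} {φ : OpenPartialHomeomorph V W} {θ : V → ℝ}
    (h : IsLocalConformal U γ U' γ' φ θ) (hγ' : ∀ x v, γ' x 0 v = 0) {Y : V → V} {Y' : W → W}
    (hpos : ∀ x ∈ U, 0 < γ x (Y x) (Y x))
    (hY : ∀ x ∈ φ.source, fderiv ℝ φ x (Y x) = Y' (φ x)) :
    IsLocalConformal U γ {X | Y' X ≠ 0} γ' φ θ := by
  refine { h with target_subset := fun z hz hz0 => ?_ }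
  have hx := φ.map_target hz
  have h1 := h.pullback _ hx (Y (φ.symm z)) (Y (φ.symm z))
  rw [hY _ hx, φ.right_inv hz, hz0, hγ'] at h1
  exact (mul_pos (pow_pos (h.factor_pos _ hx) 2) (hpos _ (h.source_subset hx))).ne h1

theorem IsLocalConformal.restrOpen {V W : Type*} [NormedAddCommGroup V] [NormedSpace ℝ V]
    [NormedAddCommGroup W] [NormedSpace ℝ W] {U : Set V} {γ : V → V → V → ℝ} {U' : Set W}
    {γ' : W → W → W → ℝ} {φ : OpenPartialHomeomorph V W} {θ : V → ℝ}
    (h : IsLocalConformal U γ U' γ' φ θ) {s : Set V} (hs : IsOpen s)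
    (hne : (φ.source ∩ s).Nonempty) : IsLocalConformal U γ U' γ' (φ.restrOpen s hs) θ where
  source_nonempty := hne
  source_subset := inter_subset_left.trans h.source_subset
  target_subset := inter_subset_left.trans h.target_subset
  contDiffOn := h.contDiffOn.mono inter_subset_left
  contDiffOn_symm := h.contDiffOn_symm.mono inter_subset_left
  factor_contDiffOn := h.factor_contDiffOn.mono inter_subset_left
  factor_pos x hx := h.factor_pos x hx.1
  pullback x hx := h.pullback x hx.1

theorem IsLocalConformal.exists_restrict {V W : Type*} [NormedAddCommGroup V] [NormedSpace ℝ V]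
    [NormedAddCommGroup W] [NormedSpace ℝ W] {U : Set V} {γ : V → V → V → ℝ} {U' : Set W}
    {γ' : W → W → W → ℝ} {φ : OpenPartialHomeomorph V W} {θ : V → ℝ}
    (h : IsLocalConformal U γ U' γ' φ θ) {B : Set W} (hB : IsOpen B) {x₀ : V} (hx₀ : x₀ ∈ φ.source)
    (hx₀B : φ x₀ ∈ B) :
    ∃ e : OpenPartialHomeomorph V W, (e : V → W) = φ ∧ e.source ⊆ φ.source ∧
      (∀ x ∈ e.source, φ x ∈ B) ∧ IsLocalConformal U γ U' γ' e θ :=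
  ⟨φ.restrOpen (φ.source ∩ φ ⁻¹' B) (φ.isOpen_inter_preimage hB), rfl, inter_subset_left,
    fun _ hx => hx.2.2, h.restrOpen _ ⟨x₀, hx₀, hx₀, hx₀B⟩⟩

theorem IsKdSLikeData.contDiffOn_fderiv_field {n : ℕ} {U : Set (Euc n)}
    {γ : Euc n → Euc n →L[ℝ] Euc n →L[ℝ] ℝ} {Y : Euc n → Euc n} (hD : IsKdSLikeData n U γ Y)
    {φ : OpenPartialHomeomorph (Euc n) (Euc n)} {θ : Euc n → ℝ}
    (hφ : IsLocalConformal U (fun x u v => γ x u v) univ (flatMetric n) φ θ) :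
    ContDiffOn ℝ ∞ (fun x => fderiv ℝ φ x (Y x)) φ.source := fun _ hx =>
  ((contDiffAt_fderiv_of_contDiffOn φ.open_source hφ.contDiffOn hx).clm_apply
    (hD.field_contDiffOn.contDiffAt
      (hD.isOpen.mem_nhds (hφ.source_subset hx)))).contDiffWithinAt

theorem IsKdSLikeData.exists_conformalKilling_along {n : ℕ} {U : Set (Euc n)}
    {γ : Euc n → Euc n →L[ℝ] Euc n →L[ℝ] ℝ} {Y : Euc n → Euc n} (hD : IsKdSLikeData n U γ Y)
    {φ : OpenPartialHomeomorph (Euc n) (Euc n)} {θ : Euc n → ℝ}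
    (hφ : IsLocalConformal U (fun x u v => γ x u v) univ (flatMetric n) φ θ) :
    ∃ h : Euc n → ℝ, ∀ x ∈ φ.source, ∀ u v,
      inner ℝ (fderiv ℝ (fun x => fderiv ℝ φ x (Y x)) x u) (fderiv ℝ φ x v)
        + inner ℝ (fderiv ℝ φ x u) (fderiv ℝ (fun x => fderiv ℝ φ x (Y x)) x v)
        = 2 * h x * inner ℝ (fderiv ℝ φ x u) (fderiv ℝ φ x v) := by
  obtain ⟨f, hf⟩ := hD.conformalKilling
  -- Differentiating `⟨dφ u, dφ v⟩ = θ² γ(u, v)` along `Y` adds the logarithmic derivative of `θ` to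
  -- the original factor `f`.
  refine ⟨fun x => fderiv ℝ θ x (Y x) / θ x + f x, fun x hx u v => ?_⟩
  have hxU := hφ.source_subset hx
  have hYd : HasFDerivAt Y (fderiv ℝ Y x) x :=
    ((hD.field_contDiffOn.contDiffAt (hD.isOpen.mem_nhds hxU)).differentiableAt
      (by simp)).hasFDerivAt
  have hγd : HasFDerivAt γ (fderiv ℝ γ x) x :=
    ((hD.metric_contDiffOn.contDiffAt (hD.isOpen.mem_nhds hxU)).differentiableAt
      (by simp)).hasFDerivAt
  have hθd : HasFDerivAt θ (fderiv ℝ θ x) x :=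
    ((hφ.factor_contDiffOn.contDiffAt (φ.open_source.mem_nhds hx)).differentiableAt
      (by simp)).hasFDerivAt
  have hZu : ∀ u, fderiv ℝ (fun x => fderiv ℝ φ x (Y x)) x u =
      fderiv ℝ (fderiv ℝ φ) x u (Y x) + fderiv ℝ φ x (fderiv ℝ Y x u) := by
    intro u
    have h1 := (((contDiffAt_fderiv_of_contDiffOn φ.open_source hφ.contDiffOn
      hx).differentiableAt (by simp)).hasFDerivAt).clm_apply hYd
    rw [h1.fderiv]
    simp [add_comm]
  have hs : ∀ a b, fderiv ℝ (fderiv ℝ φ) x a b = fderiv ℝ (fderiv ℝ φ) x b a := fun a b =>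
    isSymmSndFDerivAt_of_contDiffOn φ.open_source hφ.contDiffOn hx a b
  have h1 := (hasFDerivAt_fderiv_apply φ.open_source hφ.contDiffOn hx u).inner ℝ
    (hasFDerivAt_fderiv_apply φ.open_source hφ.contDiffOn hx v)
  have h2 := (hθd.pow 2).mul ((hγd.clm_apply (hasFDerivAt_const u x)).clm_apply
    (hasFDerivAt_const v x))
  have h3 := h1.unique (h2.congr_of_eventuallyEq
    (by filter_upwards [φ.open_source.mem_nhds hx] with y hy using hφ.pullback y hy u v))
  have h4 := DFunLike.congr_fun h3 (Y x)
  have hp : ∀ a b, inner ℝ (fderiv ℝ φ x a) (fderiv ℝ φ x b) = θ x ^ 2 * γ x a b :=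
    hφ.pullback x hx
  have hk := hf x hxU u v
  have hθ := (hφ.factor_pos x hx).ne'
  simp at h4
  rw [hZu, hZu, inner_add_left, inner_add_right, hp, hp, hp, hs u, hs v]
  field_simp
  linear_combination h4 + θ x ^ 2 * hk

theorem IsKdSLikeData.exists_conformalKilling_pushforward {n : ℕ} {U : Set (Euc n)}
    {γ : Euc n → Euc n →L[ℝ] Euc n →L[ℝ] ℝ} {Y : Euc n → Euc n} (hD : IsKdSLikeData n U γ Y)
    {φ : OpenPartialHomeomorph (Euc n) (Euc n)} {θ : Euc n → ℝ}
    (hφ : IsLocalConformal U (fun x u v => γ x u v) univ (flatMetric n) φ θ) :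
    ∃ (V : Euc n → Euc n) (h : Euc n → ℝ), ContDiffOn ℝ ∞ V φ.target ∧
      (∀ x ∈ φ.source, fderiv ℝ φ x (Y x) = V (φ x)) ∧
      ∀ z ∈ φ.target, ∀ p q, inner ℝ (fderiv ℝ V z p) q + inner ℝ p (fderiv ℝ V z q) =
        2 * h z * inner ℝ p q := by
  obtain ⟨h, hZK⟩ := hD.exists_conformalKilling_along hφ
  have hZ := hD.contDiffOn_fderiv_field hφ
  let Z : Euc n → Euc n := fun x => fderiv ℝ φ x (Y x)
  let V : Euc n → Euc n := fun z => Z (φ.symm z)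
  refine ⟨V, fun z => h (φ.symm z),
    hZ.comp hφ.contDiffOn_symm fun z hz => φ.map_target hz, fun x hx => ?_, fun z hz p q => ?_⟩
  · simp only [V, Z, φ.left_inv hx]
  have hx := φ.map_target hz
  have hφd : HasFDerivAt φ (fderiv ℝ φ (φ.symm z)) (φ.symm z) :=
    ((hφ.contDiffOn.contDiffAt (φ.open_source.mem_nhds hx)).differentiableAt (by simp)).hasFDerivAt
  have hψ : HasFDerivAt φ.symm (fderiv ℝ φ.symm z) z :=
    ((hφ.contDiffOn_symm.contDiffAt (φ.open_target.mem_nhds hz)).differentiableAt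
      (by simp)).hasFDerivAt
  have hVz : HasFDerivAt V ((fderiv ℝ Z (φ.symm z)).comp (fderiv ℝ φ.symm z)) z :=
    HasFDerivAt.comp z ((hZ.contDiffAt (φ.open_source.mem_nhds hx)).differentiableAt
      (by simp)).hasFDerivAt hψ
  have hinv : ∀ p, fderiv ℝ φ (φ.symm z) (fderiv ℝ φ.symm z p) = p := by
    intro p
    have h1 := HasFDerivAt.comp z hφd hψ
    have h2 := h1.unique ((hasFDerivAt_id (𝕜 := ℝ) z).congr_of_eventuallyEq
      (by filter_upwards [φ.open_target.mem_nhds hz] with y hy using φ.right_inv hy))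
    exact DFunLike.congr_fun h2 p
  have h1 := hZK _ hx (fderiv ℝ φ.symm z p) (fderiv ℝ φ.symm z q)
  rw [hinv, hinv] at h1
  rw [hVz.fderiv]
  exact h1

/-- The flat chart is restricted to the preimage of a ball, because the Liouville argument needs a
connected domain. -/
theorem IsKdSLikeData.exists_isLocalConformal {n : ℕ} (hn : 3 ≤ n) {U : Set (Euc n)}
    {γ : Euc n → Euc n →L[ℝ] Euc n →L[ℝ] ℝ} {Y : Euc n → Euc n} (hD : IsKdSLikeData n U γ Y) :
    ∃ (F : SkewEnd n) (φ : OpenPartialHomeomorph (Euc n) (Euc n)) (θ : Euc n → ℝ),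
      IsLocalConformal U (fun x u v => γ x u v) univ (flatMetric n) φ θ ∧
      ∀ x ∈ φ.source, fderiv ℝ φ x (Y x) = ckvf F.1 (φ x) := by
  obtain ⟨x₀, hx₀⟩ := hD.isConnected.nonempty
  obtain ⟨φ, θ, hxs, hφ⟩ := hD.conformallyFlat x₀ hx₀
  obtain ⟨V, h, hV, hVφ, hVK⟩ := hD.exists_conformalKilling_pushforward hφ
  obtain ⟨r, hr, hball⟩ := Metric.isOpen_iff.1 φ.open_target (φ x₀) (φ.map_source hxs)
  obtain ⟨F, hF⟩ := exists_eq_ckvf_of_conformalKilling hn Metric.isOpen_ball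
    (convex_ball (φ x₀) r).isPreconnected ⟨_, Metric.mem_ball_self hr⟩ (hV.mono hball)
    (fun z hz => hVK z (hball hz))
  obtain ⟨e, he, hes, heB, hec⟩ := hφ.exists_restrict Metric.isOpen_ball hxs
    (Metric.mem_ball_self hr)
  refine ⟨F, e, θ, hec, fun x hx => ?_⟩
  rw [he, hVφ x (hes hx)]
  exact hF (φ x) (heB x hx)

end

noncomputable section

/-! ### Realization by Kerr-de Sitter data -/

theorem IsNormalFrame.exists_kdSRealizes {n : ℕ} (hn : 3 ≤ n) {lam : ℝ} (hlam : 0 < lam)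
    {F : SkewEnd n} {ν : ℝ} (hν : 0 < ν) {b : Fin (qNum n) → ℝ} (hb : ∀ i, b i ≠ 0)
    {T : FrameModel n →ₗ[ℝ] (MinkIdx n → ℝ)} (h : IsNormalFrame F.1 ν b T) (κ : ℝ) :
    ∃ (a : Fin (qNum n) → ℝ) (M : ℝ), (∀ i, a i ≠ 0) ∧ KdSRealizes lam a M κ F := by
  have hs := Real.sqrt_pos.2 hlam
  -- `c • ξ` has boost rate `c / √λ`, so `ν` determines `c`, and the rotation rates then determine
  -- `a`.
  let c := ν * Real.sqrt lam
  have hc : 0 < c := mul_pos hν hs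
  let a := c⁻¹ • b
  have hca : c • a = b := smul_inv_smul₀ hc.ne' b
  have hcν : c / Real.sqrt lam = ν := mul_div_cancel_right₀ ν hs.ne'
  have h' : IsNormalFrame F.1 (c / Real.sqrt lam) (c • a) T := by rwa [hca, hcν]
  obtain ⟨e, θ, he, hf⟩ := h'.exists_isLocalConformal_kds (by omega) hlam F.2
  have hn' : (3 : ℝ) ≤ n := by exact_mod_cast hn
  have hk : -(n : ℝ) * ((n : ℝ) - 2) * lam ^ (-(n : ℝ) / 2) ≠ 0 :=
    mul_ne_zero (mul_ne_zero (by linarith) (by linarith)) (Real.rpow_pos_of_pos hlam _).ne'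
  -- Solves `κ_M = κ / cⁿ`, the constant left after rescaling `c • ξ` to `ξ`.
  let M := κ / c ^ n / (-(n : ℝ) * ((n : ℝ) - 2) * lam ^ (-(n : ℝ) / 2))
  have hM : kdsKappa n lam M = κ / c ^ n := by
    have : kdsKappa n lam M = M * (-(n : ℝ) * ((n : ℝ) - 2) * lam ^ (-(n : ℝ) / 2)) := by
      rw [kdsKappa]; ring
    rw [this, div_mul_cancel₀ _ hk]
  refine ⟨a, M, fun i => mul_ne_zero (inv_ne_zero hc.ne') (hb i), ⟨c, hc, e, θ, he, hf⟩, ?_⟩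
  have he' := he.subset_ne_zero (Y := fun x => c • kdsField lam a x) (Y' := ckvf F.1)
    (fun x v => inner_zero_left v) (fun x hx => kdsGamma_pos hlam hx
      (smul_ne_zero hc.ne' fun h0 => (inv_ne_zero hlam.ne') (congrArg Prod.fst h0))) hf
  have hE := he'.equivalentData hf n κ
  have ht : ttTensor n κ (kdsGamma lam a) (fun x => c • kdsField lam a x) =
      ttTensor n (kdsKappa n lam M) (kdsGamma lam a) (kdsField lam a) := by
    rw [hM]
    funext x
    exact ttTensor_smul hc (kdsGamma_smul_left c) fun u v => by
      rw [kdsGamma_comm, kdsGamma_smul_left, kdsGamma_comm]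
  rwa [ht] at hE

theorem rMinus_zero_ne_zero {n : ℕ} {s : Fin (qNum n + 1) → ℝ} (hs : s ∈ RMinus n 0)
    (j : Fin (qNum n + 1)) (hj : 0 ≤ s j) : s j ≠ 0 := by
  obtain ⟨-, h0, -, -, hz⟩ := hs
  revert hj
  refine Fin.cases (fun hj => (not_le.2 h0 hj).elim) (fun i _ => ?_) j
  rw [Ne, hz i]
  simp

/-- From `F² v = ν² v`, either `(F + ν) v` is an eigenvector for `ν`, or `v` is one for `-ν` and the
symmetry of the spectrum applies. -/
theorem exists_eigenvector_of_sq {n : ℕ} {F : Matrix (MinkIdx n) (MinkIdx n) ℝ}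
    (hF : Fᵀ * minkEta n = -(minkEta n * F)) {ν : ℝ}
    (h : ((-(F * F)).charpoly).eval (-ν ^ 2) = 0) : ∃ v, v ≠ 0 ∧ F *ᵥ v = ν • v := by
  rw [Matrix.eval_charpoly, ← Matrix.exists_mulVec_eq_zero_iff] at h
  obtain ⟨v, hv, hv0⟩ := h
  have h1 : F *ᵥ (F *ᵥ v) = ν ^ 2 • v := by
    have h2 : (Matrix.scalar (MinkIdx n) (-ν ^ 2)) *ᵥ v = (-ν ^ 2) • v := by
      ext i; simp [Matrix.scalar_apply, Matrix.mulVec_diagonal]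
    rw [Matrix.sub_mulVec, h2, Matrix.neg_mulVec, ← Matrix.mulVec_mulVec, sub_neg_eq_add] at hv0
    rw [← sub_eq_zero, ← hv0]; module
  by_cases hu : F *ᵥ v + ν • v = 0
  · have h2 : F *ᵥ v = (-ν) • v := by
      rw [neg_smul]; exact eq_neg_of_add_eq_zero_left hu
    have := exists_eigenvector_neg hF ⟨v, hv, h2⟩
    rwa [neg_neg] at this
  · refine ⟨_, hu, ?_⟩
    rw [Matrix.mulVec_add, Matrix.mulVec_smul, h1]
    module

/-- The negative entry `s 0` is a root of the characteristic polynomial of `-F²`, which gives the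
real eigenvalue `√(-s 0)`. Each `b i ^ 2` is a root of `𝒬_{F²}`, hence an entry of `s`; being
non-negative it is not `s 0`, and the other entries are non-zero. -/
theorem HasParams.exists_isNormalFrame {n : ℕ} (hn : 1 ≤ n) {F : SkewEnd n}
    {s : Fin (qNum n + 1) → ℝ} (hs : s ∈ RMinus n 0) (h : HasParams F.1 s) :
    ∃ (ν : ℝ) (b : Fin (qNum n) → ℝ) (T : FrameModel n →ₗ[ℝ] (MinkIdx n → ℝ)),
      0 < ν ∧ (∀ i, b i ≠ 0) ∧ IsNormalFrame F.1 ν b T := by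
  obtain ⟨⟨Q, ⟨hQm, hQe, hQo⟩, hQr⟩, -⟩ := h
  have h0 : s 0 < 0 := hs.2.1
  have hroot : ∀ x, Q.eval x = 0 ↔ ∃ j, s j = x := by
    intro x
    have : x ∈ Q.roots ↔ Q.eval x = 0 := by
      rw [Polynomial.mem_roots hQm.ne_zero, Polynomial.IsRoot.def]
    rw [← this, hQr]
    simp only [Multiset.mem_map, Finset.mem_val, Finset.mem_univ, true_and]
  let ν := Real.sqrt (-s 0)
  have hν : 0 < ν := Real.sqrt_pos.2 (by linarith)
  have hν2 : -ν ^ 2 = s 0 := by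
    rw [Real.sq_sqrt (by linarith)]; ring
  have hchar : ((-(F.1 * F.1)).charpoly).eval (-ν ^ 2) = 0 := by
    have h1 := (hroot (s 0)).2 ⟨0, rfl⟩
    rw [hν2]
    rcases Nat.even_or_odd n with he | ho
    · rw [← hQe he]; simp [h1]
    · rw [← hQo ho]; simp [h1]
  obtain ⟨b, T, hT⟩ := exists_isNormalFrame_of_eigenvector hn F.2 hν.ne'
    (exists_eigenvector_of_sq F.2 hchar)
  refine ⟨ν, b, T, hν, fun i hi => ?_, hT⟩
  have hP := hT.charpoly_neg_mul_self hn
  have hz : Q ^ 2 = ((Polynomial.X + Polynomial.C (ν ^ 2)) *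
      ∏ i, (Polynomial.X - Polynomial.C (b i ^ 2))) ^ 2 := by
    rcases Nat.even_or_odd n with he | ho
    · have : pNum n + 1 - qNum n = 0 := by
        obtain ⟨k, rfl⟩ := he
        unfold pNum qNum; omega
      rw [hQe he, hP, this, pow_zero, mul_one]
    · have : pNum n + 1 - qNum n = 1 := by
        obtain ⟨k, rfl⟩ := ho
        unfold pNum qNum; omega
      rw [← hQo ho, this, pow_one, mul_comm] at hP
      exact mul_right_cancel₀ Polynomial.X_ne_zero hP
  have hz' := congrArg (Polynomial.eval (b i ^ 2)) hz
  have hprod : ∏ j, (b i ^ 2 - b j ^ 2) = 0 :=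
    Finset.prod_eq_zero (Finset.mem_univ i) (sub_self _)
  simp only [Polynomial.eval_pow, Polynomial.eval_mul, Polynomial.eval_prod, Polynomial.eval_sub,
    Polynomial.eval_X, Polynomial.eval_C, hprod, mul_zero] at hz'
  obtain ⟨j, hj⟩ := (hroot _).1 (by simpa using hz')
  exact rMinus_zero_ne_zero hs j (hj ▸ sq_nonneg _) (by rw [hj, hi]; simp)

/-! ### Even dimension: generic endomorphisms -/

/-- On the segment from `1` to `A` a kernel vector `v` would satisfy `(1 - s) |v|² = 0`, since `vᵀ A
v = 0`. The determinant thus cannot change sign before reaching `A`. -/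
theorem det_nonneg_of_transpose_eq_neg {ι : Type*} [Fintype ι] [DecidableEq ι] {A : Matrix ι ι ℝ}
    (hA : Aᵀ = -A) : 0 ≤ A.det := by
  by_contra! hneg
  let f : ℝ → ℝ := fun s => (s • A + (1 - s) • (1 : Matrix ι ι ℝ)).det
  have hf : Continuous f := Continuous.matrix_det (by fun_prop)
  have hf0 : f 0 = 1 := by simp [f]
  have hf1 : f 1 = A.det := by simp [f]
  obtain ⟨s, hs, hs0⟩ := intermediate_value_Icc' zero_le_one hf.continuousOn
    (show (0 : ℝ) ∈ Icc (f 1) (f 0) by rw [hf0, hf1]; exact ⟨hneg.le, zero_le_one⟩)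
  obtain ⟨v, hv, hv0⟩ := Matrix.exists_mulVec_eq_zero_iff.2 hs0
  have h1 : v ⬝ᵥ (A *ᵥ v) = 0 := by
    have h2 : v ⬝ᵥ (A *ᵥ v) = v ⬝ᵥ (Aᵀ *ᵥ v) := by
      rw [Matrix.mulVec_transpose, dotProduct_comm v (v ᵥ* A), Matrix.dotProduct_mulVec]
    rw [hA, Matrix.neg_mulVec, dotProduct_neg] at h2
    linarith
  have h2 := congrArg (v ⬝ᵥ ·) hv0
  simp only [Matrix.add_mulVec, Matrix.smul_mulVec, Matrix.one_mulVec, dotProduct_add,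
    dotProduct_smul, h1, smul_eq_mul, mul_zero, zero_add, dotProduct_zero] at h2
  have h3 : v ⬝ᵥ v ≠ 0 := fun h => hv (dotProduct_self_eq_zero.1 h)
  have h4 : s = 1 := by
    have := (mul_eq_zero.1 h2).resolve_right h3
    linarith
  rw [h4, hf1] at hs0
  exact hneg.ne hs0

theorem det_neg_of_skew {n : ℕ} {F : Matrix (MinkIdx n) (MinkIdx n) ℝ}
    (hF : Fᵀ * minkEta n = -(minkEta n * F)) (h0 : F.det ≠ 0) : F.det < 0 := by
  have h1 : (minkEta n * F)ᵀ = -(minkEta n * F) := by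
    rw [Matrix.transpose_mul, minkEta_transpose, hF]
  have h2 := det_nonneg_of_transpose_eq_neg h1
  have h3 : (minkEta n).det = -1 := by
    rw [minkEta, Matrix.det_diagonal, Finset.prod_ite_eq' Finset.univ (Sum.inl 0) fun _ => (-1 : ℝ)]
    simp
  rw [Matrix.det_mul, h3] at h2
  exact lt_of_le_of_ne (by linarith) h0

/-- In even dimension the characteristic polynomial has value `det F < 0` at `0` and tends to `+∞`,
so it has a positive root. -/
theorem exists_pos_eigenvalue {n : ℕ} (he : Even n) {F : Matrix (MinkIdx n) (MinkIdx n) ℝ}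
    (hF : Fᵀ * minkEta n = -(minkEta n * F)) (h0 : F.det ≠ 0) :
    ∃ ν : ℝ, 0 < ν ∧ ∃ v, v ≠ 0 ∧ F *ᵥ v = ν • v := by
  have hneg := det_neg_of_skew hF h0
  have hcard : Fintype.card (MinkIdx n) = 2 + n := by simp
  have hp0 : F.charpoly.eval 0 < 0 := by
    rw [Matrix.eval_charpoly]
    simp only [map_zero, zero_sub, Matrix.det_neg, hcard]
    rwa [Even.neg_one_pow (by simpa [Nat.even_add] using he), one_mul]
  have hlim : Tendsto (fun x => F.charpoly.eval x) atTop atTop := by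
    refine Polynomial.tendsto_atTop_of_leadingCoeff_nonneg _ ?_ ?_
    · rw [Matrix.charpoly_degree_eq_dim, hcard]
      exact_mod_cast (by omega : 0 < 2 + n)
    · rw [F.charpoly_monic.leadingCoeff]; exact zero_le_one
  obtain ⟨R, hR, hR0⟩ := ((hlim.eventually_gt_atTop 0).and (eventually_gt_atTop 0)).exists
  obtain ⟨ν, hν, hν0⟩ := intermediate_value_Icc hR0.le (F.charpoly.continuous.continuousOn)
    (show (0 : ℝ) ∈ _ from ⟨hp0.le, hR.le⟩)
  refine ⟨ν, lt_of_le_of_ne hν.1 ?_, ?_⟩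
  · rintro rfl
    exact hp0.ne hν0
  · simp only [Matrix.eval_charpoly] at hν0
    rw [exists_eigenvector_iff_det, ← neg_sub, Matrix.det_neg]
    have : ν • (1 : Matrix (MinkIdx n) (MinkIdx n) ℝ) = Matrix.scalar (MinkIdx n) ν := by
      rw [Matrix.scalar_apply, Matrix.smul_one_eq_diagonal]
    rw [this, hν0, mul_zero]

theorem exists_isNormalFrame_of_det_ne_zero {n : ℕ} (hn : 1 ≤ n) (he : Even n) {F : SkewEnd n}
    (h0 : F.1.det ≠ 0) :
    ∃ (ν : ℝ) (b : Fin (qNum n) → ℝ) (T : FrameModel n →ₗ[ℝ] (MinkIdx n → ℝ)),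
      0 < ν ∧ (∀ i, b i ≠ 0) ∧ IsNormalFrame F.1 ν b T := by
  obtain ⟨ν, hν, hv⟩ := exists_pos_eigenvalue he F.2 h0
  obtain ⟨b, T, hT⟩ := exists_isNormalFrame_of_eigenvector hn F.2 hν.ne' hv
  refine ⟨ν, b, T, hν, fun i hi => h0 ?_, hT⟩
  -- A vanishing rotation rate would put this vector in the kernel of `F`.
  let z : FrameModel n := (0, 0, Pi.single (Sum.inl (Sum.inl i)) 1)
  have hz : z ≠ 0 := by
    intro h
    have := congrFun (congrArg (fun z : FrameModel n => z.2.2) h) (Sum.inl (Sum.inl i))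
    simp [z] at this
  have hact : modelAct ν b z = 0 := by
    refine Prod.ext (by simp [modelAct, z]) (Prod.ext (by simp [modelAct, z]) ?_)
    funext j
    rcases j with (j | j) | j
    · simp [modelAct, z]
    · by_cases hj : j = i
      · subst hj; simp [modelAct, hi]
      · simp [modelAct, z, hj]
    · simp [modelAct]
  refine Matrix.exists_mulVec_eq_zero_iff.1 ⟨T z, fun h => hz ?_, ?_⟩
  · exact injective_of_isometry hT.inner (h.trans (map_zero T).symm)
  · rw [hT.act, hact, map_zero]

theorem exists_det_ne_zero {n : ℕ} (hn : 1 ≤ n) (he : Even n) : ∃ F : SkewEnd n, F.1.det ≠ 0 := by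
  obtain ⟨F, T, hT⟩ := exists_isNormalFrame hn 1 (1 : Fin (qNum n) → ℝ)
  refine ⟨F, fun h0 => ?_⟩
  have h1 := congrArg (Polynomial.eval 0) (hT.charpoly_neg_mul_self hn)
  have : pNum n + 1 - qNum n = 0 := by
    obtain ⟨k, rfl⟩ := he
    unfold pNum qNum; omega
  rw [Matrix.eval_charpoly, this] at h1
  simp [h0, Matrix.det_mul] at h1
  exact absurd h1.symm (pow_ne_zero _ (pow_ne_zero _ (by norm_num)))

/-- Perturb by `ε F₀` with `F₀` invertible: the determinant is `det F₀` times a monic polynomial in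
`ε`, non-zero for all small `ε ≠ 0`. -/
theorem exists_seq_tendsto_det_ne_zero {n : ℕ} (hn : 1 ≤ n) (he : Even n) (F : SkewEnd n) :
    ∃ G : ℕ → SkewEnd n, (∀ k, (G k).1.det ≠ 0) ∧ Tendsto G atTop (𝓝 F) := by
  obtain ⟨F₀, h0⟩ := exists_det_ne_zero hn he
  have hu : IsUnit F₀.1.det := isUnit_iff_ne_zero.2 h0
  let p := (-(F₀.1⁻¹ * F.1)).charpoly
  have hdet : ∀ ε : ℝ, (F.1 + ε • F₀.1).det = F₀.1.det * p.eval ε := by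
    intro ε
    rw [Matrix.eval_charpoly, ← Matrix.det_mul]
    congr 1
    rw [sub_neg_eq_add, Matrix.mul_add, ← Matrix.mul_assoc, Matrix.mul_nonsing_inv _ hu,
      Matrix.one_mul, add_comm, Matrix.scalar_apply, ← Matrix.smul_one_eq_diagonal,
      Matrix.mul_smul, Matrix.mul_one]
  have hfin : {ε : ℝ | p.eval ε = 0}.Finite := by
    refine (p.roots.toFinset.finite_toSet).subset fun ε hε => ?_
    simpa [(Matrix.charpoly_monic _).ne_zero, p] using hε
  have hev : ∀ᶠ ε in 𝓝[≠] (0 : ℝ), p.eval ε ≠ 0 :=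
    nhdsNE_le_cofinite (0 : ℝ) hfin.compl_mem_cofinite
  obtain ⟨ε, hε, hε0⟩ := exists_seq_forall_of_frequently hev.frequently
  refine ⟨fun k => ⟨F.1 + ε k • F₀.1, ?_⟩, fun k => ?_, ?_⟩
  · rw [Matrix.transpose_add, Matrix.transpose_smul, Matrix.add_mul, Matrix.mul_add, F.2,
      Matrix.smul_mul, F₀.2, Matrix.mul_smul, smul_neg, neg_add]
  · change (F.1 + ε k • F₀.1).det ≠ 0
    rw [hdet]
    exact mul_ne_zero h0 (hε0 k)
  · rw [tendsto_subtype_rng]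
    have := (tendsto_nhdsWithin_iff.1 hε).1
    simpa using (tendsto_const_nhds (x := F.1)).add (this.smul_const F₀.1)

/-! ### Main result -/

/-- The zeros of a decreasing non-negative list form a final segment, whose length is their number.
-/
theorem eq_zero_iff_of_antitone {q : ℕ} {g : Fin q → ℝ} (hg : Antitone g) (h0 : ∀ i, 0 ≤ g i)
    (i : Fin q) : g i = 0 ↔ q - Nat.card {i // g i = 0} ≤ (i : ℕ) := by
  classical
  rw [Nat.card_eq_fintype_card, Fintype.card_subtype]
  have hq : (Finset.univ.filter fun i => g i = 0).card +
      (Finset.univ.filter fun i => ¬ g i = 0).card = q := by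
    rw [Finset.card_filter_add_card_filter_not]; simp
  have hi := i.2
  constructor
  · intro h
    have h1 : Finset.Ici i ⊆ Finset.univ.filter fun i => g i = 0 := fun j hj => by
      simpa using le_antisymm (h ▸ hg (Finset.mem_Ici.1 hj)) (h0 j)
    have h2 := Finset.card_le_card h1
    rw [Fin.card_Ici] at h2
    omega
  · intro h
    by_contra hne
    have h1 : Finset.Iic i ⊆ Finset.univ.filter fun i => ¬ g i = 0 := fun j hj => by
      have h2 := hg (Finset.mem_Iic.1 hj)
      have h3 := lt_of_le_of_ne (h0 i) (Ne.symm hne)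
      simpa using (h3.trans_le h2).ne'
    have h2 := Finset.card_le_card h1
    rw [Fin.card_Iic] at h2
    omega

theorem cons_mem_rMinus {n : ℕ} {lam : ℝ} (hlam : 0 < lam) (a : Fin (qNum n) → ℝ)
    (τ : Equiv.Perm (Fin (qNum n))) (ha : Antitone fun i => a (τ i) ^ 2) :
    (Fin.cons (-lam⁻¹) fun i => a (τ i) ^ 2) ∈ RMinus n (Nat.card {i // a i = 0}) := by
  have hcard : Nat.card {i // a i = 0} = Nat.card {i // a (τ i) ^ 2 = 0} :=
    (Nat.card_congr (τ.subtypeEquiv fun i => by simp)).symm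
  refine ⟨?_, ?_, ?_, fun i => ?_, fun i => ?_⟩
  · simpa using Finite.card_subtype_le fun i => a i = 0
  · simpa using hlam
  · simpa using ha
  · simpa using sq_nonneg _
  · rw [hcard, Fin.cons_succ]
    exact eq_zero_iff_of_antitone ha (fun i => sq_nonneg _) i

end

theorem proposition5p2 (n : ℕ) (hn : 3 ≤ n) (lam : ℝ) (hlam : 0 < lam) :
    -- the boundary metric and the field of the data are those of the Kerr-de Sitter metric
    (∀ (a : Fin (qNum n) → ℝ) (M : ℝ), ∀ x ∈ kdsDomain n, ∀ u v : ScriCoord n,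
      Tendsto (fun ρ : ℝ => ρ ^ 2 * kdsMetric lam a M ρ x (0, u) (0, v)) (𝓝[>] 0)
        (𝓝 (kdsGamma lam a x u v)) ∧
      Tendsto (fun ρ : ℝ => kdsK lam a ρ x (0, u)) (𝓝[>] 0)
        (𝓝 (kdsGamma lam a x (kdsField lam a x) u))) ∧
    -- with `m` vanishing rotation parameters the class lies in `ℛ₋^{(n,m)}`
    (∀ (a : Fin (qNum n) → ℝ) (τ : Equiv.Perm (Fin (qNum n))) (m : ℕ),
      Antitone (fun i => a (τ i) ^ 2) → m = Nat.card {i // a i = 0} →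
      ∃ F : SkewEnd n,
        SameConformalClass (kdsDomain n) (kdsGamma lam a) (kdsField lam a)
          univ (flatMetric n) (ckvf F.1) ∧
        ClassHasParams (Quot.mk _ F) (Fin.cons (-lam⁻¹) fun i => a (τ i) ^ 2) ∧
        (Fin.cons (-lam⁻¹) fun i => a (τ i) ^ 2) ∈ RMinus n m) ∧
    -- with non-zero rotation parameters the family covers `ℛ₋^{(n,0)}`
    (∀ s ∈ RMinus n 0,
      (∃ F : SkewEnd n, ClassHasParams (Quot.mk _ F) s) ∧
      ∀ F : SkewEnd n, HasParams F.1 s → ∀ κ : ℝ,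
        ∃ (a : Fin (qNum n) → ℝ) (M : ℝ), (∀ i, a i ≠ 0) ∧ KdSRealizes lam a M κ F) ∧
    -- for `n` even, Kerr-de Sitter data and their limits cover all Kerr-de Sitter-like data
    (Even n → ∀ (U : Set (Euc n)) (γ : Euc n → Euc n →L[ℝ] Euc n →L[ℝ] ℝ) (Y : Euc n → Euc n),
      IsKdSLikeData n U γ Y → ∀ κ : ℝ,
      ∃ F : SkewEnd n,
        SameConformalClass U (fun x u v => γ x u v) Y univ (flatMetric n) (ckvf F.1) ∧
        EquivalentData n U (fun x u v => γ x u v) (ttTensor n κ (fun x u v => γ x u v) Y)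
          {X | ckvf F.1 X ≠ 0} (flatMetric n) (ttTensor n κ (flatMetric n) (ckvf F.1)) ∧
        ∃ (G : ℕ → SkewEnd n) (a : ℕ → Fin (qNum n) → ℝ) (M : ℕ → ℝ),
          (∀ k, (∀ i, a k i ≠ 0) ∧ KdSRealizes lam (a k) (M k) κ (G k)) ∧
          Tendsto G atTop (𝓝 F) ∧
          Tendsto (fun k => (Quot.mk _ (G k) : ConfClass n)) atTop
            (𝓝 (Quot.mk _ F : ConfClass n))) := by
  have hn1 : 1 ≤ n := by omega
  refine ⟨fun a M x hx u v => ⟨tendsto_sq_mul_kdsMetric hn hlam M hx u v, tendsto_kdsK hlam hx u⟩,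
    fun a τ m ha hm => ?_, fun s hs => ⟨?_, fun F hF κ => ?_⟩, fun he U γ Y hD κ => ?_⟩
  -- These are the rates of `ξ` itself, that is `c = 1`.
  · obtain ⟨F, T, hT⟩ := exists_isNormalFrame hn1 (1 / Real.sqrt lam) a
    have hT' : IsNormalFrame F.1 (1 / Real.sqrt lam) ((1 : ℝ) • a) T := by rwa [one_smul]
    obtain ⟨e, θ, hc, hf⟩ := hT'.exists_isLocalConformal_kds hn1 hlam F.2
    simp only [one_smul] at hf
    have hν : -(1 / Real.sqrt lam) ^ 2 = -lam⁻¹ := by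
      rw [div_pow, Real.sq_sqrt hlam.le, one_pow, one_div]
    have hp := hT.classHasParams hn1 (one_div_pos.2 (Real.sqrt_pos.2 hlam)).ne' τ ha
    rw [hν] at hp
    exact ⟨F, ⟨e, θ, hc, hf⟩, hp, hm ▸ cons_mem_rMinus hlam a τ ha⟩
  · obtain ⟨F, T, hT⟩ := exists_isNormalFrame hn1 (Real.sqrt (-s 0))
      (fun i => Real.sqrt (s i.succ))
    have h0 : s 0 < 0 := hs.2.1
    have hsq : ∀ i : Fin (qNum n), Real.sqrt (s i.succ) ^ 2 = s i.succ := fun i =>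
      Real.sq_sqrt (hs.2.2.2.1 i)
    have hp := hT.classHasParams hn1 (Real.sqrt_pos.2 (by linarith)).ne' (Equiv.refl _)
      (by simpa [hsq] using hs.2.2.1)
    have hcons : (Fin.cons (-Real.sqrt (-s 0) ^ 2)
        fun i => Real.sqrt (s (Equiv.refl (Fin (qNum n)) i).succ) ^ 2) = s := by
      funext j
      refine Fin.cases ?_ (fun i => ?_) j
      · rw [Fin.cons_zero, Real.sq_sqrt (by linarith)]; ring
      · simp [hsq]
    rw [hcons] at hp
    exact ⟨F, hp⟩
  · obtain ⟨ν, b, T, hν, hb, hT⟩ := hF.exists_isNormalFrame hn1 hs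
    exact hT.exists_kdSRealizes hn hlam hν hb κ
  · obtain ⟨F, φ, θ, hφ, hf⟩ := hD.exists_isLocalConformal hn
    obtain ⟨G, hG0, hG⟩ := exists_seq_tendsto_det_ne_zero hn1 he F
    have hreal : ∀ k, ∃ (a : Fin (qNum n) → ℝ) (M : ℝ), (∀ i, a i ≠ 0) ∧
        KdSRealizes lam a M κ (G k) := by
      intro k
      obtain ⟨ν, b, T, hν, hb, hT⟩ := exists_isNormalFrame_of_det_ne_zero hn1 he (hG0 k)
      exact hT.exists_kdSRealizes hn hlam hν hb κ
    choose a M haM using hreal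
    have hφ' := hφ.subset_ne_zero (Y := Y) (Y' := ckvf F.1) (fun x v => inner_zero_left v)
      (fun x hx => hD.metric_pos x hx _ (hD.field_ne_zero x hx)) hf
    exact ⟨F, ⟨φ, θ, hφ, hf⟩, hφ'.equivalentData hf n κ, G, a, M, haM, hG,
      (continuous_quot_mk.tendsto F).comp hG⟩
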